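/- **Setting.** Let $\mathfrak{so}(4)$ be the skew real $4\times4$ matrices. Identify $\mathfrak{so}(4)^*$ with skew matrices through $\langle b,\omega\rangle=\tfrac12\sum_{i,j} b_{ij}\omega_{ij}$ and $\mathbb R^{4*}$ with $\mathbb R^4$ through the dot product. In $\mathfrak{iso}(4)\ltimes\mathfrak{iso}(4)^*$ one has $[\omega,x]=\omega x=-[x,\omega]$ for $\omega\in\mathfrak{so}(4)$, $x\in\mathbb R^4$, and for $V\in\mathbb R^{4*}$ the bracket $[V,x]=xV^{T}-Vx^{T}\in\mathfrak{so}(4)^*$ is the one for which the pairing is invariant. Rotations act by conjugation on matrices and by $hvh^{-1}:=h\,v$ on $\mathbb R^4$, $\mathbb R^{4*}$. Let $M$ be a closed smooth 3-manifold with a finite, coherently oriented decomposition into smoothly embedded tetrahedra $c^*$ such that every triangle is a face of exactly two tetrahedra. To each triangle belongs an oriented dual link $(cc')$; the triangle $(cc')^*$ is oriented as part of $\partial c^*$. For each $c$ let there be given near $c^*$ smooth fields $g_c$ (an $\mathrm{SO}(4)$-valued function), $c_c$ (an $\mathbb R^4$-valued function), $\sigma_c$ (an $\mathbb R^{4*}$-valued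 1-form) and $b_c$ (an $\mathfrak{so}(4)^*$-valued 1-form), depending smoothly on a parameter $t\in\mathbb R$; $\delta$ denotes $\frac{d}{dt}\big|_{t=0}$. The corresponding on-shell fields in $c^*$ are $$A_c=g_c^{-1}dg_c,\quad C_c=g_c^{-1}dc_c\,g_c,\quad \Sigma_c=g_c^{-1}d\sigma_c\,g_c,\quad B_c=g_c^{-1}(db_c+[d\sigma_c,c_c])g_c .$$ Assume that, for every $t$ and every link $(cc')$, the restrictions to the triangle $(cc')^*$ of $A_c,B_c,C_c,\Sigma_c$ agree with those of $A_{c'},B_{c'},C_{c'},\Sigma_{c'}$. Let $$\Theta_{BFCG}=\sum_c\Big(\int_{c^*}\langle B_c\wedge\delta A_c\rangle-\int_{c^*}\langle C_c\wedge\delta\Sigma_c\rangle\Big).$$ **Proposition.** 1. For every link $(cc')$ and every $t$ there are unique constants $h_{cc'}\in\mathrm{SO}(4)$ and $x_c^{c'}\in\mathbb R^4$ such that $g_c=h_{cc'}g_{c'}$ and $c_{c'}=h_{cc'}^{-1}(c_c+x_c^{c'})h_{cc'}$ on $(cc')^*$. They are smooth in $t$, and on $(cc')^*$ one has $d\sigma_{c'}=h_{cc'}^{-1}d\sigma_c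 h_{cc'}$ and $db_{c'}=h_{cc'}^{-1}(db_c-[d\sigma_c,x_c^{c'}])h_{cc'}$. 2. Put $\Delta g_c=\delta g_c\,g_c^{-1}$, $\Delta h_{(cc')}=\delta h_{cc'}\,h_{cc'}^{-1}$, and let the link carry $h_{(cc')}=h_{cc'}$, $x_{(cc')}=x_c^{c'}$ and its dual triangle $b_{(cc')^*}=\int_{(cc')^*}db_c\in\mathfrak{so}(4)^*$, $V_{(cc')^*}=\int_{(cc')^*}d\sigma_c\in\mathbb R^{4*}$; these are differentiable in $t$. Then $$\Theta_{BFCG}=\sum_c\int_{\partial c^*}\big(\langle db_c,\Delta g_c\rangle+\langle[d\sigma_c,c_c],\Delta g_c\rangle-\langle c_c,d\delta\sigma_c\rangle\big)$$ $$=\sum_{(cc')}\Big(\langle\Delta h_{(cc')},b_{(cc')^*}\rangle+\langle[\Delta h_{(cc')},x_{(cc')}],V_{(cc')^*}\rangle+\langle x_{(cc')},\delta V_{(cc')^*}\rangle\Big).$$ 3. Each summand is a potential of the phase space $T^*\mathrm{ISO}(4)$, and it differs from the one of the BF discretization only by the sign of the $(x,V)$ sector. Precisely, on $\mathrm{SO}(4)\times\mathbb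 R^4\times\mathfrak{so}(4)^*\times\mathbb R^{4*}\ni(h,x,b,V)$, with $\Delta h=\delta h\,h^{-1}$, consider the one-forms $$\theta'=\langle\Delta h,b\rangle+\langle[\Delta h,x],V\rangle+\langle x,\delta V\rangle,\qquad \theta_{BF}=\langle b,\Delta h\rangle+\langle V,\delta x\rangle+\langle V,[x,\Delta h]\rangle .$$ Then $\theta_{BF}=\langle\beta,\delta\mathcal G\,\mathcal G^{-1}\rangle$ is the canonical one-form of $T^*\mathrm{ISO}(4)\cong\mathrm{ISO}(4)\times\mathfrak{iso}(4)^*$ at $\mathcal G=e^xh$, $\beta=b+V$. With $\kappa(h,x,b,V)=(h,x,b,-V)$ one has $\theta'=\kappa^*\theta_{BF}+\delta\langle x,V\rangle$, hence $\delta\theta'=\kappa^*\delta\theta_{BF}$, and this two-form is non-degenerate. -/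

import Mathlib

open Set MeasureTheory Matrix
open scoped Manifold ContDiff

attribute [local instance] Matrix.normedAddCommGroup Matrix.normedSpace
attribute [-instance] instTopologicalSpaceMatrix Matrix.instUniformSpace

noncomputable section

namespace BFCG

/-! ### The Lie algebra data

`so(4)` is the space of skew matrices, `so(4)*` is identified with skew matrices through
`⟨b, α⟩ = ½ ∑ b_{ij} α_{ij}`, and `ℝ⁴*` with `ℝ⁴` through the dot product. In the double
`iso(4) ⋉ iso(4)*`, `[α, x] = α x` for `α ∈ so(4)`, `x ∈ ℝ⁴`, and the mixed bracket
`[V, x] ∈ so(4)*` of `V ∈ ℝ⁴*` and `x ∈ ℝ⁴` is fixed by the invariance of the pairing. -/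

abbrev Mat4 : Type := Matrix (Fin 4) (Fin 4) ℝ
abbrev R4 : Type := Fin 4 → ℝ
abbrev SO4 : Type := Matrix.specialOrthogonalGroup (Fin 4) ℝ

/-- The pairing of `so(4)*` with `so(4)`. -/
def pairSo (b α : Mat4) : ℝ := (1 / 2) * (bᵀ * α).trace

/-- The bracket `[V, x] ∈ so(4)*` of `V ∈ ℝ⁴*` and `x ∈ ℝ⁴`. -/
def mixedBracket (V x : R4) : Mat4 := vecMulVec x V - vecMulVec V x

/-- Invariance of the pairing: `⟨[V, x], α⟩ = ⟨V, [x, α]⟩`, where `[x, α] = -α x`. -/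
theorem pairSo_mixedBracket (V x : R4) (α : Mat4) (hα : αᵀ = -α) :
    pairSo (mixedBracket V x) α = V ⬝ᵥ (-(α *ᵥ x)) := by
  have h : ∀ i j, α i j = -α j i := fun i j => by
    have := congrFun (congrFun hα j) i
    simpa using this
  have h0 : ∀ i, α i i = 0 := fun i => by have := h i i; linarith
  simp only [pairSo, mixedBracket, trace, diag, mul_apply, transpose_apply, Matrix.sub_apply,
    vecMulVec_apply, dotProduct, mulVec, Pi.neg_apply, Fin.sum_univ_four, h0]
  rw [h 1 0, h 2 0, h 3 0, h 2 1, h 3 1, h 3 2]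
  ring

/-! ### Standard simplices and integration over them -/

/-- The standard `k`-simplex in `ℝᵏ`, with vertices `0, e₀, …, e_{k-1}`. -/
def stdCell (k : ℕ) : Set (Fin k → ℝ) := {s | (∀ i, 0 ≤ s i) ∧ ∑ i, s i ≤ 1}

/-- The ordered vertices of the standard simplex. -/
def stdVertex (k : ℕ) : Fin (k + 1) → (Fin k → ℝ) :=
  Fin.cons 0 (fun i => Pi.single i 1)

/-- The affine map that sends the ordered vertices of the standard `k`-simplex to `v`. -/
def affineSimplex {F : Type*} [AddCommGroup F] [Module ℝ F] {k : ℕ} (v : Fin (k + 1) → F)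
    (s : Fin k → ℝ) : F :=
  v 0 + ∑ i, s i • (v i.succ - v 0)

/-- The `i`-th face (opposite to the `i`-th vertex) of the standard tetrahedron, parametrized by
the standard triangle. -/
def face (i : Fin 4) : (Fin 2 → ℝ) → (Fin 3 → ℝ) :=
  affineSimplex (stdVertex 3 ∘ i.succAbove)

/-! ### Differential forms on a 3-manifold -/

section Forms

variable {M : Type*} [TopologicalSpace M] [ChartedSpace (EuclideanSpace ℝ (Fin 3)) M]

/-- `V`-valued `k`-forms on `M`. -/
abbrev Form (M : Type*) [TopologicalSpace M] [ChartedSpace (EuclideanSpace ℝ (Fin 3)) M]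
    (k : ℕ) (V : Type*) [NormedAddCommGroup V] [NormedSpace ℝ V] :=
  (x : M) → (TangentSpace (𝓡 3) x) [⋀^Fin k]→L[ℝ] V

/-- The values on tangent vectors of a `V`-valued `k`-form on `M`. -/
abbrev FormValues (M : Type*) [TopologicalSpace M] [ChartedSpace (EuclideanSpace ℝ (Fin 3)) M]
    (k : ℕ) (V : Type*) :=
  (x : M) → (Fin k → TangentSpace (𝓡 3) x) → V

/-- The pullback of a form on `M` along `f : F → M`. -/
def pullback {F : Type*} [NormedAddCommGroup F] [NormedSpace ℝ F] {k : ℕ} {V : Type*}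
    [NormedAddCommGroup V] [NormedSpace ℝ V] (f : F → M) (α : Form M k V) :
    F → F [⋀^Fin k]→L[ℝ] V :=
  fun y => (α (f y)).compContinuousLinearMap (mfderiv 𝓘(ℝ, F) (𝓡 3) f y)

/-- The differential of a function on `M`. -/
def dFun {V : Type*} [NormedAddCommGroup V] [NormedSpace ℝ V] (f : M → V) : FormValues M 1 V :=
  fun x u => mfderiv (𝓡 3) 𝓘(ℝ, V) f x (u 0)

/-- The exterior derivative of a form on `M`, computed at `x` in the preferred chart at `x`. -/
def extd {k : ℕ} {V : Type*} [NormedAddCommGroup V] [NormedSpace ℝ V] (α : Form M k V) :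
    Form M (k + 1) V :=
  fun x => (extDeriv (pullback (extChartAt (𝓡 3) x).symm α)
    (extChartAt (𝓡 3) x x)).compContinuousLinearMap
      (mfderiv (𝓡 3) 𝓘(ℝ, EuclideanSpace ℝ (Fin 3)) (extChartAt (𝓡 3) x) x)

/-- A one-parameter family of forms is jointly smooth, in the parameter and the point of `M`,
at `(t, x)`. -/
def SmoothFormFamilyAt {k : ℕ} {V : Type*} [NormedAddCommGroup V] [NormedSpace ℝ V]
    (α : ℝ → Form M k V) (t : ℝ) (x : M) : Prop :=
  ContDiffAt ℝ ∞ (fun q : ℝ × EuclideanSpace ℝ (Fin 3) =>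
    pullback (extChartAt (𝓡 3) x).symm (α q.1) q.2) (t, extChartAt (𝓡 3) x x)

/-- A one-parameter family of functions is jointly smooth, in the parameter and the point of `M`,
at `(t, x)`. -/
def SmoothFamilyAt {V : Type*} [NormedAddCommGroup V] [NormedSpace ℝ V]
    (f : ℝ → M → V) (t : ℝ) (x : M) : Prop :=
  ContMDiffAt (𝓘(ℝ, ℝ).prod (𝓡 3)) 𝓘(ℝ, V) ∞ (fun q : ℝ × M => f q.1 q.2) (t, x)

/-- The values of the pullback of a form along `f : F → M`. -/
def pullValues {F : Type*} [NormedAddCommGroup F] [NormedSpace ℝ F] {k : ℕ} {V : Type*}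
    (f : F → M) (η : FormValues M k V) (s : F) (w : Fin k → F) : V :=
  η (f s) (fun i => mfderiv 𝓘(ℝ, F) (𝓡 3) f s (w i))

/-- The integral of a `k`-form over the singular simplex `f : Δᵏ → M`. -/
def integrate {k : ℕ} {V : Type*} [NormedAddCommGroup V] [NormedSpace ℝ V]
    (f : (Fin k → ℝ) → M) (η : FormValues M k V) : V :=
  ∫ s in stdCell k, pullValues f η s (fun i => Pi.single i 1)

/-- The value on three vectors of `⟨α ∧ β⟩`, for a 2-form `α` and a 1-form `β`. -/
def wedge21 {V W : Type*} (pair : V → W → ℝ) (α : FormValues M 2 V) (β : FormValues M 1 W) :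
    FormValues M 3 ℝ := fun x u =>
  pair (α x ![u 0, u 1]) (β x ![u 2]) - pair (α x ![u 0, u 2]) (β x ![u 1])
    + pair (α x ![u 1, u 2]) (β x ![u 0])

/-- The value on three vectors of `⟨α ∧ β⟩`, for a 1-form `α` and a 2-form `β`. -/
def wedge12 {V W : Type*} (pair : V → W → ℝ) (α : FormValues M 1 V) (β : FormValues M 2 W) :
    FormValues M 3 ℝ := fun x u =>
  pair (α x ![u 0]) (β x ![u 1, u 2]) - pair (α x ![u 1]) (β x ![u 0, u 2])
    + pair (α x ![u 2]) (β x ![u 0, u 1])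

/-- The variation `δη` of a one-parameter family of forms, at parameter `0`. -/
def variation {k : ℕ} {V : Type*} [NormedAddCommGroup V] [NormedSpace ℝ V]
    (η : ℝ → FormValues M k V) : FormValues M k V :=
  fun x u => deriv (fun t => η t x u) 0

end Forms

/-! ### Cellular decompositions into tetrahedra -/

/-- A coherently oriented decomposition of a closed 3-manifold `M` into smoothly embedded
tetrahedra, each carrying an order of its vertices, in which every triangle is shared by exactly
two tetrahedra. The triangles are indexed by the dual oriented links: the link `l` goes from the
tetrahedron `(source l).1` to the tetrahedron `(target l).1` through the common triangle, which is
the face `(source l).2` of the former and the face `(target l).2` of the latter. -/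
structure Triangulation (M : Type*) [TopologicalSpace M]
    [ChartedSpace (EuclideanSpace ℝ (Fin 3)) M] (Cell Link : Type*) where
  param : Cell → (Fin 3 → ℝ) → M
  smooth : ∀ c, ∀ p ∈ stdCell 3, ContMDiffAt 𝓘(ℝ, Fin 3 → ℝ) (𝓡 3) ∞ (param c) p
  immersion : ∀ c, ∀ p ∈ stdCell 3,
    Function.Injective (mfderiv 𝓘(ℝ, Fin 3 → ℝ) (𝓡 3) (param c) p)
  injOn : ∀ c, InjOn (param c) (stdCell 3)
  cover : ⋃ c, param c '' stdCell 3 = univ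
  disjoint : ∀ c c', c ≠ c' →
    Disjoint (param c '' interior (stdCell 3)) (param c' '' stdCell 3)
  source : Link → Cell × Fin 4
  target : Link → Cell × Fin 4
  /-- every face of every tetrahedron is the source or the target face of exactly one link -/
  faces : Function.Bijective (Sum.elim source target)
  /-- the bijection between the vertices of the two faces glued along a link -/
  glue : Link → Equiv.Perm (Fin 3)
  glue_eq : ∀ l, EqOn (param (source l).1 ∘ face (source l).2)
    (param (target l).1 ∘ affineSimplex (stdVertex 3 ∘ (target l).2.succAbove ∘ glue l))
    (stdCell 2)
  /-- the two tetrahedra induce opposite orientations on the common triangle -/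
  coherent : ∀ l, (-1 : ℤ) ^ ((source l).2 : ℕ) * (Equiv.Perm.sign (glue l) : ℤ)
    = -(-1 : ℤ) ^ ((target l).2 : ℕ)

section Potential

variable {M : Type*} [TopologicalSpace M] [ChartedSpace (EuclideanSpace ℝ (Fin 3)) M]
  {Cell Link : Type*}

/-- The closed tetrahedron `c*` in `M`. -/
def Triangulation.cellSet (T : Triangulation M Cell Link) (c : Cell) : Set M :=
  T.param c '' stdCell 3

/-- The triangle dual to the link `l`, parametrized as a face of its source tetrahedron. -/
def Triangulation.triangle (T : Triangulation M Cell Link) (l : Link) : (Fin 2 → ℝ) → M :=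
  T.param (T.source l).1 ∘ face (T.source l).2

/-- The integral of a 2-form over the triangle dual to `l`, oriented as part of the boundary of
the source tetrahedron of `l`. -/
def Triangulation.triangleIntegral (T : Triangulation M Cell Link) {V : Type*}
    [NormedAddCommGroup V] [NormedSpace ℝ V] (l : Link) (η : FormValues M 2 V) : V :=
  (-1 : ℝ) ^ ((T.source l).2 : ℕ) • integrate (T.triangle l) η

/-- The integral of a 2-form over the oriented boundary of the tetrahedron `c*`. -/
def Triangulation.boundaryIntegral (T : Triangulation M Cell Link) (c : Cell)
    (η : FormValues M 2 ℝ) : ℝ :=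
  ∑ i : Fin 4, (-1 : ℝ) ^ (i : ℕ) * integrate (T.param c ∘ face i) η

/-- Two forms on `M` have the same restriction to the triangle dual to `l`. -/
def Triangulation.AgreeOn (T : Triangulation M Cell Link) {V : Type*} {k : ℕ} (l : Link)
    (η η' : FormValues M k V) : Prop :=
  ∀ s ∈ stdCell 2, ∀ w : Fin k → (Fin 2 → ℝ),
    pullValues (T.triangle l) η s w = pullValues (T.triangle l) η' s w

/-- A smooth one-parameter family (parameter `t`) of the data that parametrize the on-shell fields
in the cells: for each tetrahedron `c`, a rotation `g`, a translation `c`, an `ℝ⁴*`-valued 1-form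
`σ` and an `so(4)*`-valued 1-form `b`. They are smooth near `c*`; their values away from `c*` play
no role. -/
structure OnShellData (T : Triangulation M Cell Link) where
  g : Cell → ℝ → M → SO4
  c : Cell → ℝ → M → R4
  b : Cell → ℝ → Form M 1 Mat4
  σ : Cell → ℝ → Form M 1 R4
  b_skew : ∀ i t x u, (b i t x u)ᵀ = -(b i t x u)
  g_smooth : ∀ i t, ∀ x ∈ T.cellSet i, SmoothFamilyAt (fun t y => (g i t y : Mat4)) t x
  c_smooth : ∀ i t, ∀ x ∈ T.cellSet i, SmoothFamilyAt (c i) t x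
  b_smooth : ∀ i t, ∀ x ∈ T.cellSet i, SmoothFormFamilyAt (b i) t x
  σ_smooth : ∀ i t, ∀ x ∈ T.cellSet i, SmoothFormFamilyAt (σ i) t x

namespace OnShellData

variable {T : Triangulation M Cell Link} (D : OnShellData T)

/-- `db` -/
def db (i : Cell) (t : ℝ) : FormValues M 2 Mat4 := fun x u => extd (D.b i t) x u

/-- `dσ` -/
def dσ (i : Cell) (t : ℝ) : FormValues M 2 R4 := fun x u => extd (D.σ i t) x u

/-- `A = g⁻¹ dg` -/
def A (i : Cell) (t : ℝ) : FormValues M 1 Mat4 := fun x u =>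
  ((D.g i t x)⁻¹ : SO4).1 * dFun (fun y => (D.g i t y : Mat4)) x u

/-- `C = g⁻¹ dc g`; the rotation group acts on the translations by `g⁻¹ v g = g⁻¹ *ᵥ v` -/
def C (i : Cell) (t : ℝ) : FormValues M 1 R4 := fun x u =>
  ((D.g i t x)⁻¹ : SO4).1 *ᵥ dFun (D.c i t) x u

/-- `Σ = g⁻¹ dσ g` -/
def Sig (i : Cell) (t : ℝ) : FormValues M 2 R4 := fun x u =>
  ((D.g i t x)⁻¹ : SO4).1 *ᵥ D.dσ i t x u

/-- `B = g⁻¹ (db + [dσ, c]) g` -/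
def B (i : Cell) (t : ℝ) : FormValues M 2 Mat4 := fun x u =>
  ((D.g i t x)⁻¹ : SO4).1 * (D.db i t x u + mixedBracket (D.dσ i t x u) (D.c i t x))
    * (D.g i t x).1

/-- The fields `A`, `B`, `C`, `Σ` of neighbouring cells agree on the triangle they share. -/
def Continuity : Prop :=
  ∀ l t,
    T.AgreeOn l (D.A (T.source l).1 t) (D.A (T.target l).1 t) ∧
    T.AgreeOn l (D.B (T.source l).1 t) (D.B (T.target l).1 t) ∧
    T.AgreeOn l (D.C (T.source l).1 t) (D.C (T.target l).1 t) ∧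
    T.AgreeOn l (D.Sig (T.source l).1 t) (D.Sig (T.target l).1 t)

/-- The potential `∫ ⟨B ∧ δA⟩ - ∫ ⟨C ∧ δΣ⟩` on the on-shell fields, evaluated on the variation given
by the one-parameter family; the integral over `M` is the sum of the integrals over the cells. -/
def potential [Fintype Cell] : ℝ :=
  ∑ i, (integrate (T.param i) (wedge21 pairSo (D.B i 0) (variation (D.A i)))
    - integrate (T.param i) (wedge12 (fun v w : R4 => v ⬝ᵥ w) (D.C i 0) (variation (D.Sig i))))

/-- `Δg = δg g⁻¹` -/
def Δg (i : Cell) (x : M) : Mat4 :=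
  deriv (fun t => (D.g i t x : Mat4)) 0 * ((D.g i 0 x)⁻¹ : SO4).1

/-- The 2-form `⟨db, Δg⟩ + ⟨[dσ, c], Δg⟩ - ⟨c, dδσ⟩`, whose derivatives are kept on `b` and `σ`. -/
def boundaryForm (i : Cell) : FormValues M 2 ℝ := fun x u =>
  pairSo (D.db i 0 x u) (D.Δg i x) + pairSo (mixedBracket (D.dσ i 0 x u) (D.c i 0 x)) (D.Δg i x)
    - D.c i 0 x ⬝ᵥ variation (D.dσ i) x u

/-- The constants `h_{cc'}` and `x_c^{c'}` of the links solve the continuity equations of `g` and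
`c`: on the triangle, `g_c = h_{cc'} g_{c'}` and `c_{c'} = h_{cc'}⁻¹ (c_c + x_c^{c'}) h_{cc'}`. -/
def IsContinuitySolution (h : Link → ℝ → SO4) (x : Link → ℝ → R4) : Prop :=
  ∀ l t, ∀ s ∈ stdCell 2,
    D.g (T.source l).1 t (T.triangle l s) = h l t * D.g (T.target l).1 t (T.triangle l s) ∧
    D.c (T.target l).1 t (T.triangle l s)
      = ((h l t)⁻¹ : SO4).1 *ᵥ (D.c (T.source l).1 t (T.triangle l s) + x l t)

end OnShellData

end Potential

/-! ### The phase space of a link -/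

/-- The ambient linear space of the variables `(h, x, b, V)` of a link and its dual triangle. -/
abbrev LinkVars : Type := Mat4 × R4 × Mat4 × R4

/-- `SO(4) × ℝ⁴ × so(4)* × ℝ⁴*` -/
def linkPhaseSpace : Set LinkVars :=
  {p | p.1 ∈ Matrix.specialOrthogonalGroup (Fin 4) ℝ ∧ p.2.2.1ᵀ = -p.2.2.1}

/-- The vectors tangent to `linkPhaseSpace` at its point `p`. -/
def tangentVectors (p : LinkVars) : Set LinkVars :=
  {v | (v.1 * p.1ᵀ)ᵀ = -(v.1 * p.1ᵀ) ∧ v.2.2.1ᵀ = -v.2.2.1}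

/-- `⟨Δh, b⟩ + ⟨[Δh, x], V⟩ + ⟨x, δV⟩` at `p = (h, x, b, V)`, on the variation
`v = (δh, δx, δb, δV)`, with `Δh = δh h⁻¹`. -/
def bfcgLinkPotential (p v : LinkVars) : ℝ :=
  pairSo p.2.2.1 (v.1 * p.1ᵀ) + ((v.1 * p.1ᵀ) *ᵥ p.2.1) ⬝ᵥ p.2.2.2 + p.2.1 ⬝ᵥ v.2.2.2

/-- The potential `⟨b, Δh⟩ + ⟨V, δx⟩ + ⟨V, [x, Δh]⟩` of the BF discretization. -/
def bfLinkPotential (p v : LinkVars) : ℝ :=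
  pairSo p.2.2.1 (v.1 * p.1ᵀ) + p.2.2.2 ⬝ᵥ v.2.1 + p.2.2.2 ⬝ᵥ (-((v.1 * p.1ᵀ) *ᵥ p.2.1))

/-- The ambient space of `ISO(4) × iso(4)*`; `ISO(4)` consists of the affine `5 × 5` matrices. -/
abbrev CotangentVars : Type := Matrix (Fin 4 ⊕ Unit) (Fin 4 ⊕ Unit) ℝ × Mat4 × R4

/-- `(h, x, b, V) ↦ (e^x h, b + V)`, where `e^x = 1 + x` is the translation by `x`. -/
def toCotangent (p : LinkVars) : CotangentVars :=
  (fromBlocks 1 (replicateCol Unit p.2.1) 0 1 * fromBlocks p.1 0 0 1, p.2.2)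

/-- The canonical one-form `⟨β, δ𝒢 𝒢⁻¹⟩` of `T*ISO(4)`, trivialized by right translations as
`ISO(4) × iso(4)*`, at `q = (𝒢, b + V)`. -/
def canonicalForm (q w : CotangentVars) : ℝ :=
  pairSo q.2.1 (w.1 * q.1⁻¹).toBlocks₁₁
    + q.2.2 ⬝ᵥ (fun i => (w.1 * q.1⁻¹) (Sum.inl i) (Sum.inr ()))

/-- Change of the sign of `V`. -/
def flipV (p : LinkVars) : LinkVars := (p.1, p.2.1, p.2.2.1, -p.2.2.2)

/-- The exterior derivative of the one-form `θ` at `p`, on the vectors `u`, `v`. -/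
def extDOne (θ : LinkVars → LinkVars → ℝ) (p u v : LinkVars) : ℝ :=
  fderiv ℝ (fun q => θ q v) p u - fderiv ℝ (fun q => θ q u) p v

/-- The variables `(h, x, b, V)` of the link `l`, with `b = ∫ db_c` and `V = ∫ dσ_c` over the
triangle dual to `l`, where `c` is the source of `l`. -/
def linkVars {M : Type*} [TopologicalSpace M] [ChartedSpace (EuclideanSpace ℝ (Fin 3)) M]
    {Cell Link : Type*} {T : Triangulation M Cell Link} (D : OnShellData T)
    (h : Link → ℝ → SO4) (x : Link → ℝ → R4) (l : Link) (t : ℝ) : LinkVars :=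
  ((h l t : Mat4), x l t, T.triangleIntegral l (D.db (T.source l).1 t),
    T.triangleIntegral l (D.dσ (T.source l).1 t))

end BFCG

end

/-!
The bulk integrand is exact: on flat fields `δA = g⁻¹ d(Δg) g`, so `⟨B ∧ δA⟩ - ⟨C ∧ δΣ⟩` is, by the
invariance of the pairing, the differential of
`⟨db, Δg⟩ + ⟨[dσ, c], Δg⟩ - ⟨c, dδσ⟩`, and Stokes' theorem moves the potential to the triangles.
Two flat connections that agree along a convex triangle differ by a constant gauge transformation
there, since `g_c g_{c'}⁻¹` has vanishing derivative; this yields `h`, then likewise `x`. The two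
sides of a triangle carry opposite orientations, so it contributes the jump of the boundary form.
In that jump the fields `g_c`, `c_c` drop out and only the constants `h`, `x` and their variations
remain, so that `b` and `σ` enter through their integrals alone.
-/

namespace BFCG

open Filter Topology

/-! ### Affine simplices -/

section AffineSimplex

variable {F : Type*} [NormedAddCommGroup F] [NormedSpace ℝ F] {k : ℕ}

@[simp]
theorem stdVertex_zero : stdVertex k 0 = 0 := rfl

@[simp]
theorem stdVertex_succ (i : Fin k) : stdVertex k i.succ = Pi.single i 1 := rfl

/-- The linear part of `affineSimplex v`. -/
noncomputable def affineSimplexLin (v : Fin (k + 1) → F) : (Fin k → ℝ) →L[ℝ] F :=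
  ∑ i, (ContinuousLinearMap.proj (R := ℝ) (φ := fun _ : Fin k => ℝ) i).smulRight
    (v i.succ - v 0)

theorem affineSimplexLin_apply (v : Fin (k + 1) → F) (s : Fin k → ℝ) :
    affineSimplexLin v s = ∑ i, s i • (v i.succ - v 0) := by
  simp [affineSimplexLin]

theorem affineSimplexLin_single (v : Fin (k + 1) → F) (i : Fin k) :
    affineSimplexLin v (Pi.single i 1) = v i.succ - v 0 := by
  rw [affineSimplexLin_apply, Finset.sum_eq_single i] <;> simp +contextual

theorem affineSimplex_eq_add_lin (v : Fin (k + 1) → F) :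
    affineSimplex v = fun s => v 0 + affineSimplexLin v s :=
  funext fun s => by rw [affineSimplexLin_apply, affineSimplex]

theorem hasFDerivAt_affineSimplex (v : Fin (k + 1) → F) (s : Fin k → ℝ) :
    HasFDerivAt (affineSimplex v) (affineSimplexLin v) s := by
  rw [affineSimplex_eq_add_lin]
  exact (affineSimplexLin v).hasFDerivAt.const_add _

theorem contDiff_affineSimplex {n : WithTop ℕ∞} (v : Fin (k + 1) → F) :
    ContDiff ℝ n (affineSimplex v) := by
  rw [affineSimplex_eq_add_lin]
  exact contDiff_const.add (affineSimplexLin v).contDiff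

theorem affineSimplex_eq_sum_barycentric (v : Fin (k + 1) → F) (s : Fin k → ℝ) :
    affineSimplex v s = ∑ j, (Fin.cons (1 - ∑ i, s i) s : Fin (k + 1) → ℝ) j • v j := by
  simp only [affineSimplex, Fin.sum_univ_succ, Fin.cons_zero, Fin.cons_succ, smul_sub,
    Finset.sum_sub_distrib, sub_smul, one_smul, Finset.sum_smul]
  abel

theorem affineSimplex_mem {K : Set F} (hK : Convex ℝ K) {v : Fin (k + 1) → F}
    (hv : ∀ j, v j ∈ K) {s : Fin k → ℝ} (hs : s ∈ stdCell k) : affineSimplex v s ∈ K := by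
  rw [affineSimplex_eq_sum_barycentric]
  refine hK.sum_mem (fun j _ => ?_) ?_ (fun j _ => hv j)
  · refine Fin.cases ?_ (fun i => ?_) j
    · simpa using hs.2
    · simpa using hs.1 i
  · simp [Fin.sum_univ_succ]

theorem affineSimplex_stdVertex (v : Fin (k + 1) → F) (j : Fin (k + 1)) :
    affineSimplex v (stdVertex k j) = v j := by
  refine Fin.cases ?_ (fun i => ?_) j
  · simp [stdVertex, affineSimplex]
  · simp [affineSimplex_eq_add_lin, affineSimplexLin_single]

theorem affineSimplex_comp {m : ℕ} (v : Fin (k + 1) → F) (w : Fin (m + 1) → Fin k → ℝ) :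
    affineSimplex v ∘ affineSimplex w = affineSimplex (affineSimplex v ∘ w) := by
  funext s
  rw [affineSimplex_eq_add_lin v, Function.comp_apply, affineSimplex, affineSimplex]
  simp only [Function.comp_apply, map_add, map_sum, map_smul, map_sub, add_sub_add_left_eq_sub,
    add_assoc]

theorem affineSimplex_stdVertex_eq_id : affineSimplex (stdVertex k) = id := by
  funext s
  ext j
  simp [affineSimplex, stdVertex, Finset.sum_apply, Pi.single_apply]

theorem affineSimplex_comp_perm (v : Fin (k + 1) → F) (π : Equiv.Perm (Fin (k + 1))) :
    affineSimplex (v ∘ π) = affineSimplex v ∘ affineSimplex (stdVertex k ∘ π) := by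
  rw [affineSimplex_comp]
  exact congrArg affineSimplex (funext fun j => (affineSimplex_stdVertex v (π j)).symm)

theorem affineSimplex_perm_symm (π : Equiv.Perm (Fin (k + 1))) :
    affineSimplex (stdVertex k ∘ π) ∘ affineSimplex (stdVertex k ∘ π.symm) = id := by
  rw [← affineSimplex_comp_perm, Function.comp_assoc, Equiv.self_comp_symm, Function.comp_id,
    affineSimplex_stdVertex_eq_id]

end AffineSimplex

section StdCell

variable {k : ℕ}

theorem zero_mem_stdCell : (0 : Fin k → ℝ) ∈ stdCell k := by
  simp [stdCell]

theorem stdCell_subset_Icc : stdCell k ⊆ Icc 0 1 := fun s hs =>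
  ⟨hs.1, fun i =>
    (Finset.single_le_sum (f := s) (fun j _ => hs.1 j) (Finset.mem_univ i)).trans hs.2⟩

theorem convex_stdCell : Convex ℝ (stdCell k) := by
  rw [stdCell, ofPred_and, ofPred_forall]
  refine (convex_iInter fun i => ?_).inter ?_
  · exact convex_halfSpace_ge (f := fun s : Fin k → ℝ => s i) ⟨fun _ _ => rfl, fun _ _ => rfl⟩ 0
  · exact convex_halfSpace_le (f := fun s : Fin k → ℝ => ∑ i, s i)
      ⟨fun _ _ => by simp [Finset.sum_add_distrib], fun _ _ => by simp [Finset.mul_sum]⟩ 1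

theorem isClosed_stdCell : IsClosed (stdCell k) := by
  rw [stdCell, ofPred_and, ofPred_forall]
  exact (isClosed_iInter fun i => isClosed_le continuous_const (continuous_apply i)).inter
    (isClosed_le (by fun_prop) continuous_const)

theorem isCompact_stdCell : IsCompact (stdCell k) :=
  isCompact_Icc.of_isClosed_subset isClosed_stdCell stdCell_subset_Icc

theorem measurableSet_stdCell : MeasurableSet (stdCell k) := isClosed_stdCell.measurableSet

theorem uniqueDiffOn_stdCell : UniqueDiffOn ℝ (stdCell k) := by
  have h_open : IsOpen {s : Fin k → ℝ | (∀ i, 0 < s i) ∧ ∑ i, s i < 1} := by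
    rw [ofPred_and, ofPred_forall]
    exact (isOpen_iInter_of_finite fun i => isOpen_lt continuous_const (continuous_apply i)).inter
      (isOpen_lt (by fun_prop) continuous_const)
  refine uniqueDiffOn_convex convex_stdCell ⟨fun _ => 1 / (k + 1 : ℝ),
    interior_maximal (s := stdCell k) (fun s hs => ⟨fun i => (hs.1 i).le, hs.2.le⟩) h_open
      ⟨fun _ => by positivity, ?_⟩⟩
  simp only [Finset.sum_const, Finset.card_univ, Fintype.card_fin, nsmul_eq_mul]
  rw [mul_one_div, div_lt_one (by positivity)]
  linarith

theorem stdVertex_mem (j : Fin (k + 1)) : stdVertex k j ∈ stdCell k := by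
  refine Fin.cases zero_mem_stdCell (fun i => ⟨fun l => ?_, ?_⟩) j
  · simp only [stdVertex_succ, Pi.single_apply]
    split_ifs <;> norm_num
  · simp [stdVertex, Pi.single_apply]

theorem affineSimplex_stdVertex_comp_mem {m : ℕ} (ι : Fin (m + 1) → Fin (k + 1))
    {s : Fin m → ℝ} (hs : s ∈ stdCell m) : affineSimplex (stdVertex k ∘ ι) s ∈ stdCell k :=
  affineSimplex_mem convex_stdCell (fun _ => stdVertex_mem _) hs

theorem insertNth_mem_stdCell (i : Fin (k + 1)) {s : Fin k → ℝ} (hs : s ∈ stdCell k)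
    {a : ℝ} (ha : a ∈ Icc 0 (1 - ∑ j, s j)) : i.insertNth a s ∈ stdCell (k + 1) := by
  refine ⟨(Fin.forall_iff_succAbove i).2 ⟨by simpa using ha.1, fun j => by simpa using hs.1 j⟩, ?_⟩
  rw [Fin.sum_univ_succAbove _ i]
  simp only [Fin.insertNth_apply_same, Fin.insertNth_apply_succAbove]
  linarith [ha.2]

theorem mem_stdCell_succ_iff (i : Fin (k + 1)) {p : Fin (k + 1) → ℝ} :
    p ∈ stdCell (k + 1) ↔
      i.removeNth p ∈ stdCell k ∧ p i ∈ Icc 0 (1 - ∑ j, i.removeNth p j) := by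
  refine ⟨fun hp => ?_, fun hp => ?_⟩
  · have hsum := hp.2
    rw [Fin.sum_univ_succAbove _ i] at hsum
    exact ⟨⟨fun j => hp.1 _, by simp only [Fin.removeNth]; linarith [hp.1 i]⟩, hp.1 i,
      by simp only [Fin.removeNth]; linarith⟩
  · simpa using insertNth_mem_stdCell i hp.1 hp.2

theorem affineSimplex_perm_image (π : Equiv.Perm (Fin (k + 1))) :
    affineSimplex (stdVertex k ∘ π) '' stdCell k = stdCell k := by
  refine Subset.antisymm (image_subset_iff.2 fun s hs => affineSimplex_stdVertex_comp_mem π hs)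
    fun s hs => ⟨_, affineSimplex_stdVertex_comp_mem π.symm hs, ?_⟩
  exact congrFun (affineSimplex_perm_symm π) s

theorem affineSimplex_perm_injective (π : Equiv.Perm (Fin (k + 1))) :
    Function.Injective (affineSimplex (stdVertex k ∘ π)) :=
  Function.LeftInverse.injective (congrFun (affineSimplex_perm_symm π.symm))

theorem affineSimplex_stdVertex_succAbove_succ (i : Fin (k + 1)) (s : Fin k → ℝ) :
    affineSimplex (stdVertex (k + 1) ∘ i.succ.succAbove) s = i.insertNth 0 s := by
  rw [affineSimplex, eq_comm, Fin.insertNth_eq_iff]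
  constructor
  · simp [Fin.succ_succAbove_succ]
  · funext j
    simp [Fin.succ_succAbove_succ, Fin.removeNth, Finset.sum_apply, Pi.single_apply]

theorem affineSimplex_stdVertex_succAbove_zero (i : Fin (k + 1)) (s : Fin k → ℝ) :
    affineSimplex (stdVertex (k + 1) ∘ Fin.succAbove 0)
      (affineSimplex (stdVertex k ∘ i.cycleRange.symm) s) = i.insertNth (1 - ∑ j, s j) s := by
  have h := congrFun (affineSimplex_comp_perm (stdVertex (k + 1) ∘ Fin.succAbove 0)
    i.cycleRange.symm) s
  rw [Function.comp_apply] at h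
  rw [← h, affineSimplex_eq_sum_barycentric, ← Equiv.sum_comp i.cycleRange]
  funext m
  simp [Fin.cons_apply_cycleRange, Finset.sum_apply, Pi.single_apply]

end StdCell

/-! ### Alternating maps on the edges of a simplex -/

section Edges

variable {R E V : Type*} [CommRing R] [AddCommGroup E] [Module R E] [AddCommGroup V] [Module R V]
  {n : ℕ}

theorem alternatingMap_cons_sub (g : E [⋀^Fin (n + 1)]→ₗ[R] V) (a : E) (v : Fin n → E) :
    g (Fin.cons a fun j => v j - a) = g (Fin.cons a v) := by
  have h_sum := (g.curryLeft a).toMultilinearMap.map_add_univ v fun _ => -a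
  rw [Finset.sum_eq_single Finset.univ] at h_sum
  · simpa [Pi.add_def, sub_eq_add_neg] using! h_sum
  · intro s _ hs
    obtain ⟨j, hj⟩ : ∃ j, j ∉ s := by simpa [Finset.eq_univ_iff_forall] using hs
    have h_neg := (g.curryLeft a).map_update_neg (s.piecewise v fun _ => -a) j a
    have h_zero : g.curryLeft a (Function.update (s.piecewise v fun _ => -a) j a) = 0 :=
      g.map_eq_zero_of_eq (i := 0) (j := j.succ) _ (by simp) (Fin.succ_ne_zero j).symm
    rw [h_zero, neg_zero, Function.update_eq_self_iff.2 (by simp [hj])] at h_neg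
    exact h_neg
  · simp

/-- The alternating map `λ ∧ f` on `E × R`, where `λ` is the projection to `R`. On the vertices
`(v j, 1)` of a simplex, seen in the affine hyperplane of height one, it is the value of `f` on the
edges `v (j + 1) - v 0`; this makes the dependence of the latter on all the vertices alternating. -/
def homogenization (f : E [⋀^Fin n]→ₗ[R] V) : (E × R) [⋀^Fin (n + 1)]→ₗ[R] V :=
  AlternatingMap.alternatizeUncurryFin
    ((LinearMap.snd R E R).smulRight (f.compLinearMap (LinearMap.fst R E R)))

theorem homogenization_apply (f : E [⋀^Fin n]→ₗ[R] V) (v : Fin (n + 1) → E × R) :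
    homogenization f v
      = ∑ i : Fin (n + 1), (-1) ^ (i : ℕ) • (v i).2 • f (fun j => (i.removeNth v j).1) := by
  simp [homogenization, AlternatingMap.alternatizeUncurryFin_apply]

theorem homogenization_vertices (f : E [⋀^Fin n]→ₗ[R] V) (v : Fin (n + 1) → E) :
    homogenization f (fun j => (v j, 1)) = f fun j => v j.succ - v 0 := by
  have h_cons : (fun j => (v j, (1 : R))) = Fin.cons (v 0, 1) fun j : Fin n => (v j.succ, 1) := by
    funext j
    refine Fin.cases rfl (fun _ => rfl) j
  rw [h_cons, ← alternatingMap_cons_sub, homogenization_apply, Fin.sum_univ_succ]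
  simp

theorem alternatingMap_edges_eq_sum (f : E [⋀^Fin n]→ₗ[R] V) (v : Fin (n + 1) → E) :
    f (fun j => v j.succ - v 0) = ∑ i : Fin (n + 1), (-1) ^ (i : ℕ) • f (i.removeNth v) := by
  rw [← homogenization_vertices, homogenization_apply]
  simp only [one_smul]
  rfl

theorem alternatingMap_edges_perm (f : E [⋀^Fin n]→ₗ[R] V) (v : Fin (n + 1) → E)
    (π : Equiv.Perm (Fin (n + 1))) :
    f (fun j => v (π j.succ) - v (π 0)) = Equiv.Perm.sign π • f fun j => v j.succ - v 0 := by
  rw [← homogenization_vertices, ← homogenization_vertices f fun j => v (π j)]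
  exact (homogenization f).map_perm (fun j => (v j, 1)) π

end Edges

theorem abs_det_affineSimplexLin_perm {k : ℕ} (π : Equiv.Perm (Fin (k + 1))) :
    |(affineSimplexLin (stdVertex k ∘ π)).det| = 1 := by
  have h := alternatingMap_edges_perm (Pi.basisFun ℝ (Fin k)).det (stdVertex k) π
  have h_edges : (fun j => stdVertex k (π j.succ) - stdVertex k (π 0))
      = affineSimplexLin (stdVertex k ∘ π) ∘ Pi.basisFun ℝ (Fin k) := by
    funext j
    simp [affineSimplexLin_single]
  have h_basis : (fun j : Fin k => stdVertex k j.succ - stdVertex k 0) = Pi.basisFun ℝ (Fin k) := by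
    funext j
    simp
  rw [h_edges, h_basis, ← ContinuousLinearMap.coe_coe, Module.Basis.det_comp,
    Module.Basis.det_self, mul_one] at h
  rw [ContinuousLinearMap.det, h]
  rcases Int.units_eq_one_or (Equiv.Perm.sign π) with hπ | hπ <;> simp [hπ]

/-! ### Integration over affine simplices and the theorem of Stokes -/

section IntegralStdCell

variable {V : Type*} [NormedAddCommGroup V] {k : ℕ}

theorem integrableOn_stdCell {f : (Fin k → ℝ) → V} (hf : ContinuousOn f (stdCell k)) :
    IntegrableOn f (stdCell k) :=
  hf.integrableOn_compact isCompact_stdCell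

theorem indicator_stdCell_succ (f : (Fin (k + 1) → ℝ) → V) (i : Fin (k + 1)) (a : ℝ)
    (s : Fin k → ℝ) :
    (stdCell (k + 1)).indicator f (i.insertNth a s) = (stdCell k).indicator
      (fun s => (Icc 0 (1 - ∑ j, s j)).indicator (fun a => f (i.insertNth a s)) a) s := by
  classical
  simp only [indicator_apply, mem_stdCell_succ_iff i, Fin.removeNth_insertNth,
    Fin.insertNth_apply_same, ite_and]

theorem integrableOn_insertNth {f : (Fin (k + 1) → ℝ) → V}
    (hf : ContinuousOn f (stdCell (k + 1))) (i : Fin (k + 1)) {a : (Fin k → ℝ) → ℝ}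
    (ha : Continuous a) (ha_mem : ∀ s ∈ stdCell k, a s ∈ Icc 0 (1 - ∑ j, s j)) :
    IntegrableOn (fun s => f (i.insertNth (a s) s)) (stdCell k) :=
  integrableOn_stdCell (hf.comp
    (Continuous.finInsertNth (A := fun _ => ℝ) i ha continuous_id).continuousOn
    fun s hs => insertNth_mem_stdCell i hs (ha_mem s hs))

variable [NormedSpace ℝ V]

theorem integral_stdCell_succ {f : (Fin (k + 1) → ℝ) → V} (hf : ContinuousOn f (stdCell (k + 1)))
    (i : Fin (k + 1)) :
    ∫ p in stdCell (k + 1), f p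
      = ∫ s in stdCell k, ∫ a in (0 : ℝ)..(1 - ∑ j, s j), f (i.insertNth a s) := by
  have h_mp := (volume_preserving_piFinSuccAbove (fun _ : Fin (k + 1) => ℝ) i).symm
  have h_int := (h_mp.integrable_comp_emb (MeasurableEquiv.measurableEmbedding _)).2
    ((integrable_indicator_iff measurableSet_stdCell).2 (integrableOn_stdCell hf))
  rw [← integral_indicator measurableSet_stdCell, ← integral_indicator measurableSet_stdCell,
    ← h_mp.integral_comp', Measure.volume_eq_prod]
  refine (integral_prod_symm _ h_int).trans ?_
  refine integral_congr_ae (Eventually.of_forall fun s => ?_)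
  have h_fiber : ∀ a, (stdCell (k + 1)).indicator f
      ((MeasurableEquiv.piFinSuccAbove (fun _ => ℝ) i).symm (a, s)) = _ :=
    fun a => indicator_stdCell_succ f i a s
  simp only [Function.comp_apply, h_fiber]
  by_cases hs : s ∈ stdCell k
  · simp only [indicator_of_mem hs]
    rw [integral_indicator measurableSet_Icc, integral_Icc_eq_integral_Ioc,
      intervalIntegral.integral_of_le (by linarith [hs.2])]
  · simp only [indicator_of_notMem hs, integral_zero]

theorem hasDerivAt_insertNth (i : Fin (k + 1)) (s : Fin k → ℝ) (a : ℝ) :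
    HasDerivAt (fun a : ℝ => (i.insertNth a s : Fin (k + 1) → ℝ)) (Pi.single i 1) a := by
  rw [hasDerivAt_pi, Fin.forall_iff_succAbove i]
  refine ⟨by simpa using! hasDerivAt_id a, fun j => ?_⟩
  simpa using hasDerivAt_const a (s j)

theorem continuousOn_fderiv_apply {E : Type*} [NormedAddCommGroup E] [NormedSpace ℝ E]
    {f : E → V} {K : Set E} (hf : ∀ p ∈ K, ContDiffAt ℝ 1 f p) (e : E) :
    ContinuousOn (fun p => fderiv ℝ f p e) K :=
  fun p hp => (((hf p hp).fderiv_right (m := 0) (by simp)).continuousAt.clm_apply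
    continuousAt_const).continuousWithinAt

theorem integral_stdCell_fderiv_single [CompleteSpace V] {f : (Fin (k + 1) → ℝ) → V}
    (hf : ∀ p ∈ stdCell (k + 1), ContDiffAt ℝ 1 f p) (i : Fin (k + 1)) :
    ∫ p in stdCell (k + 1), fderiv ℝ f p (Pi.single i 1)
      = (∫ s in stdCell k, f (i.insertNth (1 - ∑ j, s j) s))
        - ∫ s in stdCell k, f (i.insertNth 0 s) := by
  have hf' := continuousOn_fderiv_apply hf (Pi.single i 1)
  have hf_cont : ContinuousOn f (stdCell (k + 1)) :=
    fun p hp => (hf p hp).continuousAt.continuousWithinAt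
  have h_nonneg : ∀ s ∈ stdCell k, 0 ≤ 1 - ∑ j, s j := fun s hs => sub_nonneg.2 hs.2
  rw [integral_stdCell_succ hf' i, ← integral_sub
    (integrableOn_insertNth hf_cont i (by fun_prop) fun s hs => ⟨h_nonneg s hs, le_rfl⟩)
    (integrableOn_insertNth hf_cont i continuous_const fun s hs => ⟨le_rfl, h_nonneg s hs⟩)]
  refine setIntegral_congr_fun measurableSet_stdCell fun s hs => ?_
  refine intervalIntegral.integral_eq_sub_of_hasDerivAt (f := fun a => f (i.insertNth a s))
    (fun a ha => ?_) (ContinuousOn.intervalIntegrable ?_) <;>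
  rw [uIcc_of_le (h_nonneg s hs)] at *
  · exact ((hf _ (insertNth_mem_stdCell i hs ha)).differentiableAt
      one_ne_zero).hasFDerivAt.comp_hasDerivAt a (hasDerivAt_insertNth i s a)
  · exact hf'.comp (Continuous.finInsertNth (A := fun _ => ℝ) i continuous_id
      continuous_const).continuousOn fun a ha => insertNth_mem_stdCell i hs ha

theorem integral_stdCell_perm (π : Equiv.Perm (Fin (k + 1))) (f : (Fin k → ℝ) → V) :
    ∫ s in stdCell k, f (affineSimplex (stdVertex k ∘ π) s) = ∫ s in stdCell k, f s := by
  have h := integral_image_eq_integral_abs_det_fderiv_smul volume measurableSet_stdCell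
    (fun s _ => (hasFDerivAt_affineSimplex (stdVertex k ∘ π) s).hasFDerivWithinAt)
    (affineSimplex_perm_injective π).injOn f
  simpa only [affineSimplex_perm_image, abs_det_affineSimplexLin_perm, one_smul] using h.symm

end IntegralStdCell

section AffineIntegral

variable {E V : Type*} [NormedAddCommGroup E] [NormedSpace ℝ E] [NormedAddCommGroup V]
  [NormedSpace ℝ V] {k : ℕ}

/-- The integral of the `k`-form `η` over the affine simplex with the ordered vertices `v`. -/
noncomputable def affineIntegral (v : Fin (k + 1) → E) (η : E → E [⋀^Fin k]→L[ℝ] V) : V :=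
  ∫ s in stdCell k, η (affineSimplex v s) fun j => v j.succ - v 0

theorem affineIntegral_stdVertex (η : (Fin k → ℝ) → (Fin k → ℝ) [⋀^Fin k]→L[ℝ] V) :
    affineIntegral (stdVertex k) η = ∫ s in stdCell k, η s fun j => Pi.single j 1 := by
  simp [affineIntegral, affineSimplex_stdVertex_eq_id]

theorem affineIntegral_perm (v : Fin (k + 1) → E) (η : E → E [⋀^Fin k]→L[ℝ] V)
    (π : Equiv.Perm (Fin (k + 1))) :
    affineIntegral (v ∘ π) η = Equiv.Perm.sign π • affineIntegral v η := by
  have h_edges : ∀ s, η (affineSimplex (v ∘ π) s) (fun j => (v ∘ π) j.succ - (v ∘ π) 0)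
      = Equiv.Perm.sign π • η (affineSimplex v (affineSimplex (stdVertex k ∘ π) s))
        fun j => v j.succ - v 0 := by
    intro s
    rw [affineSimplex_comp_perm]
    exact alternatingMap_edges_perm (η _).toAlternatingMap v π
  simp only [affineIntegral, h_edges]
  rw [← integral_stdCell_perm π fun s => η (affineSimplex v s) fun j => v j.succ - v 0]
  rcases Int.units_eq_one_or (Equiv.Perm.sign π) with hπ | hπ <;> simp [hπ, integral_neg]

theorem affineIntegral_stdVertex_succAbove_succ
    (η : (Fin (k + 1) → ℝ) → (Fin (k + 1) → ℝ) [⋀^Fin k]→L[ℝ] V) (i : Fin (k + 1)) :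
    affineIntegral (stdVertex (k + 1) ∘ i.succ.succAbove) η
      = ∫ s in stdCell k, η (i.insertNth 0 s) fun j => Pi.single (i.succAbove j) 1 := by
  simp only [affineIntegral, affineSimplex_stdVertex_succAbove_succ]
  simp [Fin.succ_succAbove_succ]

theorem affineIntegral_stdVertex_succAbove_zero
    {η : (Fin (k + 1) → ℝ) → (Fin (k + 1) → ℝ) [⋀^Fin k]→L[ℝ] V}
    (hη : ContinuousOn η (stdCell (k + 1))) :
    affineIntegral (stdVertex (k + 1) ∘ Fin.succAbove 0) η
      = ∑ i : Fin (k + 1), (-1 : ℝ) ^ (i : ℕ) • ∫ s in stdCell k,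
          η (i.insertNth (1 - ∑ j, s j) s) fun j => Pi.single (i.succAbove j) 1 := by
  have h_int (i : Fin (k + 1)) : IntegrableOn (fun s => (-1 : ℝ) ^ (i : ℕ) •
      η (affineSimplex (stdVertex (k + 1) ∘ Fin.succAbove 0) s)
        fun j => Pi.single (i.succAbove j) 1) (stdCell k) := .smul _ <|
    integrableOn_stdCell ((ContinuousAlternatingMap.apply ℝ _ V _).continuous.comp_continuousOn
      (hη.comp (contDiff_affineSimplex (n := 0) _).continuous.continuousOn fun s hs =>
        affineSimplex_stdVertex_comp_mem _ hs))
  have h_edges (s : Fin k → ℝ) := alternatingMap_edges_eq_sum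
    (η (affineSimplex (stdVertex (k + 1) ∘ Fin.succAbove 0) s)).toAlternatingMap
    (stdVertex (k + 1) ∘ Fin.succAbove 0)
  have h_vertex : stdVertex (k + 1) ∘ Fin.succAbove 0 = fun j => Pi.single j 1 := by
    funext j
    simp
  calc
    _ = ∫ s in stdCell k, ∑ i : Fin (k + 1), (-1 : ℝ) ^ (i : ℕ) •
          η (affineSimplex (stdVertex (k + 1) ∘ Fin.succAbove 0) s)
            fun j => Pi.single (i.succAbove j) 1 := by
      rw [affineIntegral]
      refine integral_congr_ae (Eventually.of_forall fun s => (h_edges s).trans ?_)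
      simp only [h_vertex, ← Int.cast_smul_eq_zsmul ℝ, Int.cast_pow, Int.cast_neg, Int.cast_one]
      rfl
    _ = _ := by
      rw [integral_finsetSum Finset.univ fun i _ => h_int i]
      refine Finset.sum_congr rfl fun i _ => ?_
      rw [integral_smul, ← integral_stdCell_perm i.cycleRange.symm]
      simp only [affineSimplex_stdVertex_succAbove_zero]

theorem affineIntegral_extDeriv [CompleteSpace V]
    {η : (Fin (k + 1) → ℝ) → (Fin (k + 1) → ℝ) [⋀^Fin k]→L[ℝ] V}
    (hη : ∀ p ∈ stdCell (k + 1), ContDiffAt ℝ 1 η p) :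
    affineIntegral (stdVertex (k + 1)) (extDeriv η)
      = ∑ i : Fin (k + 2), (-1 : ℝ) ^ (i : ℕ) •
          affineIntegral (stdVertex (k + 1) ∘ i.succAbove) η := by
  let e : Fin (k + 1) → Fin (k + 1) → ℝ := fun i => Pi.single i 1
  let f : Fin (k + 1) → (Fin (k + 1) → ℝ) → V := fun i p => η p fun j => e (i.succAbove j)
  have hf : ∀ i, ∀ p ∈ stdCell (k + 1), ContDiffAt ℝ 1 (f i) p := fun i p hp =>
    (hη p hp).continuousLinearMap_comp
      (ContinuousAlternatingMap.apply ℝ _ V fun j => e (i.succAbove j))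
  have h_extDeriv : ∀ p ∈ stdCell (k + 1), extDeriv η p e
      = ∑ i : Fin (k + 1), (-1 : ℝ) ^ (i : ℕ) • fderiv ℝ (f i) p (e i) := by
    intro p hp
    rw [extDeriv_apply ((hη p hp).differentiableAt one_ne_zero)]
    simp only [← Int.cast_smul_eq_zsmul ℝ, Int.cast_pow, Int.cast_neg, Int.cast_one]
    rfl
  have h_int : ∀ i : Fin (k + 1), IntegrableOn
      (fun p => (-1 : ℝ) ^ (i : ℕ) • fderiv ℝ (f i) p (e i)) (stdCell (k + 1)) := fun i =>
    (integrableOn_stdCell (continuousOn_fderiv_apply (hf i) _)).smul _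
  rw [affineIntegral_stdVertex, setIntegral_congr_fun measurableSet_stdCell h_extDeriv,
    integral_finsetSum _ fun i _ => h_int i, Fin.sum_univ_succ (n := k + 1),
    affineIntegral_stdVertex_succAbove_zero
      fun p hp => (hη p hp).continuousAt.continuousWithinAt,
    Fin.val_zero, pow_zero, one_smul, ← Finset.sum_add_distrib]
  refine Finset.sum_congr rfl fun i _ => ?_
  rw [integral_smul, integral_stdCell_fderiv_single (hf i),
    affineIntegral_stdVertex_succAbove_succ, Fin.val_succ, pow_succ, smul_sub]
  simp [f, e, sub_eq_add_neg]

end AffineIntegral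

/-! ### Families depending on a parameter -/

section Families

variable {E : Type*} [NormedAddCommGroup E] [NormedSpace ℝ E]
  {V : Type*} [NormedAddCommGroup V] [NormedSpace ℝ V] {k : ℕ} {m n : WithTop ℕ∞}
  {H : ℝ → E → V} {η : ℝ → E → E [⋀^Fin k]→L[ℝ] V} {t : ℝ} {p : E}

theorem contDiffAt_of_family (hH : ContDiffAt ℝ n (fun q : ℝ × E => H q.1 q.2) (t, p)) :
    ContDiffAt ℝ n (H t) p :=
  ContDiffAt.comp p hH (f := fun y => (t, y)) (by fun_prop)

theorem contDiffAt_param_of_family (hH : ContDiffAt ℝ n (fun q : ℝ × E => H q.1 q.2) (t, p)) :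
    ContDiffAt ℝ n (fun s => H s p) t :=
  ContDiffAt.comp t hH (f := fun s => (s, p)) (by fun_prop)

theorem deriv_family_eq {q : ℝ × E} (hH : DifferentiableAt ℝ (fun q : ℝ × E => H q.1 q.2) q) :
    deriv (fun s => H s q.2) q.1 = fderiv ℝ (fun q : ℝ × E => H q.1 q.2) q (1, 0) :=
  (HasFDerivAt.comp_hasDerivAt (f := fun s : ℝ => (s, q.2)) q.1 hH.hasFDerivAt
    ((hasDerivAt_id q.1).prodMk (hasDerivAt_const q.1 q.2))).deriv

theorem fderiv_family_eq {q : ℝ × E} (hH : DifferentiableAt ℝ (fun q : ℝ × E => H q.1 q.2) q) :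
    fderiv ℝ (H q.1) q.2
      = (fderiv ℝ (fun q : ℝ × E => H q.1 q.2) q).comp (ContinuousLinearMap.inr ℝ ℝ E) :=
  (HasFDerivAt.comp (f := fun y : E => (q.1, y)) q.2 hH.hasFDerivAt
    (hasFDerivAt_prodMk_right q.1 q.2)).fderiv

theorem contDiffAt_fderiv_family (hH : ContDiffAt ℝ n (fun q : ℝ × E => H q.1 q.2) (t, p))
    (hmn : m + 1 ≤ n) : ContDiffAt ℝ m (fun q : ℝ × E => fderiv ℝ (H q.1) q.2) (t, p) :=
  ContDiffAt.fderiv (f := fun q : ℝ × E => H q.1) (g := Prod.snd)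
    (ContDiffAt.comp (f := fun r : (ℝ × E) × E => (r.1.1, r.2)) ((t, p), p) hH (by fun_prop))
    contDiffAt_snd hmn

theorem contDiffAt_extDeriv_family (hη : ContDiffAt ℝ n (fun q : ℝ × E => η q.1 q.2) (t, p))
    (hmn : m + 1 ≤ n) : ContDiffAt ℝ m (fun q : ℝ × E => extDeriv (η q.1) q.2) (t, p) := by
  let L : (E →L[ℝ] E [⋀^Fin k]→L[ℝ] V) →L[ℝ] E [⋀^Fin (k + 1)]→L[ℝ] V :=
    ContinuousAlternatingMap.alternatizeUncurryFinCLM ℝ E V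
  exact (contDiffAt_fderiv_family hη hmn).continuousLinearMap_comp L

theorem eventually_differentiableAt {F : Type*} [NormedAddCommGroup F] [NormedSpace ℝ F]
    {f : F → V} {q : F} (hf : ContDiffAt ℝ 1 f q) : ∀ᶠ r in 𝓝 q, DifferentiableAt ℝ f r :=
  (hf.eventually (by simp)).mono fun _ hr => hr.differentiableAt one_ne_zero

theorem contDiffAt_deriv_family (hH : ContDiffAt ℝ n (fun q : ℝ × E => H q.1 q.2) (t, p))
    (hmn : m + 1 ≤ n) :
    ContDiffAt ℝ m (fun q : ℝ × E => deriv (fun s => H s q.2) q.1) (t, p) := by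
  refine ((hH.fderiv_right hmn).clm_apply contDiffAt_const).congr_of_eventuallyEq
    (f := fun q => fderiv ℝ (fun q : ℝ × E => H q.1 q.2) q (1, 0)) ?_
  filter_upwards [eventually_differentiableAt (hH.of_le (le_add_self.trans hmn))] with q hq
  exact deriv_family_eq hq

theorem hasFDerivAt_deriv_family (hH : ContDiffAt ℝ 2 (fun q : ℝ × E => H q.1 q.2) (t, p)) :
    HasFDerivAt (fun y => deriv (fun s => H s y) t)
      (((fderiv ℝ (fderiv ℝ fun q : ℝ × E => H q.1 q.2) (t, p)).comp
        (ContinuousLinearMap.inr ℝ ℝ E)).flip (1, 0)) p := by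
  have hH' := ((hH.fderiv_right (m := 1) (by norm_num)).differentiableAt one_ne_zero).hasFDerivAt
  have h_comp := (hH'.comp (f := fun y : E => (t, y)) p (hasFDerivAt_prodMk_right t p)).clm_apply
    (hasFDerivAt_const ((1, 0) : ℝ × E) p)
  have h_ev : ∀ᶠ y in 𝓝 p, DifferentiableAt ℝ (fun q : ℝ × E => H q.1 q.2) (t, y) :=
    (Continuous.prodMk_right t).continuousAt.eventually
      (eventually_differentiableAt (hH.of_le one_le_two))
  refine (h_comp.congr_fderiv (by simp)).congr_of_eventuallyEq ?_
  filter_upwards [h_ev] with y hy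
  exact deriv_family_eq hy

theorem hasDerivAt_fderiv_family (hH : ContDiffAt ℝ 2 (fun q : ℝ × E => H q.1 q.2) (t, p)) :
    HasDerivAt (fun s => fderiv ℝ (H s) p)
      (fderiv ℝ (fun y => deriv (fun s => H s y) t) p) t := by
  have hH' := ((hH.fderiv_right (m := 1) (by norm_num)).differentiableAt one_ne_zero).hasFDerivAt
  have h_comp := (hH'.comp_hasDerivAt (f := fun s : ℝ => (s, p)) t
    ((hasDerivAt_id t).prodMk (hasDerivAt_const t p))).clm_comp
      (hasDerivAt_const t (ContinuousLinearMap.inr ℝ ℝ E))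
  have h_ev : ∀ᶠ s in 𝓝 t, DifferentiableAt ℝ (fun q : ℝ × E => H q.1 q.2) (s, p) :=
    (Continuous.prodMk_left p).continuousAt.eventually
      (eventually_differentiableAt (hH.of_le one_le_two))
  have h_symm := hH.isSymmSndFDerivAt (by simp)
  refine (h_comp.congr_deriv ?_).congr_of_eventuallyEq ?_
  · rw [(hasFDerivAt_deriv_family hH).fderiv]
    ext e
    simpa using h_symm (1, 0) (0, e)
  · filter_upwards [h_ev] with s hs
    exact fderiv_family_eq hs

theorem extDeriv_deriv_family_eq_zero
    (hη : ContDiffAt ℝ 2 (fun q : ℝ × E => η q.1 q.2) (t, p)) (h0 : ∀ s, extDeriv (η s) p = 0) :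
    extDeriv (fun y => deriv (fun s => η s y) t) p = 0 := by
  let L : (E →L[ℝ] E [⋀^Fin k]→L[ℝ] V) →L[ℝ] E [⋀^Fin (k + 1)]→L[ℝ] V :=
    ContinuousAlternatingMap.alternatizeUncurryFinCLM ℝ E V
  have h := L.hasFDerivAt.comp_hasDerivAt t (hasDerivAt_fderiv_family (H := η) hη)
  have h_zero : (L ∘ fun s => fderiv ℝ (η s) p) = fun _ => 0 := funext h0
  rw [h_zero] at h
  exact h.unique (hasDerivAt_const t 0)

end Families

/-! ### Pullbacks of forms along smooth maps -/

section Pullback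

variable {M : Type*} [TopologicalSpace M] [ChartedSpace (EuclideanSpace ℝ (Fin 3)) M]
  {F : Type*} [NormedAddCommGroup F] [NormedSpace ℝ F]
  {V : Type*} [NormedAddCommGroup V] [NormedSpace ℝ V] {k : ℕ} {f : F → M} {p : F}

theorem form_congr_point (α : Form M k V) {a b : M} (hab : a = b)
    (v : Fin k → EuclideanSpace ℝ (Fin 3)) :
    (α a : EuclideanSpace ℝ (Fin 3) [⋀^Fin k]→L[ℝ] V) v
      = (α b : EuclideanSpace ℝ (Fin 3) [⋀^Fin k]→L[ℝ] V) v := by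
  subst hab
  rfl

theorem contDiffAt_extChartAt_comp {n : WithTop ℕ∞} [IsManifold (𝓡 3) n M]
    (hf : ContMDiffAt 𝓘(ℝ, F) (𝓡 3) n f p) :
    ContDiffAt ℝ n (extChartAt (𝓡 3) (f p) ∘ f) p :=
  (contMDiffAt_extChartAt.comp p hf).contDiffAt

theorem fderiv_extChartAt_comp [IsManifold (𝓡 3) 1 M] {x : M}
    (hx : f p ∈ (extChartAt (𝓡 3) x).source) (hf : MDifferentiableAt 𝓘(ℝ, F) (𝓡 3) f p) :
    fderiv ℝ (extChartAt (𝓡 3) x ∘ f) p =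
      (mfderiv (𝓡 3) 𝓘(ℝ, EuclideanSpace ℝ (Fin 3)) (extChartAt (𝓡 3) x) (f p)).comp
        (mfderiv 𝓘(ℝ, F) (𝓡 3) f p) := by
  rw [← mfderiv_eq_fderiv]
  exact mfderiv_comp p (mdifferentiableAt_extChartAt (by simpa using hx)) hf

theorem mfderiv_eq_mfderiv_extChartAt_symm [IsManifold (𝓡 3) 1 M] {x : M}
    (hx : f p ∈ (extChartAt (𝓡 3) x).source) (hf : MDifferentiableAt 𝓘(ℝ, F) (𝓡 3) f p) (v : F) :
    mfderiv 𝓘(ℝ, F) (𝓡 3) f p v =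
      mfderiv 𝓘(ℝ, EuclideanSpace ℝ (Fin 3)) (𝓡 3) (extChartAt (𝓡 3) x).symm
        (extChartAt (𝓡 3) x (f p)) (fderiv ℝ (extChartAt (𝓡 3) x ∘ f) p v) := by
  have h_inv := mfderivWithin_extChartAt_symm_comp_mfderiv_extChartAt' (I := 𝓡 3) (x := x) hx
  simp only [ModelWithCorners.range_eq_univ, mfderivWithin_univ] at h_inv
  rw [fderiv_extChartAt_comp hx hf]
  exact (DFunLike.congr_fun h_inv (mfderiv 𝓘(ℝ, F) (𝓡 3) f p v)).symm

theorem pullback_eventuallyEq_chart [IsManifold (𝓡 3) 1 M]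
    (hf : ContMDiffAt 𝓘(ℝ, F) (𝓡 3) 1 f p) :
    ∀ᶠ y in 𝓝 p, ∀ α : Form M k V, pullback f α y =
      (pullback (extChartAt (𝓡 3) (f p)).symm α
        ((extChartAt (𝓡 3) (f p) ∘ f) y)).compContinuousLinearMap
          (fderiv ℝ (extChartAt (𝓡 3) (f p) ∘ f) y) := by
  have h_source : ∀ᶠ y in 𝓝 p, f y ∈ (extChartAt (𝓡 3) (f p)).source :=
    hf.continuousAt.preimage_mem_nhds (extChartAt_source_mem_nhds (f p))
  filter_upwards [h_source, (contMDiffAt_iff_contMDiffAt_nhds (by simp)).1 hf] with y hy hfy α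
  ext v
  have h_mfderiv := fun i =>
    mfderiv_eq_mfderiv_extChartAt_symm hy (hfy.mdifferentiableAt one_ne_zero) (v i)
  refine (congrArg (α (f y)) (funext h_mfderiv)).trans ?_
  exact (form_congr_point α ((extChartAt (𝓡 3) (f p)).left_inv hy) _).symm

theorem extDeriv_pullback_eq [IsManifold (𝓡 3) 2 M] (hf : ContMDiffAt 𝓘(ℝ, F) (𝓡 3) 2 f p)
    {α : Form M k V} (hα : DifferentiableAt ℝ (pullback (extChartAt (𝓡 3) (f p)).symm α)
      (extChartAt (𝓡 3) (f p) (f p))) :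
    extDeriv (pullback f α) p = pullback f (extd α) p := by
  have h_chart : pullback f α =ᶠ[𝓝 p] _ :=
    (pullback_eventuallyEq_chart (hf.of_le one_le_two)).mono fun y hy => hy α
  rw [h_chart.extDeriv_eq, extDeriv_pullback (f := extChartAt (𝓡 3) (f p) ∘ f) hα
    (contDiffAt_extChartAt_comp hf) (by simp),
    fderiv_extChartAt_comp (by simp) (hf.mdifferentiableAt two_ne_zero)]
  rfl

theorem SmoothFormFamilyAt.differentiableAt {α : ℝ → Form M k V} {t : ℝ} {x : M}
    (hα : SmoothFormFamilyAt α t x) :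
    DifferentiableAt ℝ (pullback (extChartAt (𝓡 3) x).symm (α t)) (extChartAt (𝓡 3) x x) :=
  (contDiffAt_of_family (H := fun t => pullback (extChartAt (𝓡 3) x).symm (α t))
    hα).differentiableAt (by simp)

theorem contDiffAt_pullback [IsManifold (𝓡 3) ∞ M] (hf : ContMDiffAt 𝓘(ℝ, F) (𝓡 3) ∞ f p)
    {α : ℝ → Form M 1 V} {t : ℝ} (hα : SmoothFormFamilyAt α t (f p)) :
    ContDiffAt ℝ ∞ (fun q : ℝ × F => pullback f (α q.1) q.2) (t, p) := by
  have hχf := contDiffAt_extChartAt_comp hf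
  let L := ContinuousAlternatingMap.ofSubsingletonLIE (𝕜 := ℝ) (E := EuclideanSpace ℝ (Fin 3))
    (F := V) (0 : Fin 1)
  let L' := ContinuousAlternatingMap.ofSubsingletonLIE (𝕜 := ℝ) (E := F) (F := V) (0 : Fin 1)
  have h_chart : (fun q : ℝ × F => pullback f (α q.1) q.2) =ᶠ[𝓝 (t, p)] fun q =>
      L' ((L.symm (pullback (extChartAt (𝓡 3) (f p)).symm (α q.1)
        ((extChartAt (𝓡 3) (f p) ∘ f) q.2))).comp
          (fderiv ℝ (extChartAt (𝓡 3) (f p) ∘ f) q.2)) := by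
    filter_upwards [continuousAt_snd.eventually
      (pullback_eventuallyEq_chart (k := 1) (V := V) (hf.of_le (by simp)))] with q hq
    rw [hq (α q.1)]
    ext v
    refine congrArg (pullback (extChartAt (𝓡 3) (f p)).symm (α q.1) _) (funext fun i => ?_)
    simp [Subsingleton.elim i 0]
  refine (L'.toContinuousLinearEquiv.contDiff.contDiffAt.comp _
    (ContDiffAt.clm_comp ?_ ?_)).congr_of_eventuallyEq h_chart
  · refine L.symm.toContinuousLinearEquiv.contDiff.contDiffAt.comp _ (ContDiffAt.comp (t, p)
      (f := fun q : ℝ × F => (q.1, (extChartAt (𝓡 3) (f p) ∘ f) q.2)) hα ?_)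
    exact contDiffAt_fst.prodMk
      (ContDiffAt.comp (g := extChartAt (𝓡 3) (f p) ∘ f) (t, p) hχf contDiffAt_snd)
  · exact (hχf.fderiv_right (m := ∞) (by simp)).comp (t, p) contDiffAt_snd

end Pullback

/-! ### Bilinear expressions and the algebra of `so(4)` -/

section Bilinear

variable {E V W X : Type*} [NormedAddCommGroup E] [NormedSpace ℝ E]
  [NormedAddCommGroup V] [NormedSpace ℝ V] [NormedAddCommGroup W] [NormedSpace ℝ W]
  [NormedAddCommGroup X] [NormedSpace ℝ X] {k : ℕ} {n : WithTop ℕ∞} {p : E}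

theorem contDiffAt_form_apply {η : E → E [⋀^Fin k]→L[ℝ] V} (hη : ContDiffAt ℝ n η p)
    (v : Fin k → E) : ContDiffAt ℝ n (fun y => η y v) p :=
  hη.continuousLinearMap_comp (ContinuousAlternatingMap.apply ℝ E V v)

theorem contDiffAt_bilin_form (B : V →L[ℝ] W →L[ℝ] X) {f : E → V} {η : E → E [⋀^Fin k]→L[ℝ] W}
    (hf : ContDiffAt ℝ n f p) (hη : ContDiffAt ℝ n η p) :
    ContDiffAt ℝ n (fun y => (B (f y)).compContinuousAlternatingMap (η y)) p :=
  ContDiffAt.clm_apply (f := fun y => ContinuousLinearMap.compContinuousAlternatingMapCLM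
      ℝ E W X (Fin k) (B (f y)))
    ((hf.continuousLinearMap_comp B).continuousLinearMap_comp _) hη

theorem extDeriv_fun_sub {η η' : E → E [⋀^Fin k]→L[ℝ] V} (hη : DifferentiableAt ℝ η p)
    (hη' : DifferentiableAt ℝ η' p) :
    extDeriv (fun y => η y - η' y) p = extDeriv η p - extDeriv η' p := by
  rw [extDeriv, fderiv_fun_sub hη hη']
  exact map_sub (ContinuousAlternatingMap.alternatizeUncurryFinCLM ℝ E V) _ _

theorem extDeriv_bilin_form_apply (B : V →L[ℝ] W →L[ℝ] X) {f : E → V}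
    {η : E → E [⋀^Fin k]→L[ℝ] W} (hf : ContDiffAt ℝ 1 f p) (hη : ContDiffAt ℝ 1 η p)
    (v : Fin (k + 1) → E) :
    extDeriv (fun y => (B (f y)).compContinuousAlternatingMap (η y)) p v =
      ∑ i : Fin (k + 1), (-1 : ℤ) ^ (i : ℕ) • B (fderiv ℝ f p (v i)) (η p (i.removeNth v))
        + B (f p) (extDeriv η p v) := by
  have h_apply : ∀ w : Fin k → E, DifferentiableAt ℝ (fun y => η y w) p := fun w =>
    (contDiffAt_form_apply hη w).differentiableAt one_ne_zero
  have h_leibniz : ∀ (w : Fin k → E) (e : E), fderiv ℝ (fun y => B (f y) (η y w)) p e =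
      B (fderiv ℝ f p e) (η p w) + B (f p) (fderiv ℝ (fun y => η y w) p e) := fun w e =>
    (congrArg (fun L : E →L[ℝ] X => L e) (B.fderiv_of_bilinear
      (hf.differentiableAt one_ne_zero) (h_apply w))).trans (add_comm _ _)
  rw [extDeriv_apply ((contDiffAt_bilin_form B hf hη).differentiableAt one_ne_zero),
    extDeriv_apply (hη.differentiableAt one_ne_zero), map_sum, ← Finset.sum_add_distrib]
  refine Finset.sum_congr rfl fun i _ => ?_
  rw [map_zsmul, ← smul_add, ← h_leibniz]
  rfl

variable [FiniteDimensional ℝ V] [FiniteDimensional ℝ W] {B : V → W → X}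

theorem contDiffAt_bilin (hB : IsBilinearMap ℝ B) {f : E → V} {g : E → W}
    (hf : ContDiffAt ℝ n f p) (hg : ContDiffAt ℝ n g p) :
    ContDiffAt ℝ n (fun q => B (f q) (g q)) p :=
  (hf.continuousLinearMap_comp hB.toContinuousBilinearMap).clm_apply hg

theorem differentiableAt_bilin (hB : IsBilinearMap ℝ B) {f : E → V} {g : E → W}
    (hf : DifferentiableAt ℝ f p) (hg : DifferentiableAt ℝ g p) :
    DifferentiableAt ℝ (fun q => B (f q) (g q)) p :=
  (hB.toContinuousBilinearMap.differentiableAt.comp p hf).clm_apply hg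

theorem hasDerivAt_bilin (hB : IsBilinearMap ℝ B) {f : ℝ → V} {g : ℝ → W} {t : ℝ} {f' : V} {g' : W}
    (hf : HasDerivAt f f' t) (hg : HasDerivAt g g' t) :
    HasDerivAt (fun s => B (f s) (g s)) (B f' (g t) + B (f t) g') t :=
  (hB.toContinuousBilinearMap.hasFDerivAt.comp_hasDerivAt t hf).clm_apply hg

theorem fderiv_bilin (hB : IsBilinearMap ℝ B) {f : E → V} {g : E → W}
    (hf : DifferentiableAt ℝ f p) (hg : DifferentiableAt ℝ g p) (e : E) :
    fderiv ℝ (fun q => B (f q) (g q)) p e = B (fderiv ℝ f p e) (g p) + B (f p) (fderiv ℝ g p e) :=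
  (congrArg (fun L : E →L[ℝ] X => L e) (hB.toContinuousBilinearMap.fderiv_of_bilinear hf hg)).trans
    (add_comm _ _)

end Bilinear

section Matrices

variable {l m n : Type*}

theorem isBilinearMap_mul [Fintype m] :
    IsBilinearMap ℝ (fun (A : Matrix l m ℝ) (B : Matrix m n ℝ) => A * B) where
  add_left := Matrix.add_mul
  smul_left := Matrix.smul_mul
  add_right := Matrix.mul_add
  smul_right c A B := Matrix.mul_smul A c B

theorem isBilinearMap_mulVec [Fintype n] :
    IsBilinearMap ℝ (fun (A : Matrix m n ℝ) (v : n → ℝ) => A *ᵥ v) where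
  add_left := Matrix.add_mulVec
  smul_left := Matrix.smul_mulVec
  add_right := Matrix.mulVec_add
  smul_right c A v := Matrix.mulVec_smul A c v

theorem isBilinearMap_dotProduct [Fintype n] : IsBilinearMap ℝ (fun v w : n → ℝ => v ⬝ᵥ w) where
  add_left := add_dotProduct
  smul_left := smul_dotProduct
  add_right := dotProduct_add
  smul_right c v w := dotProduct_smul c v w

variable [Fintype m] [Fintype n]

/-- Transposition as a continuous linear map, so that transposes can be differentiated. -/
noncomputable def transposeL (m n : Type*) [Fintype m] [Fintype n] :
    Matrix m n ℝ →L[ℝ] Matrix n m ℝ :=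
  LinearMap.toContinuousLinearMap (Matrix.transposeLinearEquiv m n ℝ ℝ).toLinearMap

theorem hasDerivAt_transpose {f : ℝ → Matrix m n ℝ} {f' : Matrix m n ℝ} {t : ℝ}
    (hf : HasDerivAt f f' t) : HasDerivAt (fun s => (f s)ᵀ) f'ᵀ t :=
  (transposeL m n).hasFDerivAt.comp_hasDerivAt t hf

theorem contDiffAt_transpose {E : Type*} [NormedAddCommGroup E] [NormedSpace ℝ E]
    {f : E → Matrix m n ℝ} {p : E} {r : WithTop ℕ∞} (hf : ContDiffAt ℝ r f p) :
    ContDiffAt ℝ r (fun q => (f q)ᵀ) p :=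
  hf.continuousLinearMap_comp (transposeL m n)

theorem dotProduct_transpose_mulVec [DecidableEq m] {g : Matrix m n ℝ} (hg : g * gᵀ = 1)
    (a b : m → ℝ) : (gᵀ *ᵥ a) ⬝ᵥ (gᵀ *ᵥ b) = a ⬝ᵥ b := by
  rw [dotProduct_mulVec, vecMul_transpose, mulVec_mulVec, hg, one_mulVec]

theorem mulVec_dotProduct_skew {a : Matrix n n ℝ} (ha : aᵀ = -a) (v w : n → ℝ) :
    (a *ᵥ v) ⬝ᵥ w = -(v ⬝ᵥ (a *ᵥ w)) := by
  rw [dotProduct_mulVec v, ← mulVec_transpose, ha, neg_mulVec, neg_dotProduct, neg_neg]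

end Matrices

theorem isBilinearMap_pairSo : IsBilinearMap ℝ pairSo where
  add_left a b c := by simp [pairSo, Matrix.add_mul, mul_add]
  smul_left r a b := by simp [pairSo]; ring
  add_right a b c := by simp [pairSo, mul_add]
  smul_right r a b := by simp [pairSo]; ring

theorem isBilinearMap_mixedBracket : IsBilinearMap ℝ mixedBracket where
  add_left a b c := by ext i j; simp [mixedBracket, vecMulVec_apply]; ring
  smul_left r a b := by ext i j; simp [mixedBracket, vecMulVec_apply]; ring
  add_right a b c := by ext i j; simp [mixedBracket, vecMulVec_apply]; ring
  smul_right r a b := by ext i j; simp [mixedBracket, vecMulVec_apply]; ring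

theorem pairSo_add_left (a b c : Mat4) : pairSo (a + b) c = pairSo a c + pairSo b c :=
  isBilinearMap_pairSo.add_left a b c

theorem pairSo_conj {g : Mat4} (hg : g * gᵀ = 1) (a b : Mat4) :
    pairSo (gᵀ * a * g) (gᵀ * b * g) = pairSo a b := by
  have h_mul : (gᵀ * a * g)ᵀ * (gᵀ * b * g) = gᵀ * (aᵀ * b) * g :=
    calc (gᵀ * a * g)ᵀ * (gᵀ * b * g) = gᵀ * aᵀ * (g * gᵀ) * b * g := by
          simp only [transpose_mul, transpose_transpose, Matrix.mul_assoc]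
      _ = gᵀ * (aᵀ * b) * g := by rw [hg, Matrix.mul_one]; simp only [Matrix.mul_assoc]
  rw [pairSo, h_mul, trace_mul_comm, ← Matrix.mul_assoc, hg, Matrix.one_mul, pairSo]

theorem transpose_mul_SO4 (g : SO4) : (g : Mat4)ᵀ * (g : Mat4) = 1 :=
  congrArg Subtype.val (inv_mul_cancel g)

theorem mul_transpose_SO4 (g : SO4) : (g : Mat4) * (g : Mat4)ᵀ = 1 :=
  congrArg Subtype.val (mul_inv_cancel g)

/-- Conjugation by `g` drops out of the pairings of `B` with `δA` and of `C` with `δΣ`, and the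
rotational part of `δΣ` turns into a bracket by the invariance of the pairing. -/
theorem pairSo_conj_sub_dotProduct_conj (g : SO4) {Δ : Mat4} (hΔ : Δᵀ = -Δ) (ψ dΔ : Mat4)
    (dc ς ς' : R4) :
    pairSo ((g : Mat4)ᵀ * ψ * (g : Mat4)) ((g : Mat4)ᵀ * dΔ * (g : Mat4))
      - ((g : Mat4)ᵀ *ᵥ dc) ⬝ᵥ ((g : Mat4)ᵀ *ᵥ (ς' - Δ *ᵥ ς))
      = pairSo ψ dΔ + pairSo (mixedBracket ς dc) Δ - dc ⬝ᵥ ς' := by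
  rw [pairSo_conj (mul_transpose_SO4 g), dotProduct_transpose_mulVec (mul_transpose_SO4 g),
    pairSo_mixedBracket _ _ _ hΔ, dotProduct_sub, dotProduct_neg, ← dotProduct_comm _ ς,
    mulVec_dotProduct_skew hΔ]
  ring

/-! ### Variations of flat connections and the boundary form -/

section Variations

/-- The variation `δg g⁻¹` of a family of rotations, at the parameter `0`; the inverse of a
rotation is written as its transpose. -/
noncomputable def logVariation {E : Type*} (g : ℝ → E → SO4) (y : E) : Mat4 :=
  deriv (fun t => (g t y : Mat4)) 0 * (g 0 y : Mat4)ᵀ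

theorem deriv_rotation_eq_logVariation_mul {E : Type*} {g : ℝ → E → SO4} (y : E) :
    deriv (fun t => (g t y : Mat4)) 0 = logVariation g y * (g 0 y : Mat4) := by
  rw [logVariation, Matrix.mul_assoc, transpose_mul_SO4, Matrix.mul_one]

variable {E : Type*} [NormedAddCommGroup E] [NormedSpace ℝ E] {g : ℝ → E → SO4} {n : WithTop ℕ∞}
  {p : E}

theorem contDiffAt_logVariation {m : WithTop ℕ∞}
    (hg : ContDiffAt ℝ n (fun q : ℝ × E => (g q.1 q.2 : Mat4)) (0, p)) (hmn : m + 1 ≤ n) :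
    ContDiffAt ℝ m (logVariation g) p :=
  contDiffAt_bilin (B := fun A B : Mat4 => A * B) isBilinearMap_mul
    (contDiffAt_of_family (H := fun t y => deriv (fun s => (g s y : Mat4)) t)
      (contDiffAt_deriv_family (H := fun t y => (g t y : Mat4)) hg hmn))
    (contDiffAt_transpose (contDiffAt_of_family (H := fun t y => (g t y : Mat4))
      (hg.of_le (le_self_add.trans hmn))))

theorem hasDerivAt_rotation
    (hg : ContDiffAt ℝ 1 (fun q : ℝ × E => (g q.1 q.2 : Mat4)) (0, p)) :
    HasDerivAt (fun t => (g t p : Mat4)) (logVariation g p * (g 0 p : Mat4)) 0 := by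
  rw [← deriv_rotation_eq_logVariation_mul]
  exact ((contDiffAt_param_of_family (H := fun t y => (g t y : Mat4)) hg).differentiableAt
    one_ne_zero).hasDerivAt

theorem skew_of_hasDerivAt {γ : ℝ → SO4} {γ' : Mat4} {t : ℝ}
    (hγ : HasDerivAt (fun s => (γ s : Mat4)) γ' t) :
    (γ' * (γ t : Mat4)ᵀ)ᵀ = -(γ' * (γ t : Mat4)ᵀ) := by
  have h_deriv := hasDerivAt_bilin isBilinearMap_mul hγ (hasDerivAt_transpose hγ)
  have h_one : (fun s => (γ s : Mat4) * (γ s : Mat4)ᵀ) = fun _ => (1 : Mat4) :=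
    funext fun s => mul_transpose_SO4 (γ s)
  rw [h_one] at h_deriv
  rw [transpose_mul, transpose_transpose]
  exact eq_neg_of_add_eq_zero_right (h_deriv.unique (hasDerivAt_const t (1 : Mat4)))

theorem logVariation_skew
    (hg : ContDiffAt ℝ 1 (fun q : ℝ × E => (g q.1 q.2 : Mat4)) (0, p)) :
    (logVariation g p)ᵀ = -logVariation g p := by
  have h := skew_of_hasDerivAt (γ := fun t => g t p) (hasDerivAt_rotation hg)
  rwa [Matrix.mul_assoc, mul_transpose_SO4, Matrix.mul_one] at h

theorem hasDerivAt_transpose_rotation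
    (hg : ContDiffAt ℝ 1 (fun q : ℝ × E => (g q.1 q.2 : Mat4)) (0, p)) :
    HasDerivAt (fun t => (g t p : Mat4)ᵀ) (-((g 0 p : Mat4)ᵀ * logVariation g p)) 0 := by
  refine (hasDerivAt_transpose (hasDerivAt_rotation hg)).congr_deriv ?_
  rw [transpose_mul, logVariation_skew hg, Matrix.mul_neg]

theorem hasDerivAt_inv_mulVec
    (hg : ContDiffAt ℝ 1 (fun q : ℝ × E => (g q.1 q.2 : Mat4)) (0, p)) {s : ℝ → R4} {s' : R4}
    (hs : HasDerivAt s s' 0) :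
    HasDerivAt (fun t => (g t p : Mat4)ᵀ *ᵥ s t)
      ((g 0 p : Mat4)ᵀ *ᵥ (s' - logVariation g p *ᵥ s 0)) 0 := by
  refine (hasDerivAt_bilin isBilinearMap_mulVec (hasDerivAt_transpose_rotation hg)
    hs).congr_deriv ?_
  rw [mulVec_sub, mulVec_mulVec, neg_mulVec, neg_add_eq_sub]

theorem hasDerivAt_maurerCartan
    (hg : ContDiffAt ℝ 2 (fun q : ℝ × E => (g q.1 q.2 : Mat4)) (0, p)) (e : E) :
    HasDerivAt (fun t => (g t p : Mat4)ᵀ * fderiv ℝ (fun y => (g t y : Mat4)) p e)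
      ((g 0 p : Mat4)ᵀ * fderiv ℝ (logVariation g) p e * (g 0 p : Mat4)) 0 := by
  have hg_one := hg.of_le one_le_two
  have h_mixed : HasDerivAt (fun t => fderiv ℝ (fun y => (g t y : Mat4)) p e)
      (fderiv ℝ (fun y => deriv (fun s => (g s y : Mat4)) 0) p e) 0 :=
    (ContinuousLinearMap.apply ℝ Mat4 e).hasFDerivAt.comp_hasDerivAt 0
      (hasDerivAt_fderiv_family (H := fun t y => (g t y : Mat4)) hg)
  have h_leibniz : fderiv ℝ (fun y => deriv (fun s => (g s y : Mat4)) 0) p e =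
      fderiv ℝ (logVariation g) p e * (g 0 p : Mat4)
        + logVariation g p * fderiv ℝ (fun y => (g 0 y : Mat4)) p e := by
    simp only [deriv_rotation_eq_logVariation_mul]
    exact fderiv_bilin isBilinearMap_mul
      ((contDiffAt_logVariation hg (m := 1) (by norm_num)).differentiableAt one_ne_zero)
      ((contDiffAt_of_family (H := fun t y => (g t y : Mat4)) hg).differentiableAt two_ne_zero) e
  refine (hasDerivAt_bilin isBilinearMap_mul (hasDerivAt_transpose_rotation hg_one)
    h_mixed).congr_deriv ?_
  rw [h_leibniz, Matrix.mul_add, Matrix.neg_mul, ← Matrix.mul_assoc, ← Matrix.mul_assoc,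
    neg_add_cancel_comm_assoc]

/-- The form `⟨β, Δ⟩ + ⟨[ς, c], Δ⟩ - ⟨c, ς'⟩`; in the application `β = db`, `ς = dσ` and
`ς' = dδσ`, so that it is the integrand over the boundary of a cell. -/
noncomputable def boundaryFormOf (Δ : E → Mat4) (c : E → R4) (β : E → E [⋀^Fin 2]→L[ℝ] Mat4)
    (ς ς' : E → E [⋀^Fin 2]→L[ℝ] R4) (y : E) : E [⋀^Fin 2]→L[ℝ] ℝ :=
  (isBilinearMap_pairSo.toContinuousBilinearMap.flip (Δ y)).compContinuousAlternatingMap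
    (β y + (isBilinearMap_mixedBracket.toContinuousBilinearMap.flip
      (c y)).compContinuousAlternatingMap (ς y))
  - (isBilinearMap_dotProduct.toContinuousBilinearMap (c y)).compContinuousAlternatingMap (ς' y)

variable {Δ : E → Mat4} {c : E → R4} {β : E → E [⋀^Fin 2]→L[ℝ] Mat4}
  {ς ς' : E → E [⋀^Fin 2]→L[ℝ] R4}

theorem contDiffAt_boundaryFormOf (hΔ : ContDiffAt ℝ n Δ p) (hc : ContDiffAt ℝ n c p)
    (hβ : ContDiffAt ℝ n β p) (hς : ContDiffAt ℝ n ς p) (hς' : ContDiffAt ℝ n ς' p) :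
    ContDiffAt ℝ n (boundaryFormOf Δ c β ς ς') p :=
  (contDiffAt_bilin_form _ hΔ (hβ.add (contDiffAt_bilin_form _ hc hς))).sub
    (contDiffAt_bilin_form _ hc hς')

theorem extDeriv_boundaryFormOf (hΔ : ContDiffAt ℝ 1 Δ p) (hc : ContDiffAt ℝ 1 c p)
    (hβ : ContDiffAt ℝ 1 β p) (hς : ContDiffAt ℝ 1 ς p) (hς' : ContDiffAt ℝ 1 ς' p)
    (dβ : extDeriv β p = 0) (dς : extDeriv ς p = 0) (dς' : extDeriv ς' p = 0) (v : Fin 3 → E) :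
    extDeriv (boundaryFormOf Δ c β ς ς') p v = ∑ i : Fin 3, (-1 : ℤ) ^ (i : ℕ) •
      (pairSo (β p (i.removeNth v) + mixedBracket (ς p (i.removeNth v)) (c p))
          (fderiv ℝ Δ p (v i))
        + pairSo (mixedBracket (ς p (i.removeNth v)) (fderiv ℝ c p (v i))) (Δ p)
        - fderiv ℝ c p (v i) ⬝ᵥ ς' p (i.removeNth v)) := by
  let P := isBilinearMap_pairSo.toContinuousBilinearMap.flip
  let K := isBilinearMap_mixedBracket.toContinuousBilinearMap.flip
  let S := (isBilinearMap_dotProduct (n := Fin 4)).toContinuousBilinearMap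
  let ψ := fun y => β y + (K (c y)).compContinuousAlternatingMap (ς y)
  have hKς : ContDiffAt ℝ 1 (fun y => (K (c y)).compContinuousAlternatingMap (ς y)) p :=
    contDiffAt_bilin_form K hc hς
  have hψ : ContDiffAt ℝ 1 ψ p := hβ.add hKς
  have dψ : extDeriv ψ p v = ∑ i : Fin 3, (-1 : ℤ) ^ (i : ℕ) •
      mixedBracket (ς p (i.removeNth v)) (fderiv ℝ c p (v i)) := by
    have h_add : extDeriv ψ p = _ := extDeriv_fun_add (hβ.differentiableAt one_ne_zero)
      (hKς.differentiableAt one_ne_zero)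
    rw [h_add, dβ, zero_add, extDeriv_bilin_form_apply K hc hς, dς,
      ContinuousAlternatingMap.coe_zero, Pi.zero_apply, map_zero, add_zero]
    rfl
  have h_sub : extDeriv (boundaryFormOf Δ c β ς ς') p = _ := extDeriv_fun_sub
    ((contDiffAt_bilin_form P hΔ hψ).differentiableAt one_ne_zero)
    ((contDiffAt_bilin_form S hc hς').differentiableAt one_ne_zero)
  rw [h_sub, ContinuousAlternatingMap.sub_apply, extDeriv_bilin_form_apply P hΔ hψ,
    extDeriv_bilin_form_apply S hc hς', dψ, dς', ContinuousAlternatingMap.coe_zero, Pi.zero_apply,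
    map_zero, add_zero, map_sum, ← Finset.sum_add_distrib, ← Finset.sum_sub_distrib]
  refine Finset.sum_congr rfl fun i _ => ?_
  rw [map_zsmul, ← smul_add, ← smul_sub]
  rfl

end Variations

/-! ### The fields of a cell, pulled back -/

section PullValues

variable {M : Type*} [TopologicalSpace M] [ChartedSpace (EuclideanSpace ℝ (Fin 3)) M]
  {F : Type*} [NormedAddCommGroup F] [NormedSpace ℝ F]
  {V W : Type*} {f : F → M} {p : F}

theorem wedge21_eq_sum (pair : V → W → ℝ) (α : FormValues M 2 V) (β : FormValues M 1 W) (x : M)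
    (u : Fin 3 → TangentSpace (𝓡 3) x) :
    wedge21 pair α β x u =
      ∑ i : Fin 3, (-1 : ℤ) ^ (i : ℕ) • pair (α x (i.removeNth u)) (β x fun _ => u i) := by
  have h_faces : (0 : Fin 3).removeNth u = ![u 1, u 2] ∧ (1 : Fin 3).removeNth u = ![u 0, u 2] ∧
      (2 : Fin 3).removeNth u = ![u 0, u 1] := by
    refine ⟨?_, ?_, ?_⟩ <;> ext j : 1 <;> fin_cases j <;> rfl
  have h_const : ∀ i, (fun _ => u i) = ![u i] := fun i => funext fun j => by fin_cases j; rfl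
  rw [Fin.sum_univ_three, h_faces.1, h_faces.2.1, h_faces.2.2, h_const, h_const, h_const, wedge21]
  simp only [Fin.val_zero, Fin.val_one, Fin.val_two, pow_zero, pow_one, one_smul, neg_smul,
    even_two.neg_one_pow]
  ring

theorem wedge12_eq_wedge21_swap (pair : V → W → ℝ) (α : FormValues M 1 V) (β : FormValues M 2 W) :
    wedge12 pair α β = wedge21 (Function.swap pair) β α := by
  funext x u
  rw [wedge12, wedge21, Function.swap]
  ring

theorem pullValues_wedge21 (pair : V → W → ℝ) (α : FormValues M 2 V) (β : FormValues M 1 W)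
    (e : Fin 3 → F) :
    pullValues f (wedge21 pair α β) p e = ∑ i : Fin 3, (-1 : ℤ) ^ (i : ℕ) •
      pair (pullValues f α p (i.removeNth e)) (pullValues f β p fun _ => e i) :=
  wedge21_eq_sum pair α β (f p) _

theorem pullValues_wedge12 (pair : V → W → ℝ) (α : FormValues M 1 V) (β : FormValues M 2 W)
    (e : Fin 3 → F) :
    pullValues f (wedge12 pair α β) p e = ∑ i : Fin 3, (-1 : ℤ) ^ (i : ℕ) •
      pair (pullValues f α p fun _ => e i) (pullValues f β p (i.removeNth e)) := by
  rw [wedge12_eq_wedge21_swap, pullValues_wedge21]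

theorem pullValues_comp {E : Type*} [NormedAddCommGroup E] [NormedSpace ℝ E] {k : ℕ}
    {a : E → F} {a' : E →L[ℝ] F} {s : E} (hf : MDifferentiableAt 𝓘(ℝ, F) (𝓡 3) f (a s))
    (ha : HasFDerivAt a a' s) (η : FormValues M k V) (w : Fin k → E) :
    pullValues (f ∘ a) η s w = pullValues f η (a s) fun j => a' (w j) := by
  have h_chain := mfderiv_comp s hf ha.differentiableAt.mdifferentiableAt
  rw [mfderiv_eq_fderiv, ha.fderiv] at h_chain
  exact congrArg (η (f (a s))) (funext fun j => DFunLike.congr_fun h_chain (w j))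

variable [NormedAddCommGroup V] [NormedSpace ℝ V]

theorem pullValues_variation {k : ℕ} (η : ℝ → FormValues M k V) (w : Fin k → F) :
    pullValues f (variation η) p w = deriv (fun t => pullValues f (η t) p w) 0 := rfl

theorem SmoothFamilyAt.contDiffAt_comp {φ : ℝ → M → V} {t : ℝ} (hφ : SmoothFamilyAt φ t (f p))
    (hf : ContMDiffAt 𝓘(ℝ, F) (𝓡 3) ∞ f p) :
    ContDiffAt ℝ ∞ (fun q : ℝ × F => φ q.1 (f q.2)) (t, p) := by
  have h_fst : ContMDiffAt 𝓘(ℝ, ℝ × F) 𝓘(ℝ, ℝ) ∞ (Prod.fst : ℝ × F → ℝ) (t, p) :=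
    contDiffAt_fst.contMDiffAt
  have h_snd : ContMDiffAt 𝓘(ℝ, ℝ × F) 𝓘(ℝ, F) ∞ (Prod.snd : ℝ × F → F) (t, p) :=
    contDiffAt_snd.contMDiffAt
  exact (ContMDiffAt.comp (g := fun q : ℝ × M => φ q.1 q.2) (t, p) hφ
    (f := fun q : ℝ × F => (q.1, f q.2))
    (h_fst.prodMk (ContMDiffAt.comp (t, p) hf h_snd))).contDiffAt

theorem SmoothFamilyAt.mdifferentiableAt {φ : ℝ → M → V} {t : ℝ} {x : M}
    (hφ : SmoothFamilyAt φ t x) : MDifferentiableAt (𝓡 3) 𝓘(ℝ, V) (φ t) x :=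
  (ContMDiffAt.comp (g := fun q : ℝ × M => φ q.1 q.2) x hφ
    (contMDiffAt_const.prodMk contMDiffAt_id)).mdifferentiableAt (by simp)

theorem pullValues_dFun {φ : M → V} (hφ : MDifferentiableAt (𝓡 3) 𝓘(ℝ, V) φ (f p))
    (hf : MDifferentiableAt 𝓘(ℝ, F) (𝓡 3) f p) (w : Fin 1 → F) :
    pullValues f (dFun φ) p w = fderiv ℝ (fun y => φ (f y)) p (w 0) := by
  rw [← mfderiv_eq_fderiv]
  exact (DFunLike.congr_fun (mfderiv_comp p hφ hf) (w 0)).symm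

end PullValues

section Cell

variable {M : Type*} [TopologicalSpace M] [ChartedSpace (EuclideanSpace ℝ (Fin 3)) M]
  {Cell Link : Type*} {F : Type*} [NormedAddCommGroup F] [NormedSpace ℝ F]

/-- `f` is smooth at `p` and maps `p` into the closed tetrahedron `i`, so that the fields of this
tetrahedron, pulled back along `f`, are smooth at `p`. -/
structure Triangulation.SmoothIntoCellAt (T : Triangulation M Cell Link) (i : Cell) (f : F → M)
    (p : F) : Prop where
  contMDiffAt : ContMDiffAt 𝓘(ℝ, F) (𝓡 3) ∞ f p
  mem_cellSet : f p ∈ T.cellSet i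

theorem Triangulation.SmoothIntoCellAt.mdifferentiableAt {T : Triangulation M Cell Link} {i : Cell}
    {f : F → M} {p : F} (hf : T.SmoothIntoCellAt i f p) : MDifferentiableAt 𝓘(ℝ, F) (𝓡 3) f p :=
  hf.contMDiffAt.mdifferentiableAt (by simp)

theorem Triangulation.smoothIntoCellAt_param (T : Triangulation M Cell Link) (i : Cell)
    {p : Fin 3 → ℝ} (hp : p ∈ stdCell 3) : T.SmoothIntoCellAt i (T.param i) p :=
  ⟨T.smooth i p hp, p, hp, rfl⟩

theorem Triangulation.smoothIntoCellAt_param_comp (T : Triangulation M Cell Link) (i : Cell)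
    {k : ℕ} {v : Fin (k + 1) → Fin 3 → ℝ} (hv : ∀ j, v j ∈ stdCell 3) {s : Fin k → ℝ}
    (hs : s ∈ stdCell k) : T.SmoothIntoCellAt i (T.param i ∘ affineSimplex v) s where
  contMDiffAt := ContMDiffAt.comp s (T.smooth i _ (affineSimplex_mem convex_stdCell hv hs))
    (contDiff_affineSimplex v).contDiffAt.contMDiffAt
  mem_cellSet := ⟨_, affineSimplex_mem convex_stdCell hv hs, rfl⟩

namespace OnShellData

variable {T : Triangulation M Cell Link} (D : OnShellData T) (i : Cell) (f : F → M)

/-- The rotations of a cell, pulled back along `f`. -/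
noncomputable def pulledG (t : ℝ) (y : F) : SO4 := D.g i t (f y)

/-- The translations of a cell, pulled back along `f`. -/
noncomputable def pulledC (t : ℝ) (y : F) : R4 := D.c i t (f y)

/-- The form `db` of a cell, pulled back along `f`. -/
noncomputable def pulledDb (t : ℝ) : F → F [⋀^Fin 2]→L[ℝ] Mat4 := extDeriv (pullback f (D.b i t))

/-- The form `dσ` of a cell, pulled back along `f`. -/
noncomputable def pulledDσ (t : ℝ) : F → F [⋀^Fin 2]→L[ℝ] R4 := extDeriv (pullback f (D.σ i t))

/-- The variation of `dσ`, pulled back along `f`. -/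
noncomputable def pulledδDσ (y : F) : F [⋀^Fin 2]→L[ℝ] R4 := deriv (fun t => D.pulledDσ i f t y) 0

/-- The boundary form of a cell, pulled back along `f`. -/
noncomputable def pulledBoundaryForm : F → F [⋀^Fin 2]→L[ℝ] ℝ :=
  boundaryFormOf (logVariation (D.pulledG i f)) (D.pulledC i f 0) (D.pulledDb i f 0)
    (D.pulledDσ i f 0) (D.pulledδDσ i f)

variable {i f} {p : F}

theorem contDiffAt_pulledG_family (hf : T.SmoothIntoCellAt i f p) (t : ℝ) :
    ContDiffAt ℝ ∞ (fun q : ℝ × F => (D.pulledG i f q.1 q.2 : Mat4)) (t, p) :=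
  (D.g_smooth i t _ hf.mem_cellSet).contDiffAt_comp hf.contMDiffAt

theorem contDiffAt_pulledC_family (hf : T.SmoothIntoCellAt i f p) (t : ℝ) :
    ContDiffAt ℝ ∞ (fun q : ℝ × F => D.pulledC i f q.1 q.2) (t, p) :=
  (D.c_smooth i t _ hf.mem_cellSet).contDiffAt_comp hf.contMDiffAt

theorem contDiffAt_pulledC (hf : T.SmoothIntoCellAt i f p) (t : ℝ) :
    ContDiffAt ℝ ∞ (D.pulledC i f t) p :=
  contDiffAt_of_family (D.contDiffAt_pulledC_family hf t)

theorem contDiffAt_logVariation_pulledG (hf : T.SmoothIntoCellAt i f p) :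
    ContDiffAt ℝ ∞ (logVariation (D.pulledG i f)) p :=
  contDiffAt_logVariation (D.contDiffAt_pulledG_family hf 0) (by simp)

theorem pullValues_A (hf : T.SmoothIntoCellAt i f p) (t : ℝ) (w : Fin 1 → F) :
    pullValues f (D.A i t) p w =
      (D.pulledG i f t p : Mat4)ᵀ * fderiv ℝ (fun y => (D.pulledG i f t y : Mat4)) p (w 0) :=
  congrArg (fun z => (D.pulledG i f t p : Mat4)ᵀ * z) (pullValues_dFun
    (D.g_smooth i t _ hf.mem_cellSet).mdifferentiableAt hf.mdifferentiableAt w)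

theorem pullValues_C (hf : T.SmoothIntoCellAt i f p) (t : ℝ) (w : Fin 1 → F) :
    pullValues f (D.C i t) p w =
      (D.pulledG i f t p : Mat4)ᵀ *ᵥ fderiv ℝ (D.pulledC i f t) p (w 0) :=
  congrArg (fun z => (D.pulledG i f t p : Mat4)ᵀ *ᵥ z) (pullValues_dFun
    (D.c_smooth i t _ hf.mem_cellSet).mdifferentiableAt hf.mdifferentiableAt w)

theorem pullValues_variation_A (hf : T.SmoothIntoCellAt i f p) (w : Fin 1 → F) :
    pullValues f (variation (D.A i)) p w = (D.pulledG i f 0 p : Mat4)ᵀ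
      * fderiv ℝ (logVariation (D.pulledG i f)) p (w 0) * (D.pulledG i f 0 p : Mat4) := by
  rw [pullValues_variation]
  simp only [D.pullValues_A hf]
  exact (hasDerivAt_maurerCartan ((D.contDiffAt_pulledG_family hf 0).of_le ENat.LEInfty.out)
    (w 0)).deriv

variable [IsManifold (𝓡 3) ∞ M]

theorem pullValues_db (hf : T.SmoothIntoCellAt i f p) (t : ℝ) (w : Fin 2 → F) :
    pullValues f (D.db i t) p w = D.pulledDb i f t p w := by
  rw [pulledDb, extDeriv_pullback_eq (hf.contMDiffAt.of_le ENat.LEInfty.out)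
    (D.b_smooth i t _ hf.mem_cellSet).differentiableAt]
  rfl

theorem pullValues_dσ (hf : T.SmoothIntoCellAt i f p) (t : ℝ) (w : Fin 2 → F) :
    pullValues f (D.dσ i t) p w = D.pulledDσ i f t p w := by
  rw [pulledDσ, extDeriv_pullback_eq (hf.contMDiffAt.of_le ENat.LEInfty.out)
    (D.σ_smooth i t _ hf.mem_cellSet).differentiableAt]
  rfl

theorem contDiffAt_pulledDb_family (hf : T.SmoothIntoCellAt i f p) (t : ℝ) :
    ContDiffAt ℝ ∞ (fun q : ℝ × F => D.pulledDb i f q.1 q.2) (t, p) :=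
  contDiffAt_extDeriv_family (η := fun t => pullback f (D.b i t))
    (contDiffAt_pullback hf.contMDiffAt (D.b_smooth i t _ hf.mem_cellSet)) (by simp)

theorem contDiffAt_pulledDσ_family (hf : T.SmoothIntoCellAt i f p) (t : ℝ) :
    ContDiffAt ℝ ∞ (fun q : ℝ × F => D.pulledDσ i f q.1 q.2) (t, p) :=
  contDiffAt_extDeriv_family (η := fun t => pullback f (D.σ i t))
    (contDiffAt_pullback hf.contMDiffAt (D.σ_smooth i t _ hf.mem_cellSet)) (by simp)

theorem contDiffAt_pulledDb (hf : T.SmoothIntoCellAt i f p) (t : ℝ) :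
    ContDiffAt ℝ ∞ (D.pulledDb i f t) p :=
  contDiffAt_of_family (D.contDiffAt_pulledDb_family hf t)

theorem contDiffAt_pulledDσ (hf : T.SmoothIntoCellAt i f p) (t : ℝ) :
    ContDiffAt ℝ ∞ (D.pulledDσ i f t) p :=
  contDiffAt_of_family (D.contDiffAt_pulledDσ_family hf t)

theorem contDiffAt_pulledδDσ (hf : T.SmoothIntoCellAt i f p) :
    ContDiffAt ℝ ∞ (D.pulledδDσ i f) p :=
  contDiffAt_of_family (H := fun t y => deriv (fun s => D.pulledDσ i f s y) t)
    (contDiffAt_deriv_family (D.contDiffAt_pulledDσ_family hf 0) (by simp))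

theorem extDeriv_pulledDb (hf : T.SmoothIntoCellAt i f p) (t : ℝ) :
    extDeriv (D.pulledDb i f t) p = 0 :=
  extDeriv_extDeriv_apply (contDiffAt_of_family (H := fun t => pullback f (D.b i t))
    (contDiffAt_pullback hf.contMDiffAt (D.b_smooth i t _ hf.mem_cellSet)))
      (by simpa using ENat.LEInfty.out)

theorem extDeriv_pulledDσ (hf : T.SmoothIntoCellAt i f p) (t : ℝ) :
    extDeriv (D.pulledDσ i f t) p = 0 :=
  extDeriv_extDeriv_apply (contDiffAt_of_family (H := fun t => pullback f (D.σ i t))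
    (contDiffAt_pullback hf.contMDiffAt (D.σ_smooth i t _ hf.mem_cellSet)))
      (by simpa using ENat.LEInfty.out)

theorem extDeriv_pulledδDσ (hf : T.SmoothIntoCellAt i f p) :
    extDeriv (D.pulledδDσ i f) p = 0 :=
  extDeriv_deriv_family_eq_zero (η := D.pulledDσ i f)
    ((D.contDiffAt_pulledDσ_family hf 0).of_le ENat.LEInfty.out) (D.extDeriv_pulledDσ hf)

theorem hasDerivAt_pulledDσ (hf : T.SmoothIntoCellAt i f p) (w : Fin 2 → F) :
    HasDerivAt (fun t => D.pulledDσ i f t p w) (D.pulledδDσ i f p w) 0 :=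
  (ContinuousAlternatingMap.apply ℝ F R4 w).hasFDerivAt.comp_hasDerivAt 0
    ((contDiffAt_param_of_family (H := D.pulledDσ i f)
      (D.contDiffAt_pulledDσ_family hf 0)).differentiableAt (by simp)).hasDerivAt

theorem pullValues_Sig (hf : T.SmoothIntoCellAt i f p) (t : ℝ) (w : Fin 2 → F) :
    pullValues f (D.Sig i t) p w = (D.pulledG i f t p : Mat4)ᵀ *ᵥ D.pulledDσ i f t p w :=
  congrArg (fun z => (D.pulledG i f t p : Mat4)ᵀ *ᵥ z) (D.pullValues_dσ hf t w)

theorem pullValues_B (hf : T.SmoothIntoCellAt i f p) (t : ℝ) (w : Fin 2 → F) :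
    pullValues f (D.B i t) p w = (D.pulledG i f t p : Mat4)ᵀ
      * (D.pulledDb i f t p w + mixedBracket (D.pulledDσ i f t p w) (D.pulledC i f t p))
      * (D.pulledG i f t p : Mat4) := by
  rw [← D.pullValues_db hf, ← D.pullValues_dσ hf]
  rfl

theorem pullValues_variation_Sig (hf : T.SmoothIntoCellAt i f p) (w : Fin 2 → F) :
    pullValues f (variation (D.Sig i)) p w = (D.pulledG i f 0 p : Mat4)ᵀ
      *ᵥ (D.pulledδDσ i f p w - logVariation (D.pulledG i f) p *ᵥ D.pulledDσ i f 0 p w) := by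
  rw [pullValues_variation]
  simp only [D.pullValues_Sig hf]
  exact (hasDerivAt_inv_mulVec ((D.contDiffAt_pulledG_family hf 0).of_le (by simp))
    (D.hasDerivAt_pulledDσ hf w)).deriv

theorem pullValues_variation_dσ (hf : T.SmoothIntoCellAt i f p) (w : Fin 2 → F) :
    pullValues f (variation (D.dσ i)) p w = D.pulledδDσ i f p w := by
  rw [pullValues_variation]
  simp only [D.pullValues_dσ hf]
  exact (D.hasDerivAt_pulledDσ hf w).deriv

theorem pullValues_boundaryForm (hf : T.SmoothIntoCellAt i f p) (w : Fin 2 → F) :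
    pullValues f (D.boundaryForm i) p w = D.pulledBoundaryForm i f p w := by
  have h_pull : pullValues f (D.boundaryForm i) p w =
      pairSo (pullValues f (D.db i 0) p w) (logVariation (D.pulledG i f) p)
        + pairSo (mixedBracket (pullValues f (D.dσ i 0) p w) (D.pulledC i f 0 p))
          (logVariation (D.pulledG i f) p)
        - D.pulledC i f 0 p ⬝ᵥ pullValues f (variation (D.dσ i)) p w := rfl
  rw [h_pull, D.pullValues_db hf, D.pullValues_dσ hf, D.pullValues_variation_dσ hf,
    ← pairSo_add_left]
  rfl

theorem contDiffAt_pulledBoundaryForm (hf : T.SmoothIntoCellAt i f p) :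
    ContDiffAt ℝ ∞ (D.pulledBoundaryForm i f) p :=
  contDiffAt_boundaryFormOf (D.contDiffAt_logVariation_pulledG hf) (D.contDiffAt_pulledC hf 0)
    (D.contDiffAt_pulledDb hf 0) (D.contDiffAt_pulledDσ hf 0) (D.contDiffAt_pulledδDσ hf)

theorem extDeriv_pulledBoundaryForm (hf : T.SmoothIntoCellAt i f p) (e : Fin 3 → F) :
    extDeriv (D.pulledBoundaryForm i f) p e =
      pullValues f (wedge21 pairSo (D.B i 0) (variation (D.A i))) p e
        - pullValues f (wedge12 (fun v w : R4 => v ⬝ᵥ w) (D.C i 0) (variation (D.Sig i))) p e := by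
  have h_skew := logVariation_skew ((D.contDiffAt_pulledG_family hf 0).of_le (by simp))
  rw [pulledBoundaryForm, extDeriv_boundaryFormOf
    ((D.contDiffAt_logVariation_pulledG hf).of_le (by simp))
    ((D.contDiffAt_pulledC hf 0).of_le (by simp)) ((D.contDiffAt_pulledDb hf 0).of_le (by simp))
    ((D.contDiffAt_pulledDσ hf 0).of_le (by simp)) ((D.contDiffAt_pulledδDσ hf).of_le (by simp))
    (D.extDeriv_pulledDb hf 0) (D.extDeriv_pulledDσ hf 0) (D.extDeriv_pulledδDσ hf),
    pullValues_wedge21, pullValues_wedge12, ← Finset.sum_sub_distrib]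
  refine Finset.sum_congr rfl fun j _ => ?_
  rw [← smul_sub, D.pullValues_B hf, D.pullValues_C hf, D.pullValues_variation_A hf,
    D.pullValues_variation_Sig hf, pairSo_conj_sub_dotProduct_conj _ h_skew]

/-! ### The potential of a cell -/

theorem continuousOn_wedge12_C_variation_Sig {S : Set F} (hf : ∀ p ∈ S, T.SmoothIntoCellAt i f p)
    (e : Fin 3 → F) :
    ContinuousOn (fun p => pullValues f
      (wedge12 (fun v w : R4 => v ⬝ᵥ w) (D.C i 0) (variation (D.Sig i))) p e) S := by
  refine ContinuousOn.congr (f := fun p => ∑ j : Fin 3, (-1 : ℤ) ^ (j : ℕ) •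
    (fderiv ℝ (D.pulledC i f 0) p (e j) ⬝ᵥ (D.pulledδDσ i f p (j.removeNth e)
      - logVariation (D.pulledG i f) p *ᵥ D.pulledDσ i f 0 p (j.removeNth e)))) ?_ fun p hp => ?_
  · refine continuousOn_finsetSum _ fun j _ => ContinuousOn.fun_const_smul (fun p hp => ?_) _
    have h_dc := ((D.contDiffAt_pulledC (hf p hp) 0).fderiv_right (m := ∞) (by simp)).clm_apply
      (contDiffAt_const (c := e j))
    have h_δdσ := contDiffAt_form_apply (D.contDiffAt_pulledδDσ (hf p hp)) (j.removeNth e)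
    have h_dσ := contDiffAt_form_apply (D.contDiffAt_pulledDσ (hf p hp) 0) (j.removeNth e)
    exact (contDiffAt_bilin isBilinearMap_dotProduct h_dc (h_δdσ.sub (contDiffAt_bilin
      isBilinearMap_mulVec (D.contDiffAt_logVariation_pulledG (hf p hp))
        h_dσ))).continuousAt.continuousWithinAt
  · simp only [pullValues_wedge12, D.pullValues_C (hf p hp), D.pullValues_variation_Sig (hf p hp),
      dotProduct_transpose_mulVec (mul_transpose_SO4 _)]

theorem integrate_wedge21_sub_integrate_wedge12 (i : Cell) :
    integrate (T.param i) (wedge21 pairSo (D.B i 0) (variation (D.A i)))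
      - integrate (T.param i) (wedge12 (fun v w : R4 => v ⬝ᵥ w) (D.C i 0) (variation (D.Sig i))) =
    affineIntegral (stdVertex 3) (extDeriv (D.pulledBoundaryForm i (T.param i))) := by
  have hf : ∀ p ∈ stdCell 3, T.SmoothIntoCellAt i (T.param i) p :=
    fun p hp => T.smoothIntoCellAt_param i hp
  have h_ext : ContinuousOn (fun p => extDeriv (D.pulledBoundaryForm i (T.param i)) p
      fun j => Pi.single j 1) (stdCell 3) := fun p hp =>
    (contDiffAt_form_apply (contDiffAt_of_family (t := 0)
      (H := fun _ => extDeriv (D.pulledBoundaryForm i (T.param i)))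
      (contDiffAt_extDeriv_family (m := ∞) (η := fun _ => D.pulledBoundaryForm i (T.param i))
        (ContDiffAt.comp (0, p) (D.contDiffAt_pulledBoundaryForm (hf p hp)) contDiffAt_snd)
        (by simp))) _).continuousAt.continuousWithinAt
  have h_split : ∀ p ∈ stdCell 3, pullValues (T.param i)
      (wedge21 pairSo (D.B i 0) (variation (D.A i))) p (fun j => Pi.single j 1) =
      extDeriv (D.pulledBoundaryForm i (T.param i)) p (fun j => Pi.single j 1)
        + pullValues (T.param i) (wedge12 (fun v w : R4 => v ⬝ᵥ w) (D.C i 0)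
          (variation (D.Sig i))) p (fun j => Pi.single j 1) := fun p hp =>
    sub_eq_iff_eq_add.1 (D.extDeriv_pulledBoundaryForm (hf p hp) _).symm
  rw [affineIntegral_stdVertex, integrate, integrate,
    setIntegral_congr_fun measurableSet_stdCell h_split,
    integral_add (integrableOn_stdCell h_ext)
      (integrableOn_stdCell (D.continuousOn_wedge12_C_variation_Sig hf _)), add_sub_cancel_right]

theorem integrate_boundaryForm_comp (i : Cell) {v : Fin 3 → Fin 3 → ℝ}
    (hv : ∀ j, v j ∈ stdCell 3) :
    integrate (T.param i ∘ affineSimplex v) (D.boundaryForm i) =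
      affineIntegral v (D.pulledBoundaryForm i (T.param i)) := by
  refine setIntegral_congr_fun measurableSet_stdCell fun s hs => ?_
  have hf := T.smoothIntoCellAt_param i (affineSimplex_mem convex_stdCell hv hs)
  simp only [pullValues_comp hf.mdifferentiableAt (hasFDerivAt_affineSimplex v s),
    D.pullValues_boundaryForm hf, affineSimplexLin_single]

theorem potential_eq_sum_boundaryIntegral [Fintype Cell] :
    D.potential = ∑ i, T.boundaryIntegral i (D.boundaryForm i) := by
  refine Finset.sum_congr rfl fun i _ => ?_
  rw [integrate_wedge21_sub_integrate_wedge12, affineIntegral_extDeriv fun p hp =>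
    (D.contDiffAt_pulledBoundaryForm (T.smoothIntoCellAt_param i hp)).of_le (by simp)]
  exact Finset.sum_congr rfl fun j _ => congrArg _
    (D.integrate_boundaryForm_comp i fun _ => stdVertex_mem _).symm

end OnShellData

end Cell

/-! ### Continuity across a triangle -/

theorem eq_of_rotation_mulVec_eq {h g g' : SO4} (hg : g = h * g') {v w : R4}
    (hvw : (g : Mat4)ᵀ *ᵥ v = (g' : Mat4)ᵀ *ᵥ w) : w = (h : Mat4)ᵀ *ᵥ v := by
  have h_rotate := congrArg (fun z => (g' : Mat4) *ᵥ z) hvw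
  simp only [mulVec_mulVec, mul_transpose_SO4, one_mulVec] at h_rotate
  rw [← h_rotate, hg, Submonoid.coe_mul, transpose_mul, ← Matrix.mul_assoc, mul_transpose_SO4,
    Matrix.one_mul]

theorem eq_of_rotation_conj_eq {h g g' : SO4} (hg : g = h * g') {a b : Mat4}
    (hab : (g : Mat4)ᵀ * a * (g : Mat4) = (g' : Mat4)ᵀ * b * (g' : Mat4)) :
    b = (h : Mat4)ᵀ * a * (h : Mat4) :=
  calc b = (g' : Mat4) * ((g' : Mat4)ᵀ * b * (g' : Mat4)) * (g' : Mat4)ᵀ := by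
        simp only [← Matrix.mul_assoc, mul_transpose_SO4, Matrix.one_mul]
        rw [Matrix.mul_assoc, mul_transpose_SO4, Matrix.mul_one]
    _ = ((g' : Mat4) * (g' : Mat4)ᵀ) * ((h : Mat4)ᵀ * a * (h : Mat4))
          * ((g' : Mat4) * (g' : Mat4)ᵀ) := by
        rw [← hab, hg]
        simp only [Submonoid.coe_mul, transpose_mul, Matrix.mul_assoc]
    _ = (h : Mat4)ᵀ * a * (h : Mat4) := by
        rw [mul_transpose_SO4, Matrix.one_mul, Matrix.mul_one]

theorem mixedBracket_mulVec (r : Mat4) (v y : R4) :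
    mixedBracket (r *ᵥ v) (r *ᵥ y) = r * mixedBracket v y * rᵀ := by
  simp only [mixedBracket, Matrix.mul_sub, Matrix.sub_mul, mul_vecMulVec, vecMulVec_mul,
    vecMul_transpose]

section Rigidity

variable {E : Type*} [NormedAddCommGroup E] [NormedSpace ℝ E] {S : Set E}
  {g g' : E → SO4} {p q : E}

theorem eq_of_hasFDerivAt_zero {V : Type*} [NormedAddCommGroup V] [NormedSpace ℝ V] {f : E → V}
    (hS : Convex ℝ S) (hf : ∀ r ∈ S, HasFDerivAt f (0 : E →L[ℝ] V) r) (hp : p ∈ S) (hq : q ∈ S) :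
    f p = f q := by
  have h_bound := hS.norm_image_sub_le_of_norm_hasFDerivWithin_le (C := 0)
    (fun r hr => (hf r hr).hasFDerivWithinAt) (fun _ _ => norm_zero.le) hq hp
  rw [zero_mul] at h_bound
  exact sub_eq_zero.1 (norm_le_zero_iff.1 h_bound)

theorem transpose_fderiv_mul_rotation (hg : DifferentiableAt ℝ (fun r => (g r : Mat4)) p) (e : E) :
    (fderiv ℝ (fun r => (g r : Mat4)) p e)ᵀ * (g p : Mat4)
      = -((g p : Mat4)ᵀ * fderiv ℝ (fun r => (g r : Mat4)) p e) := by
  have hgT := (transposeL (Fin 4) (Fin 4)).hasFDerivAt.comp p hg.hasFDerivAt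
  have h_prod := fderiv_bilin isBilinearMap_mul hgT.differentiableAt hg e
  have h_one : (fun r => (transposeL (Fin 4) (Fin 4) ∘ fun r => (g r : Mat4)) r * (g r : Mat4)) =
      fun _ => 1 := funext fun r => transpose_mul_SO4 (g r)
  rw [h_one, hgT.fderiv, fderiv_const_apply] at h_prod
  exact eq_neg_of_add_eq_zero_left h_prod.symm

theorem hasFDerivAt_mul_transpose_zero (hg : DifferentiableAt ℝ (fun r => (g r : Mat4)) p)
    (hg' : DifferentiableAt ℝ (fun r => (g' r : Mat4)) p)
    (h_form : ∀ e, (g p : Mat4)ᵀ * fderiv ℝ (fun r => (g r : Mat4)) p e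
      = (g' p : Mat4)ᵀ * fderiv ℝ (fun r => (g' r : Mat4)) p e) :
    HasFDerivAt (fun r => (g r : Mat4) * (g' r : Mat4)ᵀ) (0 : E →L[ℝ] Mat4) p := by
  have hgT' := (transposeL (Fin 4) (Fin 4)).hasFDerivAt.comp p hg'.hasFDerivAt
  refine (differentiableAt_bilin isBilinearMap_mul hg
    hgT'.differentiableAt).hasFDerivAt.congr_fderiv (ContinuousLinearMap.ext fun e => ?_)
  refine (fderiv_bilin isBilinearMap_mul hg hgT'.differentiableAt e).trans ?_
  rw [hgT'.fderiv]
  set dg := fderiv ℝ (fun r => (g r : Mat4)) p e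
  set dg' := fderiv ℝ (fun r => (g' r : Mat4)) p e
  calc dg * (g' p : Mat4)ᵀ + (g p : Mat4) * dg'ᵀ
      = (g p : Mat4) * (g p : Mat4)ᵀ * dg * (g' p : Mat4)ᵀ
          + (g p : Mat4) * dg'ᵀ * ((g' p : Mat4) * (g' p : Mat4)ᵀ) := by
        rw [mul_transpose_SO4, mul_transpose_SO4, Matrix.one_mul, Matrix.mul_one]
    _ = (g p : Mat4) * ((g p : Mat4)ᵀ * dg + dg'ᵀ * (g' p : Mat4)) * (g' p : Mat4)ᵀ := by
        simp only [Matrix.mul_add, Matrix.add_mul, Matrix.mul_assoc]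
    _ = 0 := by
        rw [h_form, transpose_fderiv_mul_rotation hg', add_neg_cancel, Matrix.mul_zero,
          Matrix.zero_mul]

theorem rotation_mul_inv_eq (hS : Convex ℝ S)
    (hg : ∀ r ∈ S, DifferentiableAt ℝ (fun r => (g r : Mat4)) r)
    (hg' : ∀ r ∈ S, DifferentiableAt ℝ (fun r => (g' r : Mat4)) r)
    (h_form : ∀ r ∈ S, ∀ e, (g r : Mat4)ᵀ * fderiv ℝ (fun r => (g r : Mat4)) r e
      = (g' r : Mat4)ᵀ * fderiv ℝ (fun r => (g' r : Mat4)) r e) (hp : p ∈ S) (hq : q ∈ S) :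
    g p * (g' p)⁻¹ = g q * (g' q)⁻¹ :=
  Subtype.ext (eq_of_hasFDerivAt_zero (f := fun r => (g r : Mat4) * (g' r : Mat4)ᵀ) hS
    (fun r hr => hasFDerivAt_mul_transpose_zero (hg r hr) (hg' r hr) (h_form r hr)) hp hq)

theorem rotation_mulVec_sub_eq (hS : Convex ℝ S) {h : SO4} (h_rot : ∀ r ∈ S, g r = h * g' r)
    {c c' : E → R4} (hc : ∀ r ∈ S, DifferentiableAt ℝ c r)
    (hc' : ∀ r ∈ S, DifferentiableAt ℝ c' r)
    (h_form : ∀ r ∈ S, ∀ e,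
      (g r : Mat4)ᵀ *ᵥ fderiv ℝ c r e = (g' r : Mat4)ᵀ *ᵥ fderiv ℝ c' r e)
    (hp : p ∈ S) (hq : q ∈ S) :
    (h : Mat4) *ᵥ c' p - c p = (h : Mat4) *ᵥ c' q - c q := by
  let L : R4 →L[ℝ] R4 := isBilinearMap_mulVec.toContinuousBilinearMap (h : Mat4)
  refine eq_of_hasFDerivAt_zero (f := fun r => L (c' r) - c r) hS (fun r hr => ?_) hp hq
  refine ((L.hasFDerivAt.comp r (hc' r hr).hasFDerivAt).sub (hc r hr).hasFDerivAt).congr_fderiv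
    (ContinuousLinearMap.ext fun e => sub_eq_zero.2 ?_)
  change (h : Mat4) *ᵥ fderiv ℝ c' r e = fderiv ℝ c r e
  rw [eq_of_rotation_mulVec_eq (h_rot r hr) (h_form r hr e), mulVec_mulVec, mul_transpose_SO4,
    one_mulVec]

end Rigidity

section Links

variable {M : Type*} [TopologicalSpace M] [ChartedSpace (EuclideanSpace ℝ (Fin 3)) M]
  {Cell Link : Type*} {T : Triangulation M Cell Link}

theorem Triangulation.smoothIntoCellAt_source (T : Triangulation M Cell Link) (l : Link)
    {s : Fin 2 → ℝ} (hs : s ∈ stdCell 2) :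
    T.SmoothIntoCellAt (T.source l).1 (T.triangle l) s :=
  T.smoothIntoCellAt_param_comp _ (fun _ => stdVertex_mem _) hs

theorem Triangulation.smoothIntoCellAt_target (T : Triangulation M Cell Link) (l : Link)
    {s : Fin 2 → ℝ} (hs : s ∈ stdCell 2) :
    T.SmoothIntoCellAt (T.target l).1 (T.triangle l) s where
  contMDiffAt := (T.smoothIntoCellAt_source l hs).contMDiffAt
  mem_cellSet := by
    rw [Triangulation.triangle, T.glue_eq l hs]
    exact (T.smoothIntoCellAt_param_comp _ (fun _ => stdVertex_mem _) hs).mem_cellSet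

namespace OnShellData

variable {D : OnShellData T} {h : Link → ℝ → SO4} {x : Link → ℝ → R4}

theorem differentiableAt_pulledG (D : OnShellData T) {F : Type*} [NormedAddCommGroup F]
    [NormedSpace ℝ F] {i : Cell} {f : F → M} {p : F} (hf : T.SmoothIntoCellAt i f p) (t : ℝ) :
    DifferentiableAt ℝ (fun y => (D.pulledG i f t y : Mat4)) p :=
  (contDiffAt_of_family (H := fun t y => (D.pulledG i f t y : Mat4))
    (D.contDiffAt_pulledG_family hf t)).differentiableAt (by simp)

theorem Continuity.rotation_quotient_const (hD : D.Continuity) (l : Link) (t : ℝ) {s : Fin 2 → ℝ}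
    (hs : s ∈ stdCell 2) :
    D.g (T.source l).1 t (T.triangle l s) * (D.g (T.target l).1 t (T.triangle l s))⁻¹
      = D.g (T.source l).1 t (T.triangle l 0) * (D.g (T.target l).1 t (T.triangle l 0))⁻¹ := by
  refine rotation_mul_inv_eq (g := D.pulledG (T.source l).1 (T.triangle l) t)
    (g' := D.pulledG (T.target l).1 (T.triangle l) t) convex_stdCell
    (fun r hr => D.differentiableAt_pulledG (T.smoothIntoCellAt_source l hr) t)
    (fun r hr => D.differentiableAt_pulledG (T.smoothIntoCellAt_target l hr) t)
    (fun r hr e => ?_) hs zero_mem_stdCell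
  have hA := (hD l t).1 r hr fun _ => e
  rwa [D.pullValues_A (T.smoothIntoCellAt_source l hr),
    D.pullValues_A (T.smoothIntoCellAt_target l hr)] at hA

theorem Continuity.translation_difference_const (hD : D.Continuity) (l : Link) (t : ℝ) {r : SO4}
    (hr : ∀ s ∈ stdCell 2, D.g (T.source l).1 t (T.triangle l s)
      = r * D.g (T.target l).1 t (T.triangle l s)) {s : Fin 2 → ℝ} (hs : s ∈ stdCell 2) :
    (r : Mat4) *ᵥ D.c (T.target l).1 t (T.triangle l s) - D.c (T.source l).1 t (T.triangle l s)
      = (r : Mat4) *ᵥ D.c (T.target l).1 t (T.triangle l 0)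
        - D.c (T.source l).1 t (T.triangle l 0) := by
  refine rotation_mulVec_sub_eq (c := D.pulledC (T.source l).1 (T.triangle l) t)
    (c' := D.pulledC (T.target l).1 (T.triangle l) t) convex_stdCell hr
    (fun q hq => (D.contDiffAt_pulledC (T.smoothIntoCellAt_source l hq) t).differentiableAt
      (by simp))
    (fun q hq => (D.contDiffAt_pulledC (T.smoothIntoCellAt_target l hq) t).differentiableAt
      (by simp))
    (fun q hq e => ?_) hs zero_mem_stdCell
  have hC := (hD l t).2.2.1 q hq fun _ => e
  rwa [D.pullValues_C (T.smoothIntoCellAt_source l hq),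
    D.pullValues_C (T.smoothIntoCellAt_target l hq)] at hC

theorem IsContinuitySolution.rotation_eq (hs : D.IsContinuitySolution h x) (l : Link) (t : ℝ) :
    h l t = D.g (T.source l).1 t (T.triangle l 0) * (D.g (T.target l).1 t (T.triangle l 0))⁻¹ :=
  eq_mul_inv_of_mul_eq (hs l t 0 zero_mem_stdCell).1.symm

theorem IsContinuitySolution.translation_eq (hs : D.IsContinuitySolution h x) (l : Link) (t : ℝ) :
    x l t = (h l t : Mat4) *ᵥ D.c (T.target l).1 t (T.triangle l 0)
      - D.c (T.source l).1 t (T.triangle l 0) := by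
  rw [(hs l t 0 zero_mem_stdCell).2, mulVec_mulVec, ← Submonoid.coe_mul, mul_inv_cancel,
    Submonoid.coe_one, one_mulVec, add_sub_cancel_left]

theorem Continuity.existsUnique_continuitySolution (hD : D.Continuity) :
    ∃! d : (Link → ℝ → SO4) × (Link → ℝ → R4), D.IsContinuitySolution d.1 d.2 := by
  let h : Link → ℝ → SO4 := fun l t =>
    D.g (T.source l).1 t (T.triangle l 0) * (D.g (T.target l).1 t (T.triangle l 0))⁻¹
  let x : Link → ℝ → R4 := fun l t => (h l t : Mat4) *ᵥ D.c (T.target l).1 t (T.triangle l 0)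
    - D.c (T.source l).1 t (T.triangle l 0)
  have h_rot : ∀ l t, ∀ s ∈ stdCell 2, D.g (T.source l).1 t (T.triangle l s)
      = h l t * D.g (T.target l).1 t (T.triangle l s) := fun l t s hs =>
    mul_inv_eq_iff_eq_mul.1 (hD.rotation_quotient_const l t hs)
  have h_trans : ∀ l t, ∀ s ∈ stdCell 2, D.c (T.source l).1 t (T.triangle l s) + x l t
      = (h l t : Mat4) *ᵥ D.c (T.target l).1 t (T.triangle l s) := fun l t s hs =>
    (add_comm _ _).trans
      (sub_eq_iff_eq_add.1 (hD.translation_difference_const l t (h_rot l t) hs)).symm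
  refine ⟨(h, x), fun l t s hs => ⟨h_rot l t s hs, ?_⟩, ?_⟩
  · rw [h_trans l t s hs, mulVec_mulVec, ← Submonoid.coe_mul, inv_mul_cancel, Submonoid.coe_one,
      one_mulVec]
  · rintro ⟨h', x'⟩ hs
    obtain rfl : h' = h := funext₂ hs.rotation_eq
    exact congrArg _ (funext₂ hs.translation_eq)

theorem IsContinuitySolution.contDiff_rotation (hs : D.IsContinuitySolution h x) (l : Link) :
    ContDiff ℝ ∞ (fun t => (h l t : Mat4)) := by
  have h_eq : (fun t => (h l t : Mat4)) = fun t =>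
      (D.pulledG (T.source l).1 (T.triangle l) t 0 : Mat4)
        * (D.pulledG (T.target l).1 (T.triangle l) t 0 : Mat4)ᵀ :=
    funext fun t => congrArg Subtype.val (hs.rotation_eq l t)
  rw [h_eq]
  exact contDiff_iff_contDiffAt.2 fun t => contDiffAt_bilin isBilinearMap_mul
    (contDiffAt_param_of_family (H := fun t y => (D.pulledG _ (T.triangle l) t y : Mat4))
      (D.contDiffAt_pulledG_family (T.smoothIntoCellAt_source l zero_mem_stdCell) t))
    (contDiffAt_transpose
      (contDiffAt_param_of_family (H := fun t y => (D.pulledG _ (T.triangle l) t y : Mat4))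
        (D.contDiffAt_pulledG_family (T.smoothIntoCellAt_target l zero_mem_stdCell) t)))

theorem IsContinuitySolution.contDiff_translation (hs : D.IsContinuitySolution h x) (l : Link) :
    ContDiff ℝ ∞ (x l) := by
  have h_eq : x l = fun t => (h l t : Mat4) *ᵥ D.pulledC (T.target l).1 (T.triangle l) t 0
      - D.pulledC (T.source l).1 (T.triangle l) t 0 :=
    funext (hs.translation_eq l)
  rw [h_eq]
  exact contDiff_iff_contDiffAt.2 fun t =>
    (contDiffAt_bilin isBilinearMap_mulVec (hs.contDiff_rotation l).contDiffAt
      (contDiffAt_param_of_family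
        (D.contDiffAt_pulledC_family (T.smoothIntoCellAt_target l zero_mem_stdCell) t))).sub
      (contDiffAt_param_of_family
        (D.contDiffAt_pulledC_family (T.smoothIntoCellAt_source l zero_mem_stdCell) t))

theorem Continuity.agreeOn_dσ_target (hD : D.Continuity) (hs : D.IsContinuitySolution h x)
    (l : Link) (t : ℝ) :
    T.AgreeOn l (D.dσ (T.target l).1 t)
      (fun y u => ((h l t)⁻¹ : SO4).1 *ᵥ D.dσ (T.source l).1 t y u) :=
  fun s hs2 w => eq_of_rotation_mulVec_eq (hs l t s hs2).1 ((hD l t).2.2.2 s hs2 w)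

theorem Continuity.agreeOn_curvature_target (hD : D.Continuity) (hs : D.IsContinuitySolution h x)
    (l : Link) (t : ℝ) :
    T.AgreeOn l
      (fun y u => D.db (T.target l).1 t y u
        + mixedBracket (D.dσ (T.target l).1 t y u) (D.c (T.target l).1 t y))
      (fun y u => (h l t : Mat4)ᵀ * (D.db (T.source l).1 t y u
        + mixedBracket (D.dσ (T.source l).1 t y u) (D.c (T.source l).1 t y)) * (h l t : Mat4)) :=
  fun s hs2 w => eq_of_rotation_conj_eq (hs l t s hs2).1 ((hD l t).2.1 s hs2 w)

theorem Continuity.agreeOn_db_target (hD : D.Continuity) (hs : D.IsContinuitySolution h x)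
    (l : Link) (t : ℝ) :
    T.AgreeOn l (D.db (T.target l).1 t)
      (fun y u => ((h l t)⁻¹ : SO4).1 * (D.db (T.source l).1 t y u
        - mixedBracket (D.dσ (T.source l).1 t y u) (x l t)) * (h l t).1) := by
  intro s hs2 w
  set db := pullValues (T.triangle l) (D.db (T.source l).1 t) s w
  set dσ := pullValues (T.triangle l) (D.dσ (T.source l).1 t) s w
  set c := D.c (T.source l).1 t (T.triangle l s)
  have h_curv : pullValues (T.triangle l) (D.db (T.target l).1 t) s w
      + mixedBracket (pullValues (T.triangle l) (D.dσ (T.target l).1 t) s w)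
        (D.c (T.target l).1 t (T.triangle l s))
      = (h l t : Mat4)ᵀ * (db + mixedBracket dσ c) * (h l t : Mat4) :=
    hD.agreeOn_curvature_target hs l t s hs2 w
  have h_dσ : pullValues (T.triangle l) (D.dσ (T.target l).1 t) s w = (h l t : Mat4)ᵀ *ᵥ dσ :=
    hD.agreeOn_dσ_target hs l t s hs2 w
  have h_c : D.c (T.target l).1 t (T.triangle l s) = (h l t : Mat4)ᵀ *ᵥ (c + x l t) :=
    (hs l t s hs2).2
  rw [h_dσ, h_c, mixedBracket_mulVec, transpose_transpose, ← eq_sub_iff_add_eq,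
    ← Matrix.sub_mul, ← Matrix.mul_sub, isBilinearMap_mixedBracket.add_right,
    ← sub_sub, add_sub_cancel_right] at h_curv
  exact h_curv

end OnShellData

end Links

/-! ### Integrals over simplices, depending on a parameter -/

theorem hasDerivAt_integral_of_contDiffAt {E V : Type*} [NormedAddCommGroup E] [NormedSpace ℝ E]
    [MeasurableSpace E] [BorelSpace E] {μ : Measure E} [IsFiniteMeasureOnCompacts μ]
    [NormedAddCommGroup V] [NormedSpace ℝ V] {K : Set E} (hK : IsCompact K) {H : ℝ → E → V}
    (hH : ∀ t, ∀ s ∈ K, ContDiffAt ℝ 1 (fun q : ℝ × E => H q.1 q.2) (t, s)) (t : ℝ) :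
    HasDerivAt (fun r => ∫ s in K, H r s ∂μ) (∫ s in K, deriv (fun r => H r s) t ∂μ) t := by
  have h_int : ∀ r, IntegrableOn (H r) K μ := fun r =>
    ContinuousOn.integrableOn_compact hK fun s hs =>
      (contDiffAt_of_family (hH r s hs)).continuousAt.continuousWithinAt
  have h_deriv : ContinuousOn (fun q : ℝ × E => deriv (fun r => H r q.2) q.1)
      (Metric.closedBall t 1 ×ˢ K) := fun q hq =>
    (contDiffAt_deriv_family (m := 0) (hH q.1 q.2 hq.2) (by simp)).continuousAt.continuousWithinAt
  have h_deriv_int : IntegrableOn (fun s => deriv (fun r => H r s) t) K μ :=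
    ContinuousOn.integrableOn_compact hK (h_deriv.comp (f := fun s => (t, s)) (by fun_prop)
      fun s hs => ⟨Metric.mem_closedBall_self zero_le_one, hs⟩)
  obtain ⟨C, hC⟩ := ((isCompact_closedBall t 1).prod hK).exists_bound_of_continuousOn h_deriv
  refine (hasDerivAt_integral_of_dominated_loc_of_deriv_le (bound := fun _ => C)
    (F' := fun r s => deriv (fun r => H r s) r) (Metric.closedBall_mem_nhds t one_pos)
    (Eventually.of_forall fun r => (h_int r).aestronglyMeasurable) (h_int t)
    h_deriv_int.aestronglyMeasurable ?_ (continuousOn_const.integrableOn_compact hK) ?_).2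
  · exact (ae_restrict_iff' hK.measurableSet).2 (Eventually.of_forall fun s hs r hr =>
      hC (r, s) ⟨hr, hs⟩)
  · exact (ae_restrict_iff' hK.measurableSet).2 (Eventually.of_forall fun s hs r _ =>
      ((contDiffAt_param_of_family (hH r s hs)).differentiableAt one_ne_zero).hasDerivAt)

section AffineIntegral

variable {E V W : Type*} [NormedAddCommGroup E] [NormedSpace ℝ E] [NormedAddCommGroup V]
  [NormedSpace ℝ V] [NormedAddCommGroup W] [NormedSpace ℝ W] {k : ℕ} {v : Fin (k + 1) → E}

theorem integrableOn_affineSimplex {η : E → E [⋀^Fin k]→L[ℝ] V}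
    (hη : ∀ s ∈ stdCell k, ContinuousAt η (affineSimplex v s)) (w : Fin k → E) :
    IntegrableOn (fun s => η (affineSimplex v s) w) (stdCell k) :=
  integrableOn_stdCell fun s hs =>
    ((ContinuousAlternatingMap.apply ℝ E V w).continuous.continuousAt.comp
      (ContinuousAt.comp (hη s hs)
        (contDiff_affineSimplex (n := 0) v).continuous.continuousAt)).continuousWithinAt

theorem affineIntegral_congr {η η' : E → E [⋀^Fin k]→L[ℝ] V}
    (h : ∀ s ∈ stdCell k, η (affineSimplex v s) = η' (affineSimplex v s)) :
    affineIntegral v η = affineIntegral v η' :=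
  setIntegral_congr_fun measurableSet_stdCell fun s hs => DFunLike.congr_fun (h s hs) _

theorem affineIntegral_add {η η' : E → E [⋀^Fin k]→L[ℝ] V}
    (hη : ∀ s ∈ stdCell k, ContinuousAt η (affineSimplex v s))
    (hη' : ∀ s ∈ stdCell k, ContinuousAt η' (affineSimplex v s)) :
    affineIntegral v (fun y => η y + η' y) = affineIntegral v η + affineIntegral v η' :=
  integral_add (integrableOn_affineSimplex hη _) (integrableOn_affineSimplex hη' _)

theorem affineIntegral_sub {η η' : E → E [⋀^Fin k]→L[ℝ] V}
    (hη : ∀ s ∈ stdCell k, ContinuousAt η (affineSimplex v s))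
    (hη' : ∀ s ∈ stdCell k, ContinuousAt η' (affineSimplex v s)) :
    affineIntegral v (fun y => η y - η' y) = affineIntegral v η - affineIntegral v η' :=
  integral_sub (integrableOn_affineSimplex hη _) (integrableOn_affineSimplex hη' _)

theorem affineIntegral_compContinuousAlternatingMap [CompleteSpace V] [CompleteSpace W]
    (L : V →L[ℝ] W) {η : E → E [⋀^Fin k]→L[ℝ] V}
    (hη : ∀ s ∈ stdCell k, ContinuousAt η (affineSimplex v s)) :
    affineIntegral v (fun y => L.compContinuousAlternatingMap (η y)) = L (affineIntegral v η) :=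
  L.integral_comp_comm (integrableOn_affineSimplex hη _)

theorem hasDerivAt_affineIntegral {η : ℝ → E → E [⋀^Fin k]→L[ℝ] V}
    (hη : ∀ t, ∀ s ∈ stdCell k,
      ContDiffAt ℝ 1 (fun q : ℝ × E => η q.1 q.2) (t, affineSimplex v s)) (t : ℝ) :
    HasDerivAt (fun r => affineIntegral v (η r))
      (affineIntegral v fun y => deriv (fun r => η r y) t) t := by
  let w : Fin k → E := fun j => v j.succ - v 0
  have h_eval : ∀ s ∈ stdCell k, deriv (fun r => η r (affineSimplex v s) w) t
      = deriv (fun r => η r (affineSimplex v s)) t w := fun s hs =>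
    ((ContinuousAlternatingMap.apply ℝ E V w).hasFDerivAt.comp_hasDerivAt t
      ((contDiffAt_param_of_family (H := η) (hη t s hs)).differentiableAt
        one_ne_zero).hasDerivAt).deriv
  refine (hasDerivAt_integral_of_contDiffAt isCompact_stdCell
    (H := fun r s => η r (affineSimplex v s) w) (fun r s hs => ?_) t).congr_deriv
    (setIntegral_congr_fun measurableSet_stdCell h_eval)
  exact (ContDiffAt.comp (f := fun q : ℝ × (Fin k → ℝ) => (q.1, affineSimplex v q.2)) (r, s)
    (hη r s hs) (contDiffAt_fst.prodMk ((contDiff_affineSimplex v).contDiffAt.comp (r, s)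
      contDiffAt_snd))).continuousLinearMap_comp (ContinuousAlternatingMap.apply ℝ E V w)

theorem affineIntegral_boundaryFormOf_const {v : Fin 3 → E} (Δ : Mat4) (c : R4)
    {β : E → E [⋀^Fin 2]→L[ℝ] Mat4} {ς ς' : E → E [⋀^Fin 2]→L[ℝ] R4}
    (hβ : ∀ s ∈ stdCell 2, ContinuousAt β (affineSimplex v s))
    (hς : ∀ s ∈ stdCell 2, ContinuousAt ς (affineSimplex v s))
    (hς' : ∀ s ∈ stdCell 2, ContinuousAt ς' (affineSimplex v s)) :
    affineIntegral v (boundaryFormOf (fun _ => Δ) (fun _ => c) β ς ς') =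
      pairSo (affineIntegral v β + mixedBracket (affineIntegral v ς) c) Δ
        - c ⬝ᵥ affineIntegral v ς' := by
  let P := isBilinearMap_pairSo.toContinuousBilinearMap.flip Δ
  let K := isBilinearMap_mixedBracket.toContinuousBilinearMap.flip c
  let S := (isBilinearMap_dotProduct (n := Fin 4)).toContinuousBilinearMap c
  have h_comp : ∀ {X Y : Type} [NormedAddCommGroup X] [NormedSpace ℝ X] [NormedAddCommGroup Y]
      [NormedSpace ℝ Y] (L : X →L[ℝ] Y) {η : E → E [⋀^Fin 2]→L[ℝ] X},
      (∀ s ∈ stdCell 2, ContinuousAt η (affineSimplex v s)) →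
      ∀ s ∈ stdCell 2, ContinuousAt (fun y => L.compContinuousAlternatingMap (η y))
        (affineSimplex v s) := fun L _ hη s hs =>
    (L.compContinuousAlternatingMapCLM ℝ E _ _ (Fin 2)).continuous.continuousAt.comp (hη s hs)
  have hψ : ∀ s ∈ stdCell 2,
      ContinuousAt (fun y => β y + K.compContinuousAlternatingMap (ς y)) (affineSimplex v s) :=
    fun s hs => (hβ s hs).add (h_comp K hς s hs)
  calc affineIntegral v (boundaryFormOf (fun _ => Δ) (fun _ => c) β ς ς')
      = P (affineIntegral v fun y => β y + K.compContinuousAlternatingMap (ς y))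
          - S (affineIntegral v ς') := by
        rw [← affineIntegral_compContinuousAlternatingMap P hψ,
          ← affineIntegral_compContinuousAlternatingMap S hς']
        exact affineIntegral_sub (h_comp P hψ) (h_comp S hς')
    _ = P (affineIntegral v β + K (affineIntegral v ς)) - S (affineIntegral v ς') := by
        rw [affineIntegral_add hβ (h_comp K hς), affineIntegral_compContinuousAlternatingMap K hς]

end AffineIntegral

section PullValuesCongr

variable {M : Type*} [TopologicalSpace M] [ChartedSpace (EuclideanSpace ℝ (Fin 3)) M]
  {F V : Type*} [NormedAddCommGroup F] [NormedSpace ℝ F] {S : Set F} {f f' : F → M} {s : F}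

theorem mfderiv_eq_of_eqOn (hS : UniqueDiffOn ℝ S) (h : EqOn f f' S) (hs : s ∈ S)
    (hf : MDifferentiableAt 𝓘(ℝ, F) (𝓡 3) f s) (hf' : MDifferentiableAt 𝓘(ℝ, F) (𝓡 3) f' s)
    (w : F) :
    (mfderiv 𝓘(ℝ, F) (𝓡 3) f s w : EuclideanSpace ℝ (Fin 3)) = mfderiv 𝓘(ℝ, F) (𝓡 3) f' s w := by
  have h_unique : UniqueMDiffWithinAt 𝓘(ℝ, F) S s := (hS s hs).uniqueMDiffWithinAt
  have h_within := mfderivWithin_congr (I := 𝓘(ℝ, F)) (I' := 𝓡 3) h (h hs)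
  rw [mfderivWithin_eq_mfderiv h_unique hf] at h_within
  exact (DFunLike.congr_fun h_within w).trans
    (DFunLike.congr_fun (mfderivWithin_eq_mfderiv h_unique hf') w)

theorem formValues_congr {k : ℕ} (η : FormValues M k V) {a b : M} (hab : a = b)
    {u v : Fin k → EuclideanSpace ℝ (Fin 3)} (huv : u = v) : η a u = η b v := by
  subst hab huv
  rfl

theorem pullValues_eq_of_eqOn {k : ℕ} (hS : UniqueDiffOn ℝ S) (h : EqOn f f' S) (hs : s ∈ S)
    (hf : MDifferentiableAt 𝓘(ℝ, F) (𝓡 3) f s) (hf' : MDifferentiableAt 𝓘(ℝ, F) (𝓡 3) f' s)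
    (η : FormValues M k V) (w : Fin k → F) : pullValues f η s w = pullValues f' η s w :=
  formValues_congr η (h hs) (funext fun j => mfderiv_eq_of_eqOn hS h hs hf hf' (w j))

theorem integrate_eq_affineIntegral [NormedAddCommGroup V] [NormedSpace ℝ V] {k : ℕ}
    {f : (Fin k → ℝ) → M} {η : FormValues M k V} {η' : (Fin k → ℝ) → (Fin k → ℝ) [⋀^Fin k]→L[ℝ] V}
    (h : ∀ s ∈ stdCell k, ∀ w, pullValues f η s w = η' s w) :
    integrate f η = affineIntegral (stdVertex k) η' :=
  (setIntegral_congr_fun measurableSet_stdCell fun s hs => h s hs _).trans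
    (affineIntegral_stdVertex η').symm

end PullValuesCongr

/-! ### Forms with values in the kernel of a linear map -/

section Kernel

variable {E V W : Type*} [NormedAddCommGroup E] [NormedSpace ℝ E] [NormedAddCommGroup V]
  [NormedSpace ℝ V] [NormedAddCommGroup W] [NormedSpace ℝ W] {k : ℕ}

theorem map_extDeriv_eq_zero (L : V →L[ℝ] W) {η : E → E [⋀^Fin k]→L[ℝ] V} {p : E}
    (hη : DifferentiableAt ℝ η p) (h : ∀ y v, L (η y v) = 0) (v : Fin (k + 1) → E) :
    L (extDeriv η p v) = 0 := by
  rw [extDeriv_apply hη, map_sum]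
  refine Finset.sum_eq_zero fun i _ => ?_
  have hηi : DifferentiableAt ℝ (fun y => η y (i.removeNth v)) p :=
    (ContinuousAlternatingMap.apply ℝ E V (i.removeNth v)).differentiableAt.comp p hη
  have h_comp : L ∘SL fderiv ℝ (fun y => η y (i.removeNth v)) p = 0 :=
    (L.hasFDerivAt.comp p hηi.hasFDerivAt).unique
      ((hasFDerivAt_const (0 : W) p).congr_of_eventuallyEq (Eventually.of_forall fun y => h y _))
  rw [map_zsmul, ← ContinuousLinearMap.comp_apply, h_comp, _root_.zero_apply, smul_zero]

theorem map_affineIntegral_eq_zero [CompleteSpace V] [CompleteSpace W] (L : V →L[ℝ] W)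
    {v : Fin (k + 1) → E} {η : E → E [⋀^Fin k]→L[ℝ] V}
    (hη : ∀ s ∈ stdCell k, ContinuousAt η (affineSimplex v s))
    (h : ∀ s ∈ stdCell k, ∀ w, L (η (affineSimplex v s) w) = 0) :
    L (affineIntegral v η) = 0 := by
  rw [← affineIntegral_compContinuousAlternatingMap L hη]
  exact setIntegral_eq_zero_of_forall_eq_zero fun s hs => h s hs _

theorem transpose_eq_neg_iff {n : Type*} [Fintype n] (a : Matrix n n ℝ) :
    aᵀ = -a ↔ (transposeL n n + ContinuousLinearMap.id ℝ (Matrix n n ℝ)) a = 0 :=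
  eq_neg_iff_add_eq_zero

end Kernel

/-! ### The variables of a link -/

section Rotations

variable {E : Type*} [NormedAddCommGroup E] [NormedSpace ℝ E] {g g' k : ℝ → E → SO4} {p : E}

theorem logVariation_mul
    (hk : ContDiffAt ℝ 1 (fun q : ℝ × E => (k q.1 q.2 : Mat4)) (0, p))
    (hg : ContDiffAt ℝ 1 (fun q : ℝ × E => (g q.1 q.2 : Mat4)) (0, p)) :
    logVariation (fun t y => k t y * g t y) p =
      logVariation k p + (k 0 p : Mat4) * logVariation g p * (k 0 p : Mat4)ᵀ := by
  have h_deriv : deriv (fun t => (k t p : Mat4) * (g t p : Mat4)) 0 = _ := (hasDerivAt_bilin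
    isBilinearMap_mul (hasDerivAt_rotation hk) (hasDerivAt_rotation hg)).deriv
  have h_unfold : logVariation (fun t y => k t y * g t y) p
      = deriv (fun t => (k t p : Mat4) * (g t p : Mat4)) 0
        * ((k 0 p : Mat4) * (g 0 p : Mat4))ᵀ := rfl
  rw [h_unfold, h_deriv, transpose_mul]
  calc (logVariation k p * (k 0 p : Mat4) * (g 0 p : Mat4)
          + (k 0 p : Mat4) * (logVariation g p * (g 0 p : Mat4)))
          * ((g 0 p : Mat4)ᵀ * (k 0 p : Mat4)ᵀ)
      = logVariation k p * ((k 0 p : Mat4) * ((g 0 p : Mat4) * (g 0 p : Mat4)ᵀ)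
          * (k 0 p : Mat4)ᵀ) + (k 0 p : Mat4) * logVariation g p
          * ((g 0 p : Mat4) * (g 0 p : Mat4)ᵀ) * (k 0 p : Mat4)ᵀ := by
        simp only [Matrix.add_mul, Matrix.mul_assoc]
    _ = logVariation k p + (k 0 p : Mat4) * logVariation g p * (k 0 p : Mat4)ᵀ := by
        rw [mul_transpose_SO4, Matrix.mul_one, Matrix.mul_one, mul_transpose_SO4, Matrix.mul_one]

theorem logVariation_eq_conj_of_eq_mul
    (hk : ContDiffAt ℝ 1 (fun q : ℝ × E => (k q.1 q.2 : Mat4)) (0, p))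
    (hg : ContDiffAt ℝ 1 (fun q : ℝ × E => (g q.1 q.2 : Mat4)) (0, p))
    (h : ∀ t, g' t p = k t p * g t p) :
    logVariation g p =
      (k 0 p : Mat4)ᵀ * (logVariation g' p - logVariation k p) * (k 0 p : Mat4) := by
  have h_mul : logVariation g' p = logVariation (fun t y => k t y * g t y) p := by
    simp only [logVariation, h]
  rw [h_mul, logVariation_mul hk hg, add_sub_cancel_left]
  calc logVariation g p = ((k 0 p : Mat4)ᵀ * (k 0 p : Mat4)) * logVariation g p
          * ((k 0 p : Mat4)ᵀ * (k 0 p : Mat4)) := by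
        rw [transpose_mul_SO4, Matrix.one_mul, Matrix.mul_one]
    _ = _ := by simp only [Matrix.mul_assoc]

end Rotations

theorem boundaryForm_jump (h : SO4) {Δh : Mat4} (hΔh : Δhᵀ = -Δh) (Δ β : Mat4) (c x ς ς' : R4) :
    (pairSo (β + mixedBracket ς c) Δ - c ⬝ᵥ ς')
      - (pairSo ((h : Mat4)ᵀ * (β + mixedBracket ς c) * (h : Mat4))
          ((h : Mat4)ᵀ * (Δ - Δh) * (h : Mat4))
        - ((h : Mat4)ᵀ *ᵥ (c + x)) ⬝ᵥ ((h : Mat4)ᵀ *ᵥ (ς' - Δh *ᵥ ς)))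
      = pairSo (β + mixedBracket ς (-x)) Δh - (-x) ⬝ᵥ ς' := by
  have h_bracket : ∀ y, pairSo (mixedBracket ς y) Δh = y ⬝ᵥ (Δh *ᵥ ς) := fun y => by
    rw [pairSo_mixedBracket _ _ _ hΔh, dotProduct_neg, dotProduct_comm, mulVec_dotProduct_skew hΔh,
      neg_neg]
  have h_sub : pairSo (β + mixedBracket ς c) (Δ - Δh)
      = pairSo (β + mixedBracket ς c) Δ - pairSo (β + mixedBracket ς c) Δh :=
    map_sub (isBilinearMap_pairSo.toContinuousBilinearMap _) Δ Δh
  rw [pairSo_conj (mul_transpose_SO4 h), dotProduct_transpose_mulVec (mul_transpose_SO4 h), h_sub,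
    pairSo_add_left β _ Δh, pairSo_add_left β _ Δh, h_bracket, h_bracket, dotProduct_sub,
    add_dotProduct, add_dotProduct, neg_dotProduct, neg_dotProduct]
  ring

theorem bfcgLinkPotential_eq_pairSo {p v : LinkVars} (hv : (v.1 * p.1ᵀ)ᵀ = -(v.1 * p.1ᵀ)) :
    bfcgLinkPotential p v = pairSo (p.2.2.1 + mixedBracket p.2.2.2 (-p.2.1)) (v.1 * p.1ᵀ)
      - (-p.2.1) ⬝ᵥ v.2.2.2 := by
  rw [bfcgLinkPotential, pairSo_add_left, pairSo_mixedBracket _ _ _ hv, mulVec_neg, neg_neg,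
    neg_dotProduct, sub_neg_eq_add, dotProduct_comm (_ *ᵥ _)]

section LinkIntegrals

variable {M : Type*} [TopologicalSpace M] [ChartedSpace (EuclideanSpace ℝ (Fin 3)) M]
  [IsManifold (𝓡 3) ∞ M] {Cell Link : Type*} {T : Triangulation M Cell Link}

namespace OnShellData

theorem pulledDb_skew {F : Type*} [NormedAddCommGroup F] [NormedSpace ℝ F] (D : OnShellData T)
    {i : Cell} {f : F → M} {p : F} (hf : T.SmoothIntoCellAt i f p) (t : ℝ) (w : Fin 2 → F) :
    (D.pulledDb i f t p w)ᵀ = -D.pulledDb i f t p w :=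
  (transpose_eq_neg_iff _).2 (map_extDeriv_eq_zero _
    ((contDiffAt_of_family (H := fun t => pullback f (D.b i t)) (contDiffAt_pullback hf.contMDiffAt
      (D.b_smooth i t _ hf.mem_cellSet))).differentiableAt (by simp))
    (fun _ _ => (transpose_eq_neg_iff _).1 (D.b_skew _ _ _ _)) w)

variable (D : OnShellData T) (l : Link)

theorem triangleIntegral_db (t : ℝ) :
    T.triangleIntegral l (D.db (T.source l).1 t) = (-1 : ℝ) ^ ((T.source l).2 : ℕ) •
      affineIntegral (stdVertex 2) (D.pulledDb (T.source l).1 (T.triangle l) t) :=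
  congrArg _ (integrate_eq_affineIntegral fun _ hs =>
    D.pullValues_db (T.smoothIntoCellAt_source l hs) t)

theorem triangleIntegral_dσ (t : ℝ) :
    T.triangleIntegral l (D.dσ (T.source l).1 t) = (-1 : ℝ) ^ ((T.source l).2 : ℕ) •
      affineIntegral (stdVertex 2) (D.pulledDσ (T.source l).1 (T.triangle l) t) :=
  congrArg _ (integrate_eq_affineIntegral fun _ hs =>
    D.pullValues_dσ (T.smoothIntoCellAt_source l hs) t)

theorem triangleIntegral_db_skew (t : ℝ) :
    (T.triangleIntegral l (D.db (T.source l).1 t))ᵀ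
      = -T.triangleIntegral l (D.db (T.source l).1 t) := by
  rw [triangleIntegral_db, transpose_eq_neg_iff, map_smul, map_affineIntegral_eq_zero, smul_zero]
  · exact fun s hs => by
      rw [affineSimplex_stdVertex_eq_id]
      exact (D.contDiffAt_pulledDb (T.smoothIntoCellAt_source l hs) t).continuousAt
  · exact fun s hs w => by
      rw [affineSimplex_stdVertex_eq_id]
      exact (transpose_eq_neg_iff _).1 (D.pulledDb_skew (T.smoothIntoCellAt_source l hs) t w)

theorem linkVars_mem (h : Link → ℝ → SO4) (x : Link → ℝ → R4) (t : ℝ) :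
    linkVars D h x l t ∈ linkPhaseSpace :=
  ⟨(h l t).2, D.triangleIntegral_db_skew l t⟩

theorem differentiableAt_triangleIntegral_db (t : ℝ) :
    DifferentiableAt ℝ (fun t => T.triangleIntegral l (D.db (T.source l).1 t)) t := by
  simp only [triangleIntegral_db]
  refine (HasDerivAt.const_smul ((-1 : ℝ) ^ ((T.source l).2 : ℕ)) (hasDerivAt_affineIntegral
    (η := D.pulledDb (T.source l).1 (T.triangle l)) (fun r s hs => ?_) t)).differentiableAt
  rw [affineSimplex_stdVertex_eq_id]
  exact (D.contDiffAt_pulledDb_family (T.smoothIntoCellAt_source l hs) r).of_le (by simp)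

theorem hasDerivAt_triangleIntegral_dσ (t : ℝ) :
    HasDerivAt (fun t => T.triangleIntegral l (D.dσ (T.source l).1 t))
      ((-1 : ℝ) ^ ((T.source l).2 : ℕ) • affineIntegral (stdVertex 2) fun y =>
        deriv (fun r => D.pulledDσ (T.source l).1 (T.triangle l) r y) t) t := by
  simp only [triangleIntegral_dσ]
  refine HasDerivAt.const_smul ((-1 : ℝ) ^ ((T.source l).2 : ℕ)) (hasDerivAt_affineIntegral
    (η := D.pulledDσ (T.source l).1 (T.triangle l)) (fun r s hs => ?_) t)
  rw [affineSimplex_stdVertex_eq_id]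
  exact (D.contDiffAt_pulledDσ_family (T.smoothIntoCellAt_source l hs) r).of_le (by simp)

variable {D} {h : Link → ℝ → SO4} {x : Link → ℝ → R4}

theorem IsContinuitySolution.hasDerivAt_linkVars (hs : D.IsContinuitySolution h x) (t : ℝ) :
    HasDerivAt (linkVars D h x l) (deriv (fun t => (h l t : Mat4)) t, deriv (x l) t,
      deriv (fun t => T.triangleIntegral l (D.db (T.source l).1 t)) t,
      (-1 : ℝ) ^ ((T.source l).2 : ℕ) • affineIntegral (stdVertex 2) fun y =>
        deriv (fun r => D.pulledDσ (T.source l).1 (T.triangle l) r y) t) t :=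
  ((hs.contDiff_rotation l).differentiable (by simp) t).hasDerivAt.prodMk
    (((hs.contDiff_translation l).differentiable (by simp) t).hasDerivAt.prodMk
      ((D.differentiableAt_triangleIntegral_db l t).hasDerivAt.prodMk
        (D.hasDerivAt_triangleIntegral_dσ l t)))

end OnShellData

end LinkIntegrals

/-! ### The two sides of a triangle -/

section TwoSides

variable {M : Type*} [TopologicalSpace M] [ChartedSpace (EuclideanSpace ℝ (Fin 3)) M]
  {Cell Link : Type*} {T : Triangulation M Cell Link}

namespace OnShellData

variable {D : OnShellData T} {h : Link → ℝ → SO4} {x : Link → ℝ → R4} (l : Link)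

theorem IsContinuitySolution.contDiffAt_rotation_family (hs : D.IsContinuitySolution h x)
    (s : Fin 2 → ℝ) : ContDiffAt ℝ 1 (fun q : ℝ × (Fin 2 → ℝ) => (h l q.1 : Mat4)) (0, s) :=
  (((hs.contDiff_rotation l).contDiffAt (x := 0)).comp (0, s) contDiffAt_fst).of_le (by simp)

variable [IsManifold (𝓡 3) ∞ M]

theorem integrate_triangle_target (D : OnShellData T) :
    integrate (T.triangle l) (D.boundaryForm (T.target l).1) =
      (Equiv.Perm.sign (T.glue l) : ℤ) * integrate (T.param (T.target l).1 ∘ face (T.target l).2)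
        (D.boundaryForm (T.target l).1) := by
  have h_glued : integrate (T.triangle l) (D.boundaryForm (T.target l).1) =
      integrate (T.param (T.target l).1
        ∘ affineSimplex (stdVertex 3 ∘ (T.target l).2.succAbove ∘ T.glue l))
        (D.boundaryForm (T.target l).1) :=
    setIntegral_congr_fun measurableSet_stdCell fun s hs =>
      pullValues_eq_of_eqOn uniqueDiffOn_stdCell (T.glue_eq l) hs
        (T.smoothIntoCellAt_target l hs).mdifferentiableAt
        (T.smoothIntoCellAt_param_comp _ (fun _ => stdVertex_mem _) hs).mdifferentiableAt _ _
  have h_face := D.integrate_boundaryForm_comp (T.target l).1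
    (v := stdVertex 3 ∘ (T.target l).2.succAbove) fun _ => stdVertex_mem _
  rw [h_glued, integrate_boundaryForm_comp _ _ fun _ => by exact stdVertex_mem _,
    ← Function.comp_assoc, affineIntegral_perm, Units.smul_def, zsmul_eq_mul, ← h_face]
  rfl

theorem sum_boundaryIntegral_eq [Fintype Cell] [Fintype Link] (D : OnShellData T) :
    ∑ i, T.boundaryIntegral i (D.boundaryForm i) = ∑ l, (-1 : ℝ) ^ ((T.source l).2 : ℕ) *
      (integrate (T.triangle l) (D.boundaryForm (T.source l).1)
        - integrate (T.triangle l) (D.boundaryForm (T.target l).1)) := by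
  simp only [Triangulation.boundaryIntegral]
  rw [← Fintype.sum_prod_type' (f := fun i (j : Fin 4) => (-1 : ℝ) ^ (j : ℕ)
      * integrate (T.param i ∘ face j) (D.boundaryForm i)), ← T.faces.sum_comp,
    Fintype.sum_sum_type, ← Finset.sum_add_distrib]
  refine Finset.sum_congr rfl fun l _ => ?_
  have h_coherent : (-1 : ℝ) ^ ((T.source l).2 : ℕ) * ((Equiv.Perm.sign (T.glue l) : ℤ) : ℝ)
      = -(-1 : ℝ) ^ ((T.target l).2 : ℕ) := by
    exact_mod_cast T.coherent l
  rw [integrate_triangle_target]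
  simp only [Sum.elim_inl, Sum.elim_inr, Triangulation.triangle]
  linear_combination integrate (T.param (T.target l).1 ∘ face (T.target l).2)
    (D.boundaryForm (T.target l).1) * h_coherent

theorem Continuity.pulledδDσ_target (hD : D.Continuity) (hs : D.IsContinuitySolution h x)
    {s : Fin 2 → ℝ} (hs2 : s ∈ stdCell 2) (w : Fin 2 → Fin 2 → ℝ) :
    D.pulledδDσ (T.target l).1 (T.triangle l) s w =
      (h l 0 : Mat4)ᵀ *ᵥ (D.pulledδDσ (T.source l).1 (T.triangle l) s w
        - logVariation (fun t _ => h l t) s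
          *ᵥ D.pulledDσ (T.source l).1 (T.triangle l) 0 s w) := by
  have h_rotated := hasDerivAt_inv_mulVec (g := fun t _ => h l t)
    (hs.contDiffAt_rotation_family l s)
    (D.hasDerivAt_pulledDσ (T.smoothIntoCellAt_source l hs2) w)
  refine (D.hasDerivAt_pulledDσ (T.smoothIntoCellAt_target l hs2) w).unique
    (h_rotated.congr_of_eventuallyEq (Eventually.of_forall fun t => ?_))
  refine (D.pullValues_dσ (T.smoothIntoCellAt_target l hs2) t w).symm.trans
    ((hD.agreeOn_dσ_target hs l t s hs2 w).trans ?_)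
  exact congrArg ((h l t : Mat4)ᵀ *ᵥ ·) (D.pullValues_dσ (T.smoothIntoCellAt_source l hs2) t w)

theorem Continuity.pulledCurvature_target (hD : D.Continuity) (hs : D.IsContinuitySolution h x)
    (t : ℝ) {s : Fin 2 → ℝ} (hs2 : s ∈ stdCell 2) (w : Fin 2 → Fin 2 → ℝ) :
    D.pulledDb (T.target l).1 (T.triangle l) t s w
        + mixedBracket (D.pulledDσ (T.target l).1 (T.triangle l) t s w)
          (D.pulledC (T.target l).1 (T.triangle l) t s) =
      (h l t : Mat4)ᵀ * (D.pulledDb (T.source l).1 (T.triangle l) t s w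
        + mixedBracket (D.pulledDσ (T.source l).1 (T.triangle l) t s w)
          (D.pulledC (T.source l).1 (T.triangle l) t s)) * (h l t : Mat4) := by
  simp only [← D.pullValues_db (T.smoothIntoCellAt_source l hs2),
    ← D.pullValues_dσ (T.smoothIntoCellAt_source l hs2),
    ← D.pullValues_db (T.smoothIntoCellAt_target l hs2),
    ← D.pullValues_dσ (T.smoothIntoCellAt_target l hs2)]
  exact hD.agreeOn_curvature_target hs l t s hs2 w

theorem Continuity.pulledBoundaryForm_source_sub_target (hD : D.Continuity)
    (hs : D.IsContinuitySolution h x) {s : Fin 2 → ℝ} (hs2 : s ∈ stdCell 2) :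
    D.pulledBoundaryForm (T.source l).1 (T.triangle l) s
        - D.pulledBoundaryForm (T.target l).1 (T.triangle l) s =
      boundaryFormOf (logVariation fun t _ => h l t) (fun _ => -x l 0)
        (D.pulledDb (T.source l).1 (T.triangle l) 0) (D.pulledDσ (T.source l).1 (T.triangle l) 0)
        (D.pulledδDσ (T.source l).1 (T.triangle l)) s := by
  ext w
  have h_logVariation : logVariation (D.pulledG (T.target l).1 (T.triangle l)) s = _ :=
    logVariation_eq_conj_of_eq_mul (g' := D.pulledG (T.source l).1 (T.triangle l))
      (g := D.pulledG (T.target l).1 (T.triangle l)) (k := fun t _ => h l t)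
      (hs.contDiffAt_rotation_family l s)
      ((D.contDiffAt_pulledG_family (T.smoothIntoCellAt_target l hs2) 0).of_le (by simp))
      fun t => (hs l t s hs2).1
  have h_translation : D.pulledC (T.target l).1 (T.triangle l) 0 s
      = (h l 0 : Mat4)ᵀ *ᵥ (D.pulledC (T.source l).1 (T.triangle l) 0 s + x l 0) :=
    (hs l 0 s hs2).2
  refine (congrArg (_ - ·) (congrArg₂ (· - ·) (congrArg₂ pairSo
    (hD.pulledCurvature_target l hs 0 hs2 w) h_logVariation) (congrArg₂ (· ⬝ᵥ ·) h_translation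
      (hD.pulledδDσ_target l hs hs2 w)))).trans ?_
  exact boundaryForm_jump (h l 0) (logVariation_skew (hs.contDiffAt_rotation_family l s))
    _ _ _ _ _ _

theorem Continuity.integrate_source_sub_target (hD : D.Continuity)
    (hs : D.IsContinuitySolution h x) :
    integrate (T.triangle l) (D.boundaryForm (T.source l).1)
        - integrate (T.triangle l) (D.boundaryForm (T.target l).1) =
      pairSo (affineIntegral (stdVertex 2) (D.pulledDb (T.source l).1 (T.triangle l) 0)
          + mixedBracket (affineIntegral (stdVertex 2)
            (D.pulledDσ (T.source l).1 (T.triangle l) 0)) (-x l 0))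
        (deriv (fun t => (h l t : Mat4)) 0 * (h l 0 : Mat4)ᵀ)
      - (-x l 0) ⬝ᵥ affineIntegral (stdVertex 2) (D.pulledδDσ (T.source l).1 (T.triangle l)) := by
  have h_source := fun s hs => T.smoothIntoCellAt_source (s := s) l hs
  have h_target := fun s hs => T.smoothIntoCellAt_target (s := s) l hs
  rw [integrate_eq_affineIntegral fun s hs => D.pullValues_boundaryForm (h_source s hs),
    integrate_eq_affineIntegral fun s hs => D.pullValues_boundaryForm (h_target s hs),
    ← affineIntegral_sub, ← affineIntegral_boundaryFormOf_const]
  · exact affineIntegral_congr fun s hs' => by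
      rw [affineSimplex_stdVertex_eq_id]
      exact hD.pulledBoundaryForm_source_sub_target l hs hs'
  all_goals
    intro s hs'
    rw [affineSimplex_stdVertex_eq_id]
  · exact (D.contDiffAt_pulledDb (h_source s hs') 0).continuousAt
  · exact (D.contDiffAt_pulledDσ (h_source s hs') 0).continuousAt
  · exact (D.contDiffAt_pulledδDσ (h_source s hs')).continuousAt
  · exact (D.contDiffAt_pulledBoundaryForm (h_source s hs')).continuousAt
  · exact (D.contDiffAt_pulledBoundaryForm (h_target s hs')).continuousAt

theorem Continuity.link_contribution (hD : D.Continuity) (hs : D.IsContinuitySolution h x) :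
    (-1 : ℝ) ^ ((T.source l).2 : ℕ) *
        (integrate (T.triangle l) (D.boundaryForm (T.source l).1)
          - integrate (T.triangle l) (D.boundaryForm (T.target l).1)) =
      bfcgLinkPotential (linkVars D h x l 0) (deriv (linkVars D h x l) 0) := by
  rw [(hs.hasDerivAt_linkVars l 0).deriv,
    bfcgLinkPotential_eq_pairSo (skew_of_hasDerivAt
      ((hs.contDiff_rotation l).differentiable (by simp) 0).hasDerivAt),
    hD.integrate_source_sub_target l hs]
  simp only [linkVars, triangleIntegral_db, triangleIntegral_dσ]
  rw [isBilinearMap_mixedBracket.smul_left, ← smul_add, isBilinearMap_pairSo.smul_left,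
    dotProduct_smul, smul_eq_mul, smul_eq_mul, ← mul_sub]
  rfl

theorem Continuity.potential_eq_sum_links [Fintype Cell] [Fintype Link] (hD : D.Continuity)
    (hs : D.IsContinuitySolution h x) :
    D.potential = ∑ l, bfcgLinkPotential (linkVars D h x l 0) (deriv (linkVars D h x l) 0) := by
  rw [potential_eq_sum_boundaryIntegral, sum_boundaryIntegral_eq]
  exact Finset.sum_congr rfl fun l _ => hD.link_contribution l hs

end OnShellData

end TwoSides

/-! ### The phase space of a link -/

section OneForms

variable {θ θ' : LinkVars → LinkVars → ℝ} {p : LinkVars}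

theorem extDOne_add (hθ : ∀ w, DifferentiableAt ℝ (fun q => θ q w) p)
    (hθ' : ∀ w, DifferentiableAt ℝ (fun q => θ' q w) p) (u v : LinkVars) :
    extDOne (fun q w => θ q w + θ' q w) p u v = extDOne θ p u v + extDOne θ' p u v := by
  simp only [extDOne, fderiv_fun_add (hθ _) (hθ' _), _root_.add_apply]
  ring

theorem extDOne_pullback (L : LinkVars →L[ℝ] LinkVars)
    (hθ : ∀ w, DifferentiableAt ℝ (fun q => θ q w) (L p)) (u v : LinkVars) :
    extDOne (fun q w => θ (L q) (L w)) p u v = extDOne θ (L p) (L u) (L v) := by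
  have h_fderiv : ∀ w, fderiv ℝ (fun q => θ (L q) w) p
      = (fderiv ℝ (fun q => θ q w) (L p)).comp L := fun w =>
    ((hθ w).hasFDerivAt.comp p L.hasFDerivAt).fderiv
  simp only [extDOne, h_fderiv, ContinuousLinearMap.comp_apply]

theorem extDOne_fderiv {S : LinkVars → ℝ} (hS : ContDiffAt ℝ 2 S p) (u v : LinkVars) :
    extDOne (fun q => fderiv ℝ S q) p u v = 0 := by
  have h_diff : DifferentiableAt ℝ (fderiv ℝ S) p :=
    (hS.fderiv_right (m := 1) le_rfl).differentiableAt one_ne_zero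
  have h_fderiv : ∀ w w', fderiv ℝ (fun q => fderiv ℝ S q w) p w' = fderiv ℝ (fderiv ℝ S) p w' w :=
    fun w w' => by rw [fderiv_clm_apply h_diff (differentiableAt_const w)]; simp
  rw [extDOne, h_fderiv, h_fderiv, hS.isSymmSndFDerivAt (by simp) u v, sub_self]

end OneForms

theorem differentiableAt_rightVariation (p v : LinkVars) :
    DifferentiableAt ℝ (fun q : LinkVars => v.1 * q.1ᵀ) p :=
  differentiableAt_bilin isBilinearMap_mul (differentiableAt_const _)
    ((transposeL _ _).differentiableAt.comp p differentiableAt_fst)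

theorem differentiableAt_bfcgLinkPotential (p v : LinkVars) :
    DifferentiableAt ℝ (fun q => bfcgLinkPotential q v) p := by
  have hΔ := differentiableAt_rightVariation p v
  have hx : DifferentiableAt ℝ (fun q : LinkVars => q.2.1) p := by fun_prop
  have hb : DifferentiableAt ℝ (fun q : LinkVars => q.2.2.1) p := by fun_prop
  have hV : DifferentiableAt ℝ (fun q : LinkVars => q.2.2.2) p := by fun_prop
  exact ((differentiableAt_bilin isBilinearMap_pairSo hb hΔ).add
    (differentiableAt_bilin isBilinearMap_dotProduct
      (differentiableAt_bilin isBilinearMap_mulVec hΔ hx) hV)).add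
    (differentiableAt_bilin isBilinearMap_dotProduct hx (differentiableAt_const _))

theorem differentiableAt_bfLinkPotential (p v : LinkVars) :
    DifferentiableAt ℝ (fun q => bfLinkPotential q v) p := by
  have hΔ := differentiableAt_rightVariation p v
  have hx : DifferentiableAt ℝ (fun q : LinkVars => q.2.1) p := by fun_prop
  have hb : DifferentiableAt ℝ (fun q : LinkVars => q.2.2.1) p := by fun_prop
  have hV : DifferentiableAt ℝ (fun q : LinkVars => q.2.2.2) p := by fun_prop
  exact ((differentiableAt_bilin isBilinearMap_pairSo hb hΔ).add
    (differentiableAt_bilin isBilinearMap_dotProduct hV (differentiableAt_const _))).add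
    (differentiableAt_bilin isBilinearMap_dotProduct hV
      (differentiableAt_bilin isBilinearMap_mulVec hΔ hx).neg)

theorem fderiv_dotProduct_xV (p v : LinkVars) :
    fderiv ℝ (fun q : LinkVars => q.2.1 ⬝ᵥ q.2.2.2) p v =
      v.2.1 ⬝ᵥ p.2.2.2 + p.2.1 ⬝ᵥ v.2.2.2 := by
  have hx := (hasFDerivAt_id (𝕜 := ℝ) p).snd.fst
  have hV := (hasFDerivAt_id (𝕜 := ℝ) p).snd.snd.snd
  exact (fderiv_bilin isBilinearMap_dotProduct hx.differentiableAt hV.differentiableAt v).trans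
    (by rw [hx.fderiv, hV.fderiv]; rfl)

theorem bfcgLinkPotential_eq (p v : LinkVars) :
    bfcgLinkPotential p v = bfLinkPotential (flipV p) (flipV v)
      + fderiv ℝ (fun q : LinkVars => q.2.1 ⬝ᵥ q.2.2.2) p v := by
  rw [fderiv_dotProduct_xV]
  simp only [bfcgLinkPotential, bfLinkPotential, flipV, dotProduct_neg, neg_dotProduct, neg_neg,
    dotProduct_comm p.2.2.2]
  ring

/-- The phase-space involution `flipV` as a continuous linear map, for pulling back one-forms. -/
noncomputable def flipVL : LinkVars →L[ℝ] LinkVars :=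
  (ContinuousLinearMap.id ℝ Mat4).prodMap ((ContinuousLinearMap.id ℝ R4).prodMap
    ((ContinuousLinearMap.id ℝ Mat4).prodMap (-ContinuousLinearMap.id ℝ R4)))

theorem extDOne_bfcg_eq_flip (p u v : LinkVars) :
    extDOne bfcgLinkPotential p u v =
      extDOne bfLinkPotential (flipV p) (flipV u) (flipV v) := by
  have hS : ContDiff ℝ 2 (fun q : LinkVars => q.2.1 ⬝ᵥ q.2.2.2) := contDiff_iff_contDiffAt.2
    fun q => contDiffAt_bilin isBilinearMap_dotProduct contDiffAt_snd.fst contDiffAt_snd.snd.snd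
  have hθ : ∀ w, DifferentiableAt ℝ (fun q => bfLinkPotential (flipVL q) (flipVL w)) p := fun w =>
    (differentiableAt_bfLinkPotential (flipVL p) (flipVL w)).comp p flipVL.differentiableAt
  have hdS : ∀ w, DifferentiableAt ℝ
      (fun q => fderiv ℝ (fun q : LinkVars => q.2.1 ⬝ᵥ q.2.2.2) q w) p := fun w =>
    ((hS.fderiv_right (m := 1) le_rfl).differentiable one_ne_zero p).clm_apply
      (differentiableAt_const w)
  calc extDOne bfcgLinkPotential p u v
      = extDOne (fun q w => bfLinkPotential (flipVL q) (flipVL w)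
          + fderiv ℝ (fun q : LinkVars => q.2.1 ⬝ᵥ q.2.2.2) q w) p u v :=
        congrArg (extDOne · p u v) (funext₂ bfcgLinkPotential_eq)
    _ = extDOne bfLinkPotential (flipVL p) (flipVL u) (flipVL v) := by
        rw [extDOne_add hθ hdS, extDOne_fderiv hS.contDiffAt, add_zero,
          extDOne_pullback flipVL (differentiableAt_bfLinkPotential (flipVL p))]

theorem fderiv_bfcgLinkPotential (p u v : LinkVars) :
    fderiv ℝ (fun q => bfcgLinkPotential q v) p u =
      pairSo u.2.2.1 (v.1 * p.1ᵀ) + pairSo p.2.2.1 (v.1 * u.1ᵀ)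
        + (((v.1 * u.1ᵀ) *ᵥ p.2.1 + (v.1 * p.1ᵀ) *ᵥ u.2.1) ⬝ᵥ p.2.2.2
          + ((v.1 * p.1ᵀ) *ᵥ p.2.1) ⬝ᵥ u.2.2.2) + u.2.1 ⬝ᵥ v.2.2.2 := by
  have h_line : ∀ {X : Type} [NormedAddCommGroup X] [NormedSpace ℝ X] (a b : X),
      HasDerivAt (fun s : ℝ => a + s • b) b 0 := fun a b => by
    simpa using ((hasDerivAt_id (0 : ℝ)).smul_const b).const_add a
  have hΔ := hasDerivAt_bilin isBilinearMap_mul (hasDerivAt_const (0 : ℝ) v.1)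
    (hasDerivAt_transpose (h_line p.1 u.1))
  have hx := h_line p.2.1 u.2.1
  have hV := h_line p.2.2.2 u.2.2.2
  have h_deriv := ((hasDerivAt_bilin isBilinearMap_pairSo (h_line p.2.2.1 u.2.2.1) hΔ).add
    (hasDerivAt_bilin isBilinearMap_dotProduct
      (hasDerivAt_bilin isBilinearMap_mulVec hΔ hx) hV)).add
    (hasDerivAt_bilin isBilinearMap_dotProduct hx (hasDerivAt_const (0 : ℝ) v.2.2.2))
  simp only [zero_smul, add_zero, Matrix.zero_mul, zero_add, dotProduct_zero] at h_deriv
  exact (differentiableAt_bfcgLinkPotential p v).lineDeriv_eq_fderiv.symm.trans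
    (HasLineDerivAt.lineDeriv h_deriv)

theorem eq_zero_of_pairSo_self {a : Mat4} (h : pairSo a a = 0) : a = 0 := by
  rw [pairSo, mul_eq_zero, ← conjTranspose_eq_transpose_of_trivial] at h
  exact trace_conjTranspose_mul_self_eq_zero_iff.1 (h.resolve_left (by norm_num))

theorem transpose_mul_of_mem_linkPhaseSpace {p : LinkVars} (hp : p ∈ linkPhaseSpace) :
    p.1ᵀ * p.1 = 1 := transpose_mul_SO4 ⟨p.1, hp.1⟩

theorem mul_transpose_of_mem_linkPhaseSpace {p : LinkVars} (hp : p ∈ linkPhaseSpace) :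
    p.1 * p.1ᵀ = 1 := mul_transpose_SO4 ⟨p.1, hp.1⟩

theorem extDOne_bfcg_nondegenerate {p : LinkVars} (hp : p ∈ linkPhaseSpace) {u : LinkVars}
    (hu : u ∈ tangentVectors p)
    (h : ∀ v ∈ tangentVectors p, extDOne bfcgLinkPotential p u v = 0) : u = 0 := by
  have h_right : ∀ a : Mat4, a * p.1ᵀ * p.1 = a := fun a => by
    rw [Matrix.mul_assoc, transpose_mul_of_mem_linkPhaseSpace hp, Matrix.mul_one]
  have h_left : ∀ a : Mat4, a * p.1 * p.1ᵀ = a := fun a => by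
    rw [Matrix.mul_assoc, mul_transpose_of_mem_linkPhaseSpace hp, Matrix.mul_one]
  have pairSo_zero_left : ∀ a, pairSo 0 a = 0 := fun a => by simp [pairSo]
  have pairSo_zero_right : ∀ a, pairSo a 0 = 0 := fun a => by simp [pairSo]
  simp only [extDOne, fderiv_bfcgLinkPotential] at h
  obtain ⟨δh, δx, δb, δV⟩ := u
  obtain ⟨h_skew_h, h_skew_b⟩ := hu
  obtain rfl : δh = 0 := by
    have h_test := h (0, 0, δh * p.1ᵀ, 0) ⟨by simp, h_skew_h⟩
    have h_log : δh * p.1ᵀ = 0 :=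
      eq_zero_of_pairSo_self (by simpa [pairSo_zero_left, pairSo_zero_right] using h_test)
    rw [← h_right δh, h_log, Matrix.zero_mul]
  obtain rfl : δx = 0 := by
    have h_test := h (0, 0, 0, δx) ⟨by simp, by simp⟩
    exact dotProduct_self_eq_zero.1
      (by simpa [pairSo_zero_left, pairSo_zero_right] using h_test)
  obtain rfl : δV = 0 := by
    have h_test := h (0, δV, 0, 0) ⟨by simp, by simp⟩
    exact dotProduct_self_eq_zero.1
      (by simpa [pairSo_zero_left, pairSo_zero_right] using h_test)
  obtain rfl : δb = 0 := by
    have h_test := h (δb * p.1, 0, 0, 0) ⟨by simpa only [h_left] using h_skew_b, by simp⟩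
    exact eq_zero_of_pairSo_self
      (by simpa [h_left, pairSo_zero_left, pairSo_zero_right] using h_test)
  rfl

/-! ### The canonical one-form of `T*ISO(4)` -/

theorem fromBlocks_mul_inv_affine {n : Type*} [Fintype n] [DecidableEq n] {R : Type*} [CommRing R]
    {g : Matrix n n R} (hg : IsUnit g) (a : Matrix n n R) (x y : n → R) :
    fromBlocks a (replicateCol Unit y) 0 (0 : Matrix Unit Unit R)
        * (fromBlocks g (replicateCol Unit x) 0 1)⁻¹ =
      fromBlocks (a * g⁻¹) (replicateCol Unit (y - (a * g⁻¹) *ᵥ x)) 0 0 := by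
  rw [inv_fromBlocks_zero₂₁_of_isUnit_iff _ _ _ (iff_of_true hg isUnit_one), fromBlocks_multiply]
  congr 1
  · simp
  · rw [inv_one, Matrix.mul_one, Matrix.mul_one, Matrix.mul_neg, ← Matrix.mul_assoc,
      ← replicateCol_mulVec, neg_add_eq_sub]
    rfl
  · simp
  · simp

theorem toCotangent_eq (p : LinkVars) :
    toCotangent p = (fromBlocks p.1 (replicateCol Unit p.2.1) 0 1, p.2.2) := by
  simp [toCotangent, fromBlocks_multiply]

theorem fderiv_toCotangent (p v : LinkVars) :
    fderiv ℝ toCotangent p v = (fromBlocks v.1 (replicateCol Unit v.2.1) 0 0, v.2.2) := by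
  let L : LinkVars →ₗ[ℝ] CotangentVars :=
    { toFun := fun q => (fromBlocks q.1 (replicateCol Unit q.2.1) 0 0, q.2.2)
      map_add' := fun a b => by simp [fromBlocks_add]
      map_smul' := fun c a => by simp [fromBlocks_smul] }
  have h_affine : toCotangent = fun q => (fromBlocks 0 0 0 1, 0) + L.toContinuousLinearMap q := by
    funext q
    simp [toCotangent_eq, L, fromBlocks_add]
  rw [h_affine, fderiv_const_add, ContinuousLinearMap.fderiv]
  rfl

theorem bfLinkPotential_eq_canonicalForm {p : LinkVars} (hp : p ∈ linkPhaseSpace) (v : LinkVars) :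
    bfLinkPotential p v = canonicalForm (toCotangent p) (fderiv ℝ toCotangent p v) := by
  have h_inv : p.1⁻¹ = p.1ᵀ := inv_eq_right_inv (mul_transpose_of_mem_linkPhaseSpace hp)
  have h_unit : IsUnit p.1 := IsUnit.of_mul_eq_one _ (mul_transpose_of_mem_linkPhaseSpace hp)
  rw [fderiv_toCotangent, toCotangent_eq, canonicalForm, fromBlocks_mul_inv_affine h_unit, h_inv]
  simp only [toBlocks_fromBlocks₁₁, fromBlocks_apply₁₂, replicateCol_apply, bfLinkPotential]
  rw [add_assoc, ← dotProduct_add, ← sub_eq_add_neg]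

end BFCG

theorem mainTheorem2 {M : Type*} [TopologicalSpace M]
    [ChartedSpace (EuclideanSpace ℝ (Fin 3)) M] [IsManifold (𝓡 3) ∞ M]
    {Cell Link : Type*} [Fintype Cell] [Fintype Link]
    (T : BFCG.Triangulation M Cell Link) (D : BFCG.OnShellData T) (hD : D.Continuity) :
    -- the continuity equations of `g` and `c` are solved by unique constants on the links
    (∃! d : (Link → ℝ → BFCG.SO4) × (Link → ℝ → BFCG.R4), D.IsContinuitySolution d.1 d.2) ∧
    -- evaluation of the potential
    (∀ (h : Link → ℝ → BFCG.SO4) (x : Link → ℝ → BFCG.R4), D.IsContinuitySolution h x →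
      (∀ l, ContDiff ℝ ∞ (fun t => (h l t : BFCG.Mat4)) ∧ ContDiff ℝ ∞ (x l)) ∧
      (∀ l t,
        T.AgreeOn l (D.dσ (T.target l).1 t)
          (fun y u => ((h l t)⁻¹ : BFCG.SO4).1 *ᵥ D.dσ (T.source l).1 t y u) ∧
        T.AgreeOn l (D.db (T.target l).1 t)
          (fun y u => ((h l t)⁻¹ : BFCG.SO4).1 * (D.db (T.source l).1 t y u
            - BFCG.mixedBracket (D.dσ (T.source l).1 t y u) (x l t)) * (h l t).1)) ∧
      (∀ l t, BFCG.linkVars D h x l t ∈ BFCG.linkPhaseSpace ∧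
        DifferentiableAt ℝ (BFCG.linkVars D h x l) t) ∧
      D.potential = ∑ i, T.boundaryIntegral i (D.boundaryForm i) ∧
      D.potential =
        ∑ l, BFCG.bfcgLinkPotential (BFCG.linkVars D h x l 0)
          (deriv (BFCG.linkVars D h x l) 0)) ∧
    -- each summand is a potential of `T*ISO(4)`; it differs from the one of the BF discretization
    -- by the sign of `V`, up to a total variation
    (∀ p ∈ BFCG.linkPhaseSpace, ∀ v ∈ BFCG.tangentVectors p,
      BFCG.bfLinkPotential p v
        = BFCG.canonicalForm (BFCG.toCotangent p) (fderiv ℝ BFCG.toCotangent p v) ∧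
      BFCG.bfcgLinkPotential p v
        = BFCG.bfLinkPotential (BFCG.flipV p) (BFCG.flipV v)
          + fderiv ℝ (fun q : BFCG.LinkVars => q.2.1 ⬝ᵥ q.2.2.2) p v) ∧
    (∀ p ∈ BFCG.linkPhaseSpace, ∀ u ∈ BFCG.tangentVectors p,
      (∀ v ∈ BFCG.tangentVectors p,
        BFCG.extDOne BFCG.bfcgLinkPotential p u v
          = BFCG.extDOne BFCG.bfLinkPotential (BFCG.flipV p) (BFCG.flipV u) (BFCG.flipV v)) ∧
      ((∀ v ∈ BFCG.tangentVectors p, BFCG.extDOne BFCG.bfcgLinkPotential p u v = 0) → u = 0)) := by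
  exact ⟨hD.existsUnique_continuitySolution,
    fun h x hs => ⟨fun l => ⟨hs.contDiff_rotation l, hs.contDiff_translation l⟩,
      fun l t => ⟨hD.agreeOn_dσ_target hs l t, hD.agreeOn_db_target hs l t⟩,
      fun l t => ⟨D.linkVars_mem l h x t, (hs.hasDerivAt_linkVars l t).differentiableAt⟩,
      D.potential_eq_sum_boundaryIntegral, hD.potential_eq_sum_links hs⟩,
    fun p hp v _ => ⟨BFCG.bfLinkPotential_eq_canonicalForm hp v, BFCG.bfcgLinkPotential_eq p v⟩,
    fun p hp u hu => ⟨fun v _ => BFCG.extDOne_bfcg_eq_flip p u v,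
      BFCG.extDOne_bfcg_nondegenerate hp hu⟩⟩
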